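/- Let $R=(R_1,\dots,R_k)$ be a sequence of rectangles, $R_i$ with $r_i>0$ rows of length $s_i>0$, and let $n=\sum_i r_is_i$. Let $V$ be the set of tuples $T=T_1\otimes\cdots\otimes T_k$ of semistandard tableaux (English notation), $T_i$ of shape $R_i$, in which each of $1,\dots,n$ is used exactly once (the weight $0$ elements of the tensor product of Kirillov–Reshetikhin crystals). The reading word of a tableau lists its rows from bottom to top, each from left to right; $\mathsf{rw}(T)$ is the concatenation $\mathsf{rw}(T_1)\cdots\mathsf{rw}(T_k)$. Write $\mathrm{jdt}_a$ for the jeu de taquin slide starting at the box $a$ (or at the box that contains the entry $a$, which is erased first). The promotion $\mathrm{pr}(T)$ is computed in each factor $T_i$: perform the slide $\mathrm{jdt}_n$ at the outer box $n$, if $n$ occurs in $T_i$, put $0$ in the box that it leaves empty on the inner boundary, and increase all entries of $T_i$ by $1$. The descent set $D(T)\subseteq\{1,\dots,n\}$ consists of all $i\in\{1,\dots,n-1\}$ such that $i+1$ appears to the left of $i$ in $\mathsf{rw}(T)$, together with $n$ if $1\in\{1,\dots,n-1\}$ is such a descent of $\mathrm{pr}(T)$. The Kirillov–Reshetikhin dual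 equivalence graph $\mathcal T(R)$ has vertex set $V$; two vertices $T,T'$ are joined by an (undirected) edge if $T'=g(T)$ or $T=g(T')$ for one of the following partially defined moves $g$. 1. $t_i$, $1\le i\le n-1$: swap $i$ and $i+1$; defined if the result $T'$ lies in $V$ and $D(T)$, $D(T')$ are incomparable with respect to inclusion. 2. $t_n$: if $n\in T_\ell$ and $1\in T_j$ with $\ell\ne j$, perform $\mathrm{jdt}_n$ on $T_\ell$ and put $1$ in the resulting inner box, and perform $\mathrm{jdt}_1$ on $T_j$ and put $n$ in the resulting outer box; defined if the result $T'$ lies in $V$ and $D(T)$, $D(T')$ are incomparable. 3. $\bar t_1$: if $1,2,n$ are in the same factor $T_j$, appear in its reading word in the order $n,1,2$, and $n\in D(T)$, apply to $T_j$ the slide $\mathrm{jdt}_n$, which leaves an inner box $*$, switch $1$ and $2$, perform the slide $\mathrm{jdt}_*$, and put $n$ in the resulting outer box. 4. $\bar t_{n-1}$: if $1,n-1,n$ are in the same factor $T_j$, $n$ appears to the left of $n-1$ in its reading word, and $n\notin D(T)$, apply to $T_j$ the slide $\mathrm{jdt}_n$ and put $1$ in the resulting inner box; perform $\mathrm{jdt}_{n-1}$,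 which leaves an inner box $*$; perform the slide $\mathrm{jdt}_1$ at the entry $1$ in the first row, then the slide $\mathrm{jdt}_*$; finally put $n$ in the outer box left by the slide $\mathrm{jdt}_1$ and $n-1$ in the outer box left by the slide $\mathrm{jdt}_*$. **Proposition.** Promotion $\mathrm{pr}$ maps $V$ bijectively onto $V$ and is an automorphism of the graph $\mathcal T(R)$. Moreover, for every $T\in V$, $D(\mathrm{pr}(T))=\{\,i+1 : i\in D(T)\,\}$, where addition is taken in $\mathbb Z/n\mathbb Z$. -/

import Mathlib

namespace KRDual

/-! ### Fillings and jeu de taquin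

Cells are pairs `(a, b)` (row, column), counted from `0`, in English notation. A filling is a function
`ℕ → ℕ → ℕ`; the value `0` means that the cell is empty, as in Mathlib's `SemistandardYoungTableau`. -/

/-- A filling of finitely many cells by positive integers; `0` marks an empty cell. -/
abbrev Filling := ℕ → ℕ → ℕ

/-- Put the value `v` into the cell `c`. -/
def setCell (T : Filling) (c : ℕ × ℕ) (v : ℕ) : Filling :=
  fun a b => if a = c.1 ∧ b = c.2 then v else T a b

/-- Slide the entry of the cell `src` into the cell `dst`, leaving `src` empty. -/
def moveCell (T : Filling) (src dst : ℕ × ℕ) : Filling :=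
  setCell (setCell T dst (T src.1 src.2)) src 0

/-- The entry above the cell (`0` if there is none). -/
def entryAbove (T : Filling) (c : ℕ × ℕ) : ℕ := if c.1 = 0 then 0 else T (c.1 - 1) c.2

/-- The entry to the left of the cell (`0` if there is none). -/
def entryLeft (T : Filling) (c : ℕ × ℕ) : ℕ := if c.2 = 0 then 0 else T c.1 (c.2 - 1)

/-- One step of a slide that starts at an outer box. The state is the filling with the position of
the box `*`. The larger one of the entries above and to the left moves into `*`; if they are equal,
the upper one moves down; if there is none, nothing happens. -/
def stepOuter (p : Filling × (ℕ × ℕ)) : Filling × (ℕ × ℕ) :=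
  if entryAbove p.1 p.2 = 0 ∧ entryLeft p.1 p.2 = 0 then p
  else if entryLeft p.1 p.2 ≤ entryAbove p.1 p.2 then
    (moveCell p.1 (p.2.1 - 1, p.2.2) p.2, (p.2.1 - 1, p.2.2))
  else (moveCell p.1 (p.2.1, p.2.2 - 1) p.2, (p.2.1, p.2.2 - 1))

/-- The jeu de taquin slide of `T` at the outer box `c` (whose content is erased first): the resulting
filling, and the position of the empty box that it leaves on the inner boundary. -/
def jdtOuter (T : Filling) (c : ℕ × ℕ) : Filling × (ℕ × ℕ) :=
  stepOuter^[c.1 + c.2] (setCell T c 0, c)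

/-- One step of a slide that starts at an inner box: the smaller one of the entries below and to the
right moves into `*`; if they are equal, the lower one moves up; if there is none, nothing happens. -/
def stepInner (p : Filling × (ℕ × ℕ)) : Filling × (ℕ × ℕ) :=
  let below := p.1 (p.2.1 + 1) p.2.2
  let right := p.1 p.2.1 (p.2.2 + 1)
  if below = 0 ∧ right = 0 then p
  else if right = 0 ∨ (below ≠ 0 ∧ below ≤ right) then
    (moveCell p.1 (p.2.1 + 1, p.2.2) p.2, (p.2.1 + 1, p.2.2))
  else (moveCell p.1 (p.2.1, p.2.2 + 1) p.2, (p.2.1, p.2.2 + 1))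

/-- The jeu de taquin slide at the inner box `c` (whose content is erased first) of a filling `T` that is
empty outside the rectangle with `r` rows and `s` columns: the resulting filling, and the position
of the empty box that it leaves on the outer boundary. A slide has at most `r + s` steps. -/
def jdtInner (r s : ℕ) (T : Filling) (c : ℕ × ℕ) : Filling × (ℕ × ℕ) :=
  stepInner^[r + s] (setCell T c 0, c)

/-- The cells of the rectangle with `r` rows and `s` columns in the order of the row reading: rows from
bottom to top, each row from left to right. -/
def cellList (r s : ℕ) : List (ℕ × ℕ) :=
  (List.range r).reverse.flatMap fun a => (List.range s).map fun b => (a, b)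

/-- Promotion with respect to `n` of a filling of the `r × s` rectangle: all cells with entry `n` become
outer boxes, the slides at them are performed one after the other, the empty cells count as `0`,
and finally all entries of the rectangle are increased by `1`. -/
def promote (r s n : ℕ) (T : Filling) : Filling :=
  let U := ((cellList r s).filter fun c => T c.1 c.2 = n).foldl (fun U c => (jdtOuter U c).1) T
  fun a b => if a < r ∧ b < s then U a b + 1 else 0

/-- The row reading word of a filling of the `r × s` rectangle. -/
def rowWord (r s : ℕ) (T : Filling) : List ℕ := (cellList r s).map fun c => T c.1 c.2

/-! ### Tensor products of rectangular tableaux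

The `i`-th rectangle has `r i` rows and `s i` columns. -/

section Tensor

variable {k : ℕ} (r s : Fin k → ℕ)

/-- The total number of cells. -/
def size : ℕ := ∑ i, r i * s i

/-- The Young diagram with `r` rows of length `s`. -/
def rectangle (r s : ℕ) : YoungDiagram where
  cells := Finset.range r ×ˢ Finset.range s
  isLowerSet := by
    rintro ⟨a, b⟩ ⟨a', b'⟩ h hab
    have h1 : a' ≤ a := h.1
    have h2 : b' ≤ b := h.2
    simp only [Finset.coe_product, Finset.coe_range, Set.mem_prod, Set.mem_Iio] at hab ⊢
    omega

/-- The elements of weight `0` of the tensor product of Kirillov-Reshetikhin crystals: tuples of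
semistandard tableaux of the given rectangular shapes with entries in `{1, …, n}`, where `n` is the
total number of cells, in which each of `1, …, n` occurs exactly once. -/
def Vertex : Type :=
  {T : ∀ i, SemistandardYoungTableau (rectangle (r i) (s i)) //
    (∀ i a b, a < r i → b < s i → T i a b ∈ Finset.Icc 1 (size r s)) ∧
    ∀ m ∈ Finset.Icc 1 (size r s), ∃! c : Fin k × ℕ × ℕ, T c.1 c.2.1 c.2.2 = m}

/-- The underlying tuple of fillings. -/
def Vertex.filling {k : ℕ} {r s : Fin k → ℕ} (T : Vertex r s) : Fin k → Filling :=
  fun i a b => T.1 i a b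

/-- Promotion of a tensor product, with respect to the total number of cells, factor by factor. -/
def pr (T : Fin k → Filling) : Fin k → Filling :=
  fun i => promote (r i) (s i) (size r s) (T i)

/-- The row reading word of a tensor product: the row reading words of the factors one after the
other, from left to right. -/
def rw (T : Fin k → Filling) : List ℕ :=
  (List.finRange k).flatMap fun i => rowWord (r i) (s i) (T i)

/-- The `i ∈ {1, …, n - 1}` such that `i + 1` appears to the left of `i` in the reading word. -/
def classicalDescents (T : Fin k → Filling) : Set ℕ :=
  {i | 1 ≤ i ∧ i < size r s ∧ [i + 1, i].Sublist (rw r s T)}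

/-- The descent set, a subset of `{1, …, n}`: besides the descents in `{1, …, n - 1}` it contains `n` if
`1` is a descent of the promotion. -/
def descentSet (T : Fin k → Filling) : Set ℕ :=
  classicalDescents r s T ∪ {i | i = size r s ∧ 1 ∈ classicalDescents r s (pr r s T)}

/-- The descent sets of the two tensor products are incomparable with respect to inclusion. -/
def Incomparable (T T' : Fin k → Filling) : Prop :=
  ¬ descentSet r s T ⊆ descentSet r s T' ∧ ¬ descentSet r s T' ⊆ descentSet r s T

/-- `t_i(T) = T'` for `1 ≤ i ≤ n - 1`: the entries `i` and `i + 1` are swapped. -/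
def MoveSwap (T T' : Fin k → Filling) : Prop :=
  ∃ i, 1 ≤ i ∧ i < size r s ∧ (T' = fun j a b => Equiv.swap i (i + 1) (T j a b)) ∧
    Incomparable r s T T'

/-- `t_n(T) = T'`: the entry `n` of the factor `l` and the entry `1` of another factor `j` are
removed, the slides at these boxes are performed, and the boxes that they leave are filled with `1` in the
factor `l` and with `n` in the factor `j`. -/
def MoveAffine (T T' : Fin k → Filling) : Prop :=
  ∃ (l j : Fin k) (c d : ℕ × ℕ), l ≠ j ∧ T l c.1 c.2 = size r s ∧ T j d.1 d.2 = 1 ∧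
    (let P := jdtOuter (T l) c
     let Q := jdtInner (r j) (s j) (T j) d
     T' = Function.update (Function.update T l (setCell P.1 P.2 1)) j
       (setCell Q.1 Q.2 (size r s))) ∧
    Incomparable r s T T'

/-- `\bar t_1(T) = T'`: the entries `n, 1, 2` are in the same factor, they appear in this order in its
reading word (then `1` and `2` are neighbours in the first row), and `n` is a descent of `T`. The
slide at `n` is performed, `1` and `2` are switched, the slide at the box that the first slide has
left is performed, and the resulting outer box is filled with `n`. -/
def MoveBarOne (T T' : Fin k → Filling) : Prop :=
  ∃ (j : Fin k) (c : ℕ × ℕ),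
    [size r s, 1, 2].Sublist (rowWord (r j) (s j) (T j)) ∧
    size r s ∈ descentSet r s T ∧
    T j c.1 c.2 = size r s ∧
    (let P := jdtOuter (T j) c
     let Q := jdtInner (r j) (s j) (fun a b => Equiv.swap 1 2 (P.1 a b)) P.2
     T' = Function.update T j (setCell Q.1 Q.2 (size r s)))

/-- `\bar t_{n-1}(T) = T'`: the entries `1, n - 1, n` are in the same factor, `n` appears to the left of
`n - 1` in its reading word, and `n` is not a descent of `T`. The slide at `n` is performed and the box
that it leaves is filled with `1`; the slide at `n - 1` is performed and leaves a box `*`; the slide at the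
entry `1` in the first row is performed, then the slide at `*`; finally the outer box left by the slide
at `1` is filled with `n` and the one left by the slide at `*` with `n - 1`. -/
def MoveBarLast (T T' : Fin k → Filling) : Prop :=
  ∃ (j : Fin k) (c d : ℕ × ℕ) (b : ℕ),
    1 ∈ rowWord (r j) (s j) (T j) ∧
    [size r s, size r s - 1].Sublist (rowWord (r j) (s j) (T j)) ∧
    size r s ∉ descentSet r s T ∧
    T j c.1 c.2 = size r s ∧
    (let P := jdtOuter (T j) c
     let U := setCell P.1 P.2 1
     let Q := jdtOuter U d
     let X := jdtInner (r j) (s j) Q.1 (0, b)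
     let Y := jdtInner (r j) (s j) X.1 Q.2
     U d.1 d.2 = size r s - 1 ∧ Q.1 0 b = 1 ∧
     T' = Function.update T j (setCell (setCell Y.1 X.2 (size r s)) Y.2 (size r s - 1)))

/-- The Kirillov-Reshetikhin dual equivalence graph: two different vertices are adjacent if one of them is
obtained from the other by one of the moves. -/
def krGraph : SimpleGraph (Vertex r s) :=
  SimpleGraph.fromRel fun T T' =>
    MoveSwap r s T.filling T'.filling ∨ MoveAffine r s T.filling T'.filling ∨
    MoveBarOne r s T.filling T'.filling ∨ MoveBarLast r s T.filling T'.filling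

end Tensor

end KRDual

namespace KRDual

/-! ### Words of cells

A tensor product of standard fillings is the same as the word whose `v`-th letter is the cell that
contains the entry `v`. A cell of the tensor product is a triple (factor, row, column). -/

/-! Record a tuple of standard fillings as the word `q` whose v-th letter is the cell of the entry
v, and give each cell its content, shifted so that different factors are far apart. Then i is a
descent exactly when the content drops from `q i` to `q (i + 1)` (`readBefore_iff`), and two
consecutive letters may be exchanged exactly when their contents do not differ by 1. The toggle at i
exchanges them if this is allowed; it is an involution. A jeu de taquin slide is a run of toggles:
when the empty box meets the next position, it really moves if that letter is a neighbouring cell,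
and is merely renumbered otherwise (`stepOuter_iterate`, `stepInner_iterate`). Hence promotion is
the composite `prom` of the toggles at n-1, …, 1, in this order (`pr_wordFilling`), and `demote` is
its inverse.

A local check shows that passing a letter leftwards over two letters keeps their descent
(`desc_pass`), and that passing it over three letters commutes with elementary dual equivalence
(`dual_pass`). So `prom` shifts descents and elementary dual equivalences by one as long as the
indices do not wrap around. At the end of the word, two or three promotions are combined: since
distant toggles commute, the last two or three letters travel to the front as a block, up to toggles
among themselves. Those are under control because the letters 1 and 2, and likewise n-1 and n, are
neighbours whenever they share a factor (`desc_prom_prom`, `prom_prom_exch`, `prom_prom_prom_exch`).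
This gives the rotation of descent sets.

For the edges, each move is expressed by words. The move t_i is an exchange, t_n is `demote` ∘ `exch
1` ∘ `prom` (`affine_filling`), \bar t_1 is `demote` ∘ `exch 2` ∘ `prom` (`barOne_filling`), and
\bar t_{n-1} is `demote`² ∘ `exch 2` ∘ `prom`² (`barLast_filling`). So promotion takes t_n, \bar
t_1, \bar t_{n-1} to t_1, t_2, \bar t_1. A swap t_i of letters in two factors becomes t_{i+1},
including t_n for i = n-1. For a swap in one factor, incomparability makes it an elementary dual
equivalence with the third letter i-1 or i+2; the descent n cannot be the reason for
incomparability, because two sweeps do not cross (`desc_prom_exch`). Its image is again a swap,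
unless the three letters are the last three, when it is an edge \bar t_{n-1} traversed backwards
(`moveBarLast_prom`). Thus edges go to edges, and as the vertex set is finite, this suffices
(`adj_iff_of_perm`). -/

/-- A word of cells; only the letters at the positions `1, …, n` matter. -/
abbrev Word (k : ℕ) := ℕ → Fin k × ℕ × ℕ

/-- The word lists the cells of the rectangles in the order of a standard filling. -/
structure IsStandard {k : ℕ} (r s : Fin k → ℕ) (q : Word k) : Prop where
  row_lt : ∀ v, 1 ≤ v → v ≤ size r s → (q v).2.1 < r (q v).1
  col_lt : ∀ v, 1 ≤ v → v ≤ size r s → (q v).2.2 < s (q v).1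
  surj : ∀ j a b, a < r j → b < s j → ∃ v, 1 ≤ v ∧ v ≤ size r s ∧ q v = (j, a, b)
  inj : ∀ u v, 1 ≤ u → u ≤ size r s → 1 ≤ v → v ≤ size r s → q u = q v → u = v
  down : ∀ u v, 1 ≤ u → u ≤ size r s → 1 ≤ v → v ≤ size r s →
    q v = ((q u).1, (q u).2.1 + 1, (q u).2.2) → u < v
  right : ∀ u v, 1 ≤ u → u ≤ size r s → 1 ≤ v → v ≤ size r s →
    q v = ((q u).1, (q u).2.1, (q u).2.2 + 1) → u < v

/-- The content of a cell, shifted so that cells in different factors have contents that are far apart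
and increase with the factor. -/
def code {k : ℕ} (n : ℕ) (c : Fin k × ℕ × ℕ) : ℤ :=
  (c.2.2 : ℤ) - c.2.1 + (2 * n + 1) * (c.1 : ℕ)

/-- Neighbouring contents. -/
abbrev Near (x y : ℤ) : Prop := x = y + 1 ∨ y = x + 1

variable {k : ℕ} {r s : Fin k → ℕ} {q : Word k}

theorem code_sub_of_fac_eq (n : ℕ) {c d : Fin k × ℕ × ℕ} (h : c.1 = d.1) :
    code n c - code n d = ((c.2.2 : ℤ) - c.2.1) - ((d.2.2 : ℤ) - d.2.1) := by
  unfold code; rw [h]; ring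

theorem area_le_size (r s : Fin k → ℕ) (j : Fin k) : r j * s j ≤ size r s :=
  Finset.single_le_sum (f := fun i => r i * s i) (fun _ _ => Nat.zero_le _) (Finset.mem_univ j)

namespace IsStandard

theorem row_lt_size (hq : IsStandard r s q) {v : ℕ} (h1 : 1 ≤ v) (hn : v ≤ size r s) :
    (q v).2.1 < size r s := by
  have h := hq.row_lt v h1 hn
  have h' := hq.col_lt v h1 hn
  have := area_le_size r s (q v).1
  nlinarith

theorem col_lt_size (hq : IsStandard r s q) {v : ℕ} (h1 : 1 ≤ v) (hn : v ≤ size r s) :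
    (q v).2.2 < size r s := by
  have h := hq.row_lt v h1 hn
  have h' := hq.col_lt v h1 hn
  have := area_le_size r s (q v).1
  nlinarith

/-- Contents within a factor lie between -(n-1) and n-1, so the shift by 2n+1 per factor leaves a
gap of at least 3. Therefore neither neighbouring contents nor two contents with a common neighbour
can come from different factors. -/
theorem code_lt_of_fac_lt (hq : IsStandard r s q) {u v : ℕ} (hu : 1 ≤ u) (hu' : u ≤ size r s)
    (hv : 1 ≤ v) (hv' : v ≤ size r s) (h : (q u).1 < (q v).1) :
    code (size r s) (q u) + 3 ≤ code (size r s) (q v) := by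
  have a1 := hq.row_lt_size hu hu'
  have a2 := hq.col_lt_size hu hu'
  have a3 := hq.row_lt_size hv hv'
  have a4 := hq.col_lt_size hv hv'
  have h' : ((q u).1 : ℕ) + 1 ≤ ((q v).1 : ℕ) := h
  unfold code
  have h2 : (((q u).1 : ℕ) : ℤ) + 1 ≤ (((q v).1 : ℕ) : ℤ) := by exact_mod_cast h'
  have h3 : (2 * (size r s : ℤ) + 1) * ((((q u).1 : ℕ) : ℤ) + 1) ≤
      (2 * (size r s : ℤ) + 1) * (((q v).1 : ℕ) : ℤ) := by
    apply mul_le_mul_of_nonneg_left h2; positivity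
  rw [mul_add, mul_one] at h3
  omega

theorem fac_eq_of_code (hq : IsStandard r s q) {u v : ℕ} (hu : 1 ≤ u) (hu' : u ≤ size r s)
    (hv : 1 ≤ v) (hv' : v ≤ size r s)
    (h : code (size r s) (q u) ≤ code (size r s) (q v) + 2)
    (h' : code (size r s) (q v) ≤ code (size r s) (q u) + 2) : (q u).1 = (q v).1 := by
  rcases lt_trichotomy (q u).1 (q v).1 with h1 | h1 | h1
  · have := hq.code_lt_of_fac_lt hu hu' hv hv' h1; omega
  · exact h1
  · have := hq.code_lt_of_fac_lt hv hv' hu hu' h1; omega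

theorem code_lt_iff_of_fac_ne (hq : IsStandard r s q) {u v : ℕ} (hu : 1 ≤ u) (hu' : u ≤ size r s)
    (hv : 1 ≤ v) (hv' : v ≤ size r s) (h : (q u).1 ≠ (q v).1) :
    code (size r s) (q u) < code (size r s) (q v) ↔ (q u).1 < (q v).1 := by
  rcases lt_or_gt_of_ne h with h1 | h1
  · have := hq.code_lt_of_fac_lt hu hu' hv hv' h1
    exact ⟨fun _ => h1, fun _ => by omega⟩
  · have := hq.code_lt_of_fac_lt hv hv' hu hu' h1
    exact ⟨fun _ => by omega, fun h2 => absurd h2 (not_lt.mpr h1.le)⟩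

theorem le_add (hq : IsStandard r s q) (d e : ℕ) : ∀ u v, 1 ≤ u → u ≤ size r s → 1 ≤ v →
    v ≤ size r s → q v = ((q u).1, (q u).2.1 + d, (q u).2.2 + e) → u ≤ v := by
  induction d with
  | zero =>
    induction e with
    | zero => intro u v hu hu' hv hv' h; exact (hq.inj u v hu hu' hv hv' (by rw [h]; rfl)).le
    | succ e ih =>
      intro u v hu hu' hv hv' h
      have h1 := hq.row_lt v hv hv'
      have h2 := hq.col_lt v hv hv'
      rw [h] at h1 h2
      obtain ⟨w, hw, hw', e1⟩ := hq.surj (q u).1 ((q u).2.1 + 0) ((q u).2.2 + e) h1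
        (by simp only at h2; omega)
      have := ih u w hu hu' hw hw' e1
      have := hq.right w v hw hw' hv hv' (by rw [h, e1]; simp [add_assoc])
      omega
  | succ d ih =>
    intro u v hu hu' hv hv' h
    have h1 := hq.row_lt v hv hv'
    have h2 := hq.col_lt v hv hv'
    rw [h] at h1 h2
    obtain ⟨w, hw, hw', e1⟩ := hq.surj (q u).1 ((q u).2.1 + d) ((q u).2.2 + e)
      (by simp only at h1; omega) h2
    have := ih u w hu hu' hw hw' e1
    have := hq.down w v hw hw' hv hv' (by rw [h, e1]; simp [add_assoc])
    omega

theorem le_of_le (hq : IsStandard r s q) {u v : ℕ} (hu : 1 ≤ u) (hu' : u ≤ size r s)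
    (hv : 1 ≤ v) (hv' : v ≤ size r s) (h : (q u).1 = (q v).1) (ha : (q u).2.1 ≤ (q v).2.1)
    (hb : (q u).2.2 ≤ (q v).2.2) : u ≤ v := by
  apply hq.le_add ((q v).2.1 - (q u).2.1) ((q v).2.2 - (q u).2.2) u v hu hu' hv hv'
  rw [h, Nat.add_sub_cancel' ha, Nat.add_sub_cancel' hb]

/-- Between two letters of equal content there are letters of both neighbouring contents. -/
theorem exists_between (hq : IsStandard r s q) {u v : ℕ} (hu : 1 ≤ u) (hv' : v ≤ size r s)
    (huv : u < v) (h : code (size r s) (q u) = code (size r s) (q v)) :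
    (∃ w, u < w ∧ w < v ∧ code (size r s) (q w) = code (size r s) (q u) + 1) ∧
    ∃ w, u < w ∧ w < v ∧ code (size r s) (q w) = code (size r s) (q u) - 1 := by
  have hu' : u ≤ size r s := by omega
  have hv : 1 ≤ v := by omega
  have hf := hq.fac_eq_of_code hu hu' hv hv' (by omega) (by omega)
  have hc := code_sub_of_fac_eq (size r s) hf
  have r1 := hq.row_lt v hv hv'
  have c1 := hq.col_lt v hv hv'
  have hlt : (q u).2.1 < (q v).2.1 := by
    by_contra hcon
    have := hq.le_of_le hv hv' hu hu' hf.symm (by omega) (by omega)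
    omega
  have hne : ∀ w, q w ≠ q u → q w ≠ q v → u ≤ w → w ≤ v → u < w ∧ w < v := by
    intro w h1 h2 h3 h4
    refine ⟨lt_of_le_of_ne h3 ?_, lt_of_le_of_ne h4 ?_⟩
    · rintro rfl; exact h1 rfl
    · rintro rfl; exact h2 rfl
  constructor
  -- The two cells are on one diagonal, so the cell to the right of the first one, and in the other
  -- half the cell below it, lies between them.
  · obtain ⟨w, hw, hw', e⟩ := hq.surj (q v).1 (q u).2.1 ((q u).2.2 + 1) (by omega) (by omega)
    have e1 : (q w).1 = (q u).1 := by rw [e, hf]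
    have e2 : (q w).2.1 = (q u).2.1 := by rw [e]
    have e3 : (q w).2.2 = (q u).2.2 + 1 := by rw [e]
    have h3 := hq.le_of_le hu hu' hw hw' e1.symm (by omega) (by omega)
    have h4 := hq.le_of_le hw hw' hv hv' (e1.trans hf) (by omega) (by omega)
    have h5 := hne w (fun h => by rw [h] at e3; omega) (fun h => by rw [h] at e2; omega) h3 h4
    exact ⟨w, h5.1, h5.2, by have := code_sub_of_fac_eq (size r s) e1; omega⟩
  · obtain ⟨w, hw, hw', e⟩ := hq.surj (q v).1 ((q u).2.1 + 1) (q u).2.2 (by omega) (by omega)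
    have e1 : (q w).1 = (q u).1 := by rw [e, hf]
    have e2 : (q w).2.1 = (q u).2.1 + 1 := by rw [e]
    have e3 : (q w).2.2 = (q u).2.2 := by rw [e]
    have h3 := hq.le_of_le hu hu' hw hw' e1.symm (by omega) (by omega)
    have h4 := hq.le_of_le hw hw' hv hv' (e1.trans hf) (by omega) (by omega)
    have h5 := hne w (fun h => by rw [h] at e2; omega) (fun h => by rw [h] at e3; omega) h3 h4
    exact ⟨w, h5.1, h5.2, by have := code_sub_of_fac_eq (size r s) e1; omega⟩

theorem code_succ_ne (hq : IsStandard r s q) {u : ℕ} (hu : 1 ≤ u) (hn : u + 1 ≤ size r s) :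
    code (size r s) (q u) ≠ code (size r s) (q (u + 1)) := by
  intro h
  obtain ⟨⟨w, h1, h2, _⟩, _⟩ := hq.exists_between hu hn (by omega) h
  omega

/-- Letters of both neighbouring contents would have to share the single position in between. -/
theorem code_add_two_ne (hq : IsStandard r s q) {u : ℕ} (hu : 1 ≤ u) (hn : u + 2 ≤ size r s) :
    code (size r s) (q u) ≠ code (size r s) (q (u + 2)) := by
  intro h
  obtain ⟨⟨w, h1, h2, h3⟩, ⟨w', h4, h5, h6⟩⟩ := hq.exists_between hu hn (by omega) h
  obtain rfl : w = w' := by omega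
  omega

theorem code_add_three (hq : IsStandard r s q) {u : ℕ} (hu : 1 ≤ u) (hn : u + 3 ≤ size r s)
    (h : code (size r s) (q u) = code (size r s) (q (u + 3))) :
    (code (size r s) (q (u + 1)) = code (size r s) (q u) + 1 ∧
      code (size r s) (q (u + 2)) = code (size r s) (q u) - 1) ∨
    (code (size r s) (q (u + 1)) = code (size r s) (q u) - 1 ∧
      code (size r s) (q (u + 2)) = code (size r s) (q u) + 1) := by
  obtain ⟨⟨w, h1, h2, h3⟩, ⟨w', h4, h5, h6⟩⟩ := hq.exists_between hu hn (by omega) h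
  have : w = u + 1 ∨ w = u + 2 := by omega
  have : w' = u + 1 ∨ w' = u + 2 := by omega
  rcases ‹w = u + 1 ∨ w = u + 2› with h7 | h7 <;> rcases this with h8 | h8 <;>
    rw [h7] at h3 <;> rw [h8] at h6
  · omega
  · exact Or.inl ⟨h3, h6⟩
  · exact Or.inr ⟨h6, h3⟩
  · omega

/-- Consecutive letters of neighbouring contents are neighbouring cells. -/
theorem succ_eq_of_near (hq : IsStandard r s q) {u : ℕ} (hu : 1 ≤ u) (hn : u + 1 ≤ size r s)
    (h : Near (code (size r s) (q u)) (code (size r s) (q (u + 1)))) :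
    q (u + 1) = ((q u).1, (q u).2.1 + 1, (q u).2.2) ∨
      q (u + 1) = ((q u).1, (q u).2.1, (q u).2.2 + 1) := by
  have hf := hq.fac_eq_of_code hu (by omega) (by omega : 1 ≤ u + 1) hn
    (by rcases h with h | h <;> omega) (by rcases h with h | h <;> omega)
  have hc := code_sub_of_fac_eq (size r s) hf
  have r1 := hq.row_lt (u + 1) (by omega) hn
  have c1 := hq.col_lt (u + 1) (by omega) hn
  have back : ¬ ((q (u + 1)).2.1 ≤ (q u).2.1 ∧ (q (u + 1)).2.2 ≤ (q u).2.2) := by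
    rintro ⟨h1, h2⟩
    have := hq.le_of_le (by omega) hn hu (by omega) hf.symm h1 h2
    omega
  -- If the next cell were strictly to the south-east, the cell to the right of `q u` would need a
  -- position strictly between two consecutive ones.
  have diag : ¬ ((q u).2.1 < (q (u + 1)).2.1 ∧ (q u).2.2 < (q (u + 1)).2.2) := by
    rintro ⟨h1, h2⟩
    obtain ⟨w, hw, hw', e⟩ := hq.surj (q (u + 1)).1 (q u).2.1 ((q u).2.2 + 1) (by omega) (by omega)
    have e1 : (q w).1 = (q (u + 1)).1 := by rw [e]
    have e2 : (q w).2.1 = (q u).2.1 := by rw [e]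
    have e3 : (q w).2.2 = (q u).2.2 + 1 := by rw [e]
    have h3 := hq.le_of_le hu (by omega) hw hw' (hf.trans e1.symm) (by omega) (by omega)
    have h4 := hq.le_of_le hw hw' (by omega) hn e1 (by omega) (by omega)
    have h5 : w = u ∨ w = u + 1 := by omega
    rcases h5 with rfl | rfl <;> omega
  have key : ((q (u + 1)).2.1 = (q u).2.1 + 1 ∧ (q (u + 1)).2.2 = (q u).2.2) ∨
      ((q (u + 1)).2.1 = (q u).2.1 ∧ (q (u + 1)).2.2 = (q u).2.2 + 1) := by
    rcases h with h | h <;> omega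
  rcases key with ⟨h1, h2⟩ | ⟨h1, h2⟩
  · left; rw [← h1, ← h2, hf]
  · right; rw [← h1, ← h2, hf]

theorem near_of_down (n : ℕ) {c d : Fin k × ℕ × ℕ} (h : d = (c.1, c.2.1 + 1, c.2.2)) :
    Near (code n c) (code n d) := by
  have := code_sub_of_fac_eq n (c := c) (d := d) (by rw [h])
  left; rw [h] at this ⊢; push_cast at this; omega

theorem near_of_right (n : ℕ) {c d : Fin k × ℕ × ℕ} (h : d = (c.1, c.2.1, c.2.2 + 1)) :
    Near (code n c) (code n d) := by
  have := code_sub_of_fac_eq n (c := c) (d := d) (by rw [h])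
  right; rw [h] at this ⊢; push_cast at this; omega

/-- The letter `1` is the upper left corner of its factor. -/
theorem one_eq (hq : IsStandard r s q) (hn : 1 ≤ size r s) : q 1 = ((q 1).1, 0, 0) := by
  have r1 := hq.row_lt 1 le_rfl hn
  have c1 := hq.col_lt 1 le_rfl hn
  obtain ⟨w, hw, hw', e⟩ := hq.surj (q 1).1 0 0 (by omega) (by omega)
  have := hq.le_of_le hw hw' le_rfl hn (by rw [e]) (by rw [e]; simp) (by rw [e]; simp)
  obtain rfl : w = 1 := by omega
  exact e

/-- The last letter is the lower right corner of its factor. -/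
theorem last_eq (hq : IsStandard r s q) (hn : 1 ≤ size r s) :
    (q (size r s)).2.1 + 1 = r (q (size r s)).1 ∧ (q (size r s)).2.2 + 1 = s (q (size r s)).1 := by
  have r1 := hq.row_lt _ hn le_rfl
  have c1 := hq.col_lt _ hn le_rfl
  obtain ⟨w, hw, hw', e⟩ := hq.surj (q (size r s)).1 (r (q (size r s)).1 - 1)
    (s (q (size r s)).1 - 1) (by omega) (by omega)
  have := hq.le_of_le hn le_rfl hw hw' (by rw [e]) (by rw [e]; simp only; omega)
    (by rw [e]; simp only; omega)
  obtain rfl : w = size r s := by omega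
  rw [Prod.ext_iff, Prod.ext_iff] at e
  simp only at e
  omega

/-- The second letter is not the corner, so it has a cell above or to its left; that cell comes
earlier and can only be the first letter. This is what makes the toggle at 1 trivial inside one
factor. -/
theorem near_one_two (hq : IsStandard r s q) (hn : 2 ≤ size r s) (h : (q 1).1 = (q 2).1) :
    Near (code (size r s) (q 1)) (code (size r s) (q 2)) := by
  have r1 := hq.row_lt 2 (by omega) hn
  have c1 := hq.col_lt 2 (by omega) hn
  have e1 := hq.one_eq (by omega)
  have hne : q 2 ≠ q 1 := fun h => by
    have := hq.inj 2 1 (by omega) hn le_rfl (by omega) h; omega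
  by_cases ha : (q 2).2.1 = 0
  · by_cases hb : (q 2).2.2 = 0
    · exact absurd (by rw [e1, h]; exact Prod.ext rfl (Prod.ext ha hb)) hne
    · obtain ⟨w, hw, hw', e⟩ := hq.surj (q 2).1 (q 2).2.1 ((q 2).2.2 - 1) (by omega) (by omega)
      have e2 : q 2 = ((q w).1, (q w).2.1, (q w).2.2 + 1) := by
        rw [e]; simp only; rw [Nat.sub_add_cancel (by omega)]
      have := hq.right w 2 hw hw' (by omega) hn e2
      obtain rfl : w = 1 := by omega
      exact near_of_right _ e2
  · obtain ⟨w, hw, hw', e⟩ := hq.surj (q 2).1 ((q 2).2.1 - 1) (q 2).2.2 (by omega) (by omega)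
    have e2 : q 2 = ((q w).1, (q w).2.1 + 1, (q w).2.2) := by
      rw [e]; simp only; rw [Nat.sub_add_cancel (by omega)]
    have := hq.down w 2 hw hw' (by omega) hn e2
    obtain rfl : w = 1 := by omega
    exact near_of_down _ e2

/-- The counterpart at the end: a cell below or to the right of the letter n-1 comes later, so it is
the letter n. -/
theorem near_last (hq : IsStandard r s q) {m : ℕ} (hm : 1 ≤ m) (hn : m + 1 = size r s)
    (h : (q m).1 = (q (m + 1)).1) :
    Near (code (size r s) (q m)) (code (size r s) (q (m + 1))) := by
  have e1 := hq.last_eq (by omega)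
  rw [← hn] at e1
  have r1 := hq.row_lt m hm (by omega)
  have c1 := hq.col_lt m hm (by omega)
  by_cases ha : (q m).2.1 + 1 < r (q m).1
  · obtain ⟨w, hw, hw', e⟩ := hq.surj (q m).1 ((q m).2.1 + 1) (q m).2.2 ha c1
    have := hq.down m w hm (by omega) hw hw' e
    obtain rfl : w = m + 1 := by omega
    exact near_of_down _ e
  · by_cases hb : (q m).2.2 + 1 < s (q m).1
    · obtain ⟨w, hw, hw', e⟩ := hq.surj (q m).1 (q m).2.1 ((q m).2.2 + 1) r1 hb
      have := hq.right m w hm (by omega) hw hw' e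
      obtain rfl : w = m + 1 := by omega
      exact near_of_right _ e
    · have := hq.le_of_le (u := m + 1) (v := m) (by omega) (by omega) hm (by omega) h.symm
        (by rw [h] at ha r1; omega) (by rw [h] at hb c1; omega)
      omega

end IsStandard

/-! ### Exchanges and toggles of two consecutive letters -/

/-- Exchange the letters at the positions `i` and `i + 1`. -/
def exch (i : ℕ) (q : Word k) : Word k := fun v => q (Equiv.swap i (i + 1) v)

/-- Exchange the letters at the positions `i` and `i + 1` unless their contents are neighbours. -/
def toggle (n i : ℕ) (q : Word k) : Word k :=
  if Near (code n (q i)) (code n (q (i + 1))) then q else exch i q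

@[simp] theorem exch_left (i : ℕ) (q : Word k) : exch i q i = q (i + 1) := by simp [exch]

@[simp] theorem exch_right (i : ℕ) (q : Word k) : exch i q (i + 1) = q i := by simp [exch]

theorem exch_of_ne {i v : ℕ} (q : Word k) (h : v ≠ i) (h' : v ≠ i + 1) : exch i q v = q v := by
  simp [exch, Equiv.swap_apply_of_ne_of_ne h h']

@[simp] theorem exch_exch (i : ℕ) (q : Word k) : exch i (exch i q) = q := by
  funext v; simp [exch]

theorem toggle_of_near {n i : ℕ} (h : Near (code n (q i)) (code n (q (i + 1)))) :
    toggle n i q = q := if_pos h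

theorem toggle_of_not_near {n i : ℕ} (h : ¬ Near (code n (q i)) (code n (q (i + 1)))) :
    toggle n i q = exch i q := if_neg h

theorem toggle_of_ne {n i v : ℕ} (q : Word k) (h : v ≠ i) (h' : v ≠ i + 1) :
    toggle n i q v = q v := by
  unfold toggle; split_ifs
  · rfl
  · exact exch_of_ne q h h'

theorem toggle_toggle (n i : ℕ) (q : Word k) : toggle n i (toggle n i q) = q := by
  by_cases h : Near (code n (q i)) (code n (q (i + 1)))
  · rw [toggle_of_near h, toggle_of_near h]
  · rw [toggle_of_not_near h, toggle_of_not_near, exch_exch]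
    rw [exch_left, exch_right]; exact fun h' => h h'.symm

theorem exch_comm {i j : ℕ} (h : i + 1 < j) (q : Word k) :
    exch i (exch j q) = exch j (exch i q) := by
  funext v
  by_cases h1 : v = i
  · subst h1
    rw [exch_left, exch_of_ne _ (by omega) (by omega), exch_of_ne _ (by omega) (by omega),
      exch_left]
  by_cases h2 : v = i + 1
  · subst h2
    rw [exch_right, exch_of_ne _ (by omega) (by omega), exch_of_ne _ (by omega) (by omega),
      exch_right]
  rw [exch_of_ne _ h1 h2]
  by_cases h3 : v = j
  · subst h3; rw [exch_left, exch_left, exch_of_ne _ (by omega) (by omega)]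
  by_cases h4 : v = j + 1
  · subst h4; rw [exch_right, exch_right, exch_of_ne _ (by omega) (by omega)]
  rw [exch_of_ne _ h3 h4, exch_of_ne _ h3 h4, exch_of_ne _ h1 h2]

theorem toggle_exch_comm (n : ℕ) {i j : ℕ} (h : i + 1 < j ∨ j + 1 < i) (q : Word k) :
    toggle n i (exch j q) = exch j (toggle n i q) := by
  have e : exch i (exch j q) = exch j (exch i q) := by
    rcases h with h | h
    · exact exch_comm h q
    · exact (exch_comm h q).symm
  unfold toggle
  rw [exch_of_ne (i := j) (v := i) _ (by omega) (by omega),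
    exch_of_ne (i := j) (v := i + 1) _ (by omega) (by omega), e]
  split_ifs <;> rfl

theorem toggle_comm (n : ℕ) {i j : ℕ} (h : i + 1 < j ∨ j + 1 < i) (q : Word k) :
    toggle n i (toggle n j q) = toggle n j (toggle n i q) := by
  by_cases h1 : Near (code n (q j)) (code n (q (j + 1)))
  · rw [toggle_of_near h1, toggle_of_near (i := j) (q := toggle n i q)]
    rwa [toggle_of_ne _ (by omega) (by omega), toggle_of_ne _ (by omega) (by omega)]
  · rw [toggle_of_not_near h1, toggle_exch_comm n h, toggle_of_not_near (i := j) (q := toggle n i q)]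
    rwa [toggle_of_ne _ (by omega) (by omega), toggle_of_ne _ (by omega) (by omega)]

theorem swap_mem {i n v : ℕ} (hi : 1 ≤ i) (hn : i + 1 ≤ n) (h : 1 ≤ v) (h' : v ≤ n) :
    1 ≤ Equiv.swap i (i + 1) v ∧ Equiv.swap i (i + 1) v ≤ n := by
  rw [Equiv.swap_apply_def]; split_ifs <;> omega

theorem lt_of_swap_lt {i u v : ℕ} (h : Equiv.swap i (i + 1) u < Equiv.swap i (i + 1) v) :
    u < v ∨ (Equiv.swap i (i + 1) u = i ∧ Equiv.swap i (i + 1) v = i + 1) := by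
  rw [Equiv.swap_apply_def, Equiv.swap_apply_def] at *
  split_ifs at * <;> omega

/-- Only the comparison of the positions i and i+1 is reversed, and cells whose contents are not
neighbours impose no condition on each other. -/
theorem IsStandard.exch (hq : IsStandard r s q) {i : ℕ} (hi : 1 ≤ i) (hn : i + 1 ≤ size r s)
    (h : ¬ Near (code (size r s) (q i)) (code (size r s) (q (i + 1)))) :
    IsStandard r s (exch i q) where
  row_lt v h1 h2 := hq.row_lt _ (swap_mem hi hn h1 h2).1 (swap_mem hi hn h1 h2).2
  col_lt v h1 h2 := hq.col_lt _ (swap_mem hi hn h1 h2).1 (swap_mem hi hn h1 h2).2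
  surj j a b ha hb := by
    obtain ⟨v, h1, h2, h3⟩ := hq.surj j a b ha hb
    refine ⟨Equiv.swap i (i + 1) v, (swap_mem hi hn h1 h2).1, (swap_mem hi hn h1 h2).2, ?_⟩
    simpa [KRDual.exch] using h3
  inj u v h1 h2 h3 h4 h5 := by
    have := hq.inj _ _ (swap_mem hi hn h1 h2).1 (swap_mem hi hn h1 h2).2
      (swap_mem hi hn h3 h4).1 (swap_mem hi hn h3 h4).2 h5
    exact (Equiv.swap i (i + 1)).injective this
  down u v h1 h2 h3 h4 h5 := by
    have := hq.down _ _ (swap_mem hi hn h1 h2).1 (swap_mem hi hn h1 h2).2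
      (swap_mem hi hn h3 h4).1 (swap_mem hi hn h3 h4).2 h5
    rcases lt_of_swap_lt this with h6 | ⟨h6, h7⟩
    · exact h6
    · rw [KRDual.exch, KRDual.exch, h6, h7] at h5
      exact absurd (near_of_down _ h5) h
  right u v h1 h2 h3 h4 h5 := by
    have := hq.right _ _ (swap_mem hi hn h1 h2).1 (swap_mem hi hn h1 h2).2
      (swap_mem hi hn h3 h4).1 (swap_mem hi hn h3 h4).2 h5
    rcases lt_of_swap_lt this with h6 | ⟨h6, h7⟩
    · exact h6
    · rw [KRDual.exch, KRDual.exch, h6, h7] at h5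
      exact absurd (near_of_right _ h5) h

theorem IsStandard.toggle (hq : IsStandard r s q) {i : ℕ} (hi : 1 ≤ i) (hn : i + 1 ≤ size r s) :
    IsStandard r s (toggle (size r s) i q) := by
  unfold KRDual.toggle; split_ifs with h
  · exact hq
  · exact hq.exch hi hn h

/-- Two letters that may be exchanged do not have neighbouring contents. -/
theorem IsStandard.not_near_of_exch (hq : IsStandard r s q) {i : ℕ} (hi : 1 ≤ i)
    (hn : i + 1 ≤ size r s) (hq' : IsStandard r s (KRDual.exch i q)) :
    ¬ Near (code (size r s) (q i)) (code (size r s) (q (i + 1))) := by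
  intro h
  rcases hq.succ_eq_of_near hi hn h with h' | h'
  · have := hq'.down (i + 1) i (by omega) hn hi (by omega) (by rw [exch_left, exch_right]; exact h')
    omega
  · have := hq'.right (i + 1) i (by omega) hn hi (by omega) (by rw [exch_left, exch_right]; exact h')
    omega

/-- The toggle moves the factors of the letters even if it does not move the letters. -/
theorem fac_toggle (hq : IsStandard r s q) {i : ℕ} (hi : 1 ≤ i) (hn : i + 1 ≤ size r s) (v : ℕ) :
    (toggle (size r s) i q v).1 = (q (Equiv.swap i (i + 1) v)).1 := by
  unfold toggle; split_ifs with h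
  · have hf := hq.fac_eq_of_code hi (by omega) (by omega : 1 ≤ i + 1) hn
      (by rcases h with h | h <;> omega) (by rcases h with h | h <;> omega)
    rw [Equiv.swap_apply_def]; split_ifs with h1 h2
    · rw [h1, hf]
    · rw [h2, hf]
    · rfl
  · rfl

/-! ### Toggles of four consecutive letters -/

section Local
variable {β : Type*} (f : β → ℤ)

/-- Toggles on bare quadruples with an integer-valued function: the local identities become case
distinctions in linear arithmetic, free of any tableaux. -/
def toggleFst (p : β × β × β × β) : β × β × β × β :=
  if Near (f p.1) (f p.2.1) then p else (p.2.1, p.1, p.2.2)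

def toggleSnd (p : β × β × β × β) : β × β × β × β :=
  if Near (f p.2.1) (f p.2.2.1) then p else (p.1, p.2.2.1, p.2.1, p.2.2.2)

def toggleTrd (p : β × β × β × β) : β × β × β × β :=
  if Near (f p.2.2.1) (f p.2.2.2) then p else (p.1, p.2.1, p.2.2.2, p.2.2.1)

/-- `x` lies strictly between `y` and `z`. -/
abbrev Btw (x y z : ℤ) : Prop := (y < x ∧ x < z) ∨ (z < x ∧ x < y)

/-- The elementary dual equivalence of the first three letters. -/
def dualFst (p : β × β × β × β) : β × β × β × β :=
  if Btw (f p.1) (f p.2.1) (f p.2.2.1) then (p.1, p.2.2.1, p.2.1, p.2.2.2)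
  else if Btw (f p.2.2.1) (f p.1) (f p.2.1) then (p.2.1, p.1, p.2.2)
  else p

/-- The elementary dual equivalence of the last three letters. -/
def dualSnd (p : β × β × β × β) : β × β × β × β :=
  if Btw (f p.2.1) (f p.2.2.1) (f p.2.2.2) then (p.1, p.2.1, p.2.2.2, p.2.2.1)
  else if Btw (f p.2.2.2) (f p.2.1) (f p.2.2.1) then (p.1, p.2.2.1, p.2.1, p.2.2.2)
  else p

-- The fourth letter passes to the front; where it meets a neighbouring content, it stops and the
-- blocking letter travels on. Each stop changes the contents involved only by 1, which turns a
-- between-relation of the first three letters into one of the last three. The hypotheses are what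
-- standardness gives at distance one, two and three; `h6` restricts the case of equal outer
-- contents.
set_option maxHeartbeats 1000000 in
theorem dualSnd_toggles (x y z w : β) (h1 : f x ≠ f y) (h2 : f y ≠ f z) (h3 : f z ≠ f w)
    (h4 : f x ≠ f z) (h5 : f y ≠ f w)
    (h6 : f x = f w → (f y = f x + 1 ∧ f z = f x - 1) ∨ (f y = f x - 1 ∧ f z = f x + 1)) :
    toggleFst f (toggleSnd f (toggleTrd f (dualFst f (x, y, z, w)))) =
      dualSnd f (toggleFst f (toggleSnd f (toggleTrd f (x, y, z, w)))) := by
  unfold dualFst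
  split_ifs with m1 m2
  all_goals
    simp only at *
    simp only [toggleTrd, toggleSnd, toggleFst]
    split_ifs
    all_goals
      simp only at *
      try (exfalso; omega)
    all_goals
      simp only [dualSnd]
      split_ifs <;> first | rfl | (exfalso; omega)

/-- A stop replaces a letter by one of neighbouring content, and no integer lies strictly between
the two; as the three contents are distinct, the comparison survives. If both toggles are blocked,
the outer contents lie on opposite sides of the middle one. -/
theorem desc_toggles (x y z w : β) (h1 : f x ≠ f y) (h2 : f y ≠ f z) (h3 : f x ≠ f z) :
    f (toggleFst f (toggleSnd f (x, y, z, w))).2.2.1 < f (toggleFst f (toggleSnd f (x, y, z, w))).2.1 ↔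
      f y < f x := by
  simp only [toggleSnd, toggleFst]
  split_ifs <;> simp only at * <;> omega

/-- The passing letter can be stopped by at most one of the two letters, so which letter arrives in
front does not depend on their order. -/
theorem exch_toggles (x y z w : β) (h1 : ¬ Near (f x) (f y))
    (h2 : ¬ (Near (f x) (f z) ∧ Near (f y) (f z))) :
    toggleFst f (toggleSnd f (y, x, z, w)) =
      ((toggleFst f (toggleSnd f (x, y, z, w))).1, (toggleFst f (toggleSnd f (x, y, z, w))).2.2.1,
        (toggleFst f (toggleSnd f (x, y, z, w))).2.1,
        (toggleFst f (toggleSnd f (x, y, z, w))).2.2.2) := by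
  simp only [toggleSnd, toggleFst]
  split_ifs <;> simp only at * <;> first | rfl | (exfalso; omega)

end Local

/-! ### Elementary dual equivalence and descents of words -/

/-- The letters at four consecutive positions. -/
def block (j : ℕ) (q : Word k) :
    (Fin k × ℕ × ℕ) × (Fin k × ℕ × ℕ) × (Fin k × ℕ × ℕ) × (Fin k × ℕ × ℕ) :=
  (q j, q (j + 1), q (j + 2), q (j + 3))

theorem eq_of_block_eq {j : ℕ} {p q : Word k} (h : block j p = block j q)
    (h' : ∀ v, v < j ∨ j + 3 < v → p v = q v) : p = q := by
  simp only [block, Prod.mk.injEq] at h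
  funext v
  by_cases h1 : v < j ∨ j + 3 < v
  · exact h' v h1
  · obtain rfl | rfl | rfl | rfl : v = j ∨ v = j + 1 ∨ v = j + 2 ∨ v = j + 3 := by omega
    exacts [h.1, h.2.1, h.2.2.1, h.2.2.2]

theorem block_exch_zero (j : ℕ) (q : Word k) :
    block j (exch j q) = (q (j + 1), q j, q (j + 2), q (j + 3)) := by
  unfold block
  rw [exch_left, exch_right, exch_of_ne (v := j + 2) _ (by omega) (by omega),
    exch_of_ne (v := j + 3) _ (by omega) (by omega)]

theorem block_exch_one (j : ℕ) (q : Word k) :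
    block j (exch (j + 1) q) = (q j, q (j + 2), q (j + 1), q (j + 3)) := by
  unfold block
  rw [exch_left, show exch (j + 1) q (j + 2) = q (j + 1) from exch_right _ _,
    exch_of_ne (v := j) _ (by omega) (by omega), exch_of_ne (v := j + 3) _ (by omega) (by omega)]

theorem block_exch_two (j : ℕ) (q : Word k) :
    block j (exch (j + 2) q) = (q j, q (j + 1), q (j + 3), q (j + 2)) := by
  unfold block
  rw [exch_left, show exch (j + 2) q (j + 3) = q (j + 2) from exch_right _ _,
    exch_of_ne (v := j) _ (by omega) (by omega), exch_of_ne (v := j + 1) _ (by omega) (by omega)]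

theorem block_toggle_zero (n j : ℕ) (q : Word k) :
    block j (toggle n j q) = toggleFst (code n) (block j q) := by
  by_cases h : Near (code n (q j)) (code n (q (j + 1)))
  · rw [toggle_of_near h]; exact (if_pos h).symm
  · rw [toggle_of_not_near h, block_exch_zero]; exact (if_neg h).symm

theorem block_toggle_one (n j : ℕ) (q : Word k) :
    block j (toggle n (j + 1) q) = toggleSnd (code n) (block j q) := by
  by_cases h : Near (code n (q (j + 1))) (code n (q (j + 2)))
  · rw [toggle_of_near h]; exact (if_pos h).symm
  · rw [toggle_of_not_near h, block_exch_one]; exact (if_neg h).symm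

theorem block_toggle_two (n j : ℕ) (q : Word k) :
    block j (toggle n (j + 2) q) = toggleTrd (code n) (block j q) := by
  by_cases h : Near (code n (q (j + 2))) (code n (q (j + 3)))
  · rw [toggle_of_near h]; exact (if_pos h).symm
  · rw [toggle_of_not_near h, block_exch_two]; exact (if_neg h).symm

/-- The elementary dual equivalence of the letters at the positions `j`, `j + 1`, `j + 2`. -/
def dual (n j : ℕ) (q : Word k) : Word k :=
  if Btw (code n (q j)) (code n (q (j + 1))) (code n (q (j + 2))) then exch (j + 1) q
  else if Btw (code n (q (j + 2))) (code n (q j)) (code n (q (j + 1))) then exch j q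
  else q

theorem block_dual_zero (n j : ℕ) (q : Word k) :
    block j (dual n j q) = dualFst (code n) (block j q) := by
  unfold dual
  by_cases h : Btw (code n (q j)) (code n (q (j + 1))) (code n (q (j + 2)))
  · rw [if_pos h, block_exch_one]; exact (if_pos h).symm
  · rw [if_neg h]
    refine Eq.trans ?_ (if_neg h).symm
    by_cases h' : Btw (code n (q (j + 2))) (code n (q j)) (code n (q (j + 1)))
    · rw [if_pos h', block_exch_zero]; exact (if_pos h').symm
    · rw [if_neg h']; exact (if_neg h').symm

theorem block_dual_one (n j : ℕ) (q : Word k) :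
    block j (dual n (j + 1) q) = dualSnd (code n) (block j q) := by
  unfold dual
  by_cases h : Btw (code n (q (j + 1))) (code n (q (j + 2))) (code n (q (j + 3)))
  · refine Eq.trans (congrArg _ (if_pos h)) ?_
    refine Eq.trans ?_ (if_pos h).symm
    exact block_exch_two j q
  · refine Eq.trans (congrArg _ (if_neg h)) ?_
    refine Eq.trans ?_ (if_neg h).symm
    by_cases h' : Btw (code n (q (j + 3))) (code n (q (j + 1))) (code n (q (j + 2)))
    · refine Eq.trans (congrArg _ (if_pos h')) ?_
      refine Eq.trans ?_ (if_pos h').symm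
      exact block_exch_one j q
    · refine Eq.trans (congrArg _ (if_neg h')) ?_
      exact (if_neg h').symm

theorem dual_of_ne (n : ℕ) {j v : ℕ} (q : Word k) (h : v < j ∨ j + 2 < v) : dual n j q v = q v := by
  unfold dual; split_ifs
  · exact exch_of_ne _ (by omega) (by omega)
  · exact exch_of_ne _ (by omega) (by omega)
  · rfl

theorem toggle_dual_comm (n : ℕ) {i j : ℕ} (h : i + 1 < j ∨ j + 2 < i) (q : Word k) :
    toggle n i (dual n j q) = dual n j (toggle n i q) := by
  unfold dual
  rw [toggle_of_ne (v := j) _ (by omega) (by omega),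
    toggle_of_ne (v := j + 1) _ (by omega) (by omega),
    toggle_of_ne (v := j + 2) _ (by omega) (by omega)]
  split_ifs
  · exact toggle_exch_comm n (by omega) q
  · exact toggle_exch_comm n (by omega) q
  · rfl

/-- `i` is a descent of the word. -/
def Desc (n i : ℕ) (q : Word k) : Prop := code n (q (i + 1)) < code n (q i)

theorem desc_congr {n i : ℕ} {p q : Word k} (h : p i = q i) (h' : p (i + 1) = q (i + 1)) :
    Desc n i p ↔ Desc n i q := by
  unfold Desc; rw [h, h']

theorem desc_exch (n i : ℕ) (q : Word k) :
    Desc n i (exch i q) ↔ code n (q i) < code n (q (i + 1)) := by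
  unfold Desc; rw [exch_left, exch_right]

/-! ### Passing a letter through two or three letters -/

theorem desc_pass (hq : IsStandard r s q) {i : ℕ} (hi : 1 ≤ i) (hn : i + 2 ≤ size r s) :
    Desc (size r s) (i + 1) (toggle (size r s) i (toggle (size r s) (i + 1) q)) ↔
      Desc (size r s) i q := by
  have h1 := hq.code_succ_ne hi (by omega)
  have h2 := hq.code_succ_ne (u := i + 1) (by omega) (by omega)
  have h3 := hq.code_add_two_ne hi (by omega)
  simp only [add_assoc, Nat.reduceAdd] at h2
  have h4 := block_toggle_zero (size r s) i (toggle (size r s) (i + 1) q)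
  rw [block_toggle_one] at h4
  have h5 := desc_toggles (code (size r s)) (q i) (q (i + 1)) (q (i + 2)) (q (i + 3)) h1 h2 h3
  rw [show (q i, q (i + 1), q (i + 2), q (i + 3)) = block i q from rfl, ← h4] at h5
  exact h5

theorem exch_pass (hq : IsStandard r s q) {i : ℕ} (hi : 1 ≤ i) (hn : i + 2 ≤ size r s)
    (hf : (q i).1 ≠ (q (i + 1)).1) :
    toggle (size r s) i (toggle (size r s) (i + 1) (exch i q)) =
      exch (i + 1) (toggle (size r s) i (toggle (size r s) (i + 1) q)) := by
  have h1 : ¬ Near (code (size r s) (q i)) (code (size r s) (q (i + 1))) := fun h =>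
    hf (hq.fac_eq_of_code hi (by omega) (by omega) (by omega) (by rcases h with h | h <;> omega)
      (by rcases h with h | h <;> omega))
  -- A common neighbour would bring the two contents within distance 2, hence into one factor.
  have h2 : ¬ (Near (code (size r s) (q i)) (code (size r s) (q (i + 2))) ∧
      Near (code (size r s) (q (i + 1))) (code (size r s) (q (i + 2)))) := fun ⟨h, h'⟩ =>
    hf (hq.fac_eq_of_code hi (by omega) (by omega) (by omega) (by omega) (by omega))
  apply eq_of_block_eq (j := i)
  · have h4 := block_toggle_zero (size r s) i (toggle (size r s) (i + 1) q)
    rw [block_toggle_one] at h4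
    have h5 := exch_toggles (code (size r s)) (q i) (q (i + 1)) (q (i + 2)) (q (i + 3)) h1 h2
    rw [show (q i, q (i + 1), q (i + 2), q (i + 3)) = block i q from rfl, ← h4] at h5
    rw [block_toggle_zero, block_toggle_one, block_exch_zero, block_exch_one, h5]
    rfl
  · intro v hv
    simp only [toggle_of_ne (i := i) (v := v) _ (by omega : v ≠ i) (by omega),
      toggle_of_ne (i := i + 1) (v := v) _ (by omega : v ≠ i + 1) (by omega),
      exch_of_ne (i := i) (v := v) _ (by omega : v ≠ i) (by omega),
      exch_of_ne (i := i + 1) (v := v) _ (by omega : v ≠ i + 1) (by omega)]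

theorem dual_pass (hq : IsStandard r s q) {j : ℕ} (hj : 1 ≤ j) (hn : j + 3 ≤ size r s) :
    toggle (size r s) j (toggle (size r s) (j + 1) (toggle (size r s) (j + 2)
      (dual (size r s) j q))) =
    dual (size r s) (j + 1) (toggle (size r s) j (toggle (size r s) (j + 1)
      (toggle (size r s) (j + 2) q))) := by
  apply eq_of_block_eq (j := j)
  · rw [block_toggle_zero, block_toggle_one, block_toggle_two, block_dual_zero, block_dual_one,
      block_toggle_zero, block_toggle_one, block_toggle_two]
    have h2 := hq.code_succ_ne (u := j + 1) (by omega) (by omega)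
    have h3 := hq.code_succ_ne (u := j + 2) (by omega) (by omega)
    have h5 := hq.code_add_two_ne (u := j + 1) (by omega) (by omega)
    simp only [add_assoc, Nat.reduceAdd] at h2 h3 h5
    exact dualSnd_toggles _ _ _ _ _ (hq.code_succ_ne hj (by omega)) h2 h3
      (hq.code_add_two_ne hj (by omega)) h5 (hq.code_add_three hj hn)
  · intro v hv
    rw [dual_of_ne _ _ (by omega), toggle_of_ne _ (by omega) (by omega),
      toggle_of_ne _ (by omega) (by omega), toggle_of_ne _ (by omega) (by omega),
      toggle_of_ne _ (by omega) (by omega), toggle_of_ne _ (by omega) (by omega),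
      toggle_of_ne _ (by omega) (by omega), dual_of_ne _ _ (by omega)]

/-- Toggles are involutions, so this is `desc_pass` for the word reached after the backward passage;
the lemmas below reverse `exch_pass` and `dual_pass` in the same way. -/
theorem desc_pass_back (hq : IsStandard r s q) {i : ℕ} (hi : 1 ≤ i) (hn : i + 2 ≤ size r s) :
    Desc (size r s) i (toggle (size r s) (i + 1) (toggle (size r s) i q)) ↔
      Desc (size r s) (i + 1) q := by
  have h := desc_pass ((hq.toggle hi (by omega)).toggle (i := i + 1) (by omega) (by omega)) hi hn
  rw [toggle_toggle, toggle_toggle] at h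
  exact h.symm

theorem fac_toggle_right (hq : IsStandard r s q) {i : ℕ} (hi : 1 ≤ i) (hn : i + 1 ≤ size r s) :
    (toggle (size r s) i q (i + 1)).1 = (q i).1 := by
  rw [fac_toggle hq hi hn, Equiv.swap_apply_right]

theorem fac_toggle_left (hq : IsStandard r s q) {i : ℕ} (hi : 1 ≤ i) (hn : i + 1 ≤ size r s) :
    (toggle (size r s) i q i).1 = (q (i + 1)).1 := by
  rw [fac_toggle hq hi hn, Equiv.swap_apply_left]

theorem fac_pass_back (hq : IsStandard r s q) {i : ℕ} (hi : 1 ≤ i) (hn : i + 2 ≤ size r s) :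
    (toggle (size r s) (i + 1) (toggle (size r s) i q) i).1 = (q (i + 1)).1 ∧
    (toggle (size r s) (i + 1) (toggle (size r s) i q) (i + 1)).1 = (q (i + 2)).1 := by
  constructor
  · rw [toggle_of_ne _ (by omega) (by omega), fac_toggle_left hq hi (by omega)]
  · rw [fac_toggle_left (hq.toggle hi (by omega)) (by omega) (by omega),
      toggle_of_ne _ (by omega) (by omega)]

theorem exch_pass_back (hq : IsStandard r s q) {i : ℕ} (hi : 1 ≤ i) (hn : i + 2 ≤ size r s)
    (hf : (q (i + 1)).1 ≠ (q (i + 2)).1) :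
    toggle (size r s) (i + 1) (toggle (size r s) i (exch (i + 1) q)) =
      exch i (toggle (size r s) (i + 1) (toggle (size r s) i q)) := by
  have hp := (hq.toggle hi (by omega)).toggle (i := i + 1) (by omega) (by omega)
  have hfac := fac_pass_back hq hi hn
  have h := exch_pass hp hi hn (by rw [hfac.1, hfac.2]; exact hf)
  rw [toggle_toggle, toggle_toggle] at h
  rw [← h, toggle_toggle, toggle_toggle]

theorem dual_pass_back (hq : IsStandard r s q) {j : ℕ} (hj : 1 ≤ j) (hn : j + 3 ≤ size r s) :
    toggle (size r s) (j + 2) (toggle (size r s) (j + 1) (toggle (size r s) j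
      (dual (size r s) (j + 1) q))) =
    dual (size r s) j (toggle (size r s) (j + 2) (toggle (size r s) (j + 1)
      (toggle (size r s) j q))) := by
  have hp := ((hq.toggle hj (by omega)).toggle (i := j + 1) (by omega) (by omega)).toggle
    (i := j + 2) (by omega) (by omega)
  have h := dual_pass hp hj hn
  rw [toggle_toggle, toggle_toggle, toggle_toggle] at h
  rw [← h, toggle_toggle, toggle_toggle, toggle_toggle]

/-! ### Sweeps -/

/-- The toggles at `m, m - 1, …, 1`, in this order. -/
def sweep (n : ℕ) : ℕ → Word k → Word k
  | 0, q => q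
  | m + 1, q => sweep n m (toggle n (m + 1) q)

/-- The toggles at `1, 2, …, m`, in this order. -/
def unsweep (n : ℕ) : ℕ → Word k → Word k
  | 0, q => q
  | m + 1, q => toggle n (m + 1) (unsweep n m q)

theorem unsweep_sweep (n m : ℕ) (q : Word k) : unsweep n m (sweep n m q) = q := by
  induction m generalizing q with
  | zero => rfl
  | succ m ih => rw [unsweep, sweep, ih, toggle_toggle]

theorem sweep_unsweep (n m : ℕ) (q : Word k) : sweep n m (unsweep n m q) = q := by
  induction m generalizing q with
  | zero => rfl
  | succ m ih => rw [unsweep, sweep, toggle_toggle, ih]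

theorem IsStandard.sweep (hq : IsStandard r s q) {m : ℕ} (hm : m + 1 ≤ size r s) :
    IsStandard r s (sweep (size r s) m q) := by
  induction m generalizing q with
  | zero => exact hq
  | succ m ih => exact ih (hq.toggle (by omega) (by omega)) (by omega)

theorem IsStandard.unsweep (hq : IsStandard r s q) {m : ℕ} (hm : m + 1 ≤ size r s) :
    IsStandard r s (unsweep (size r s) m q) := by
  induction m with
  | zero => exact hq
  | succ m ih => exact (ih (by omega)).toggle (by omega) (by omega)

theorem sweep_of_lt (n : ℕ) {m v : ℕ} (q : Word k) (h : m + 1 < v) : sweep n m q v = q v := by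
  induction m generalizing q with
  | zero => rfl
  | succ m ih => rw [sweep, ih _ (by omega), toggle_of_ne _ (by omega) (by omega)]

theorem unsweep_of_lt (n : ℕ) {m v : ℕ} (q : Word k) (h : m + 1 < v) : unsweep n m q v = q v := by
  induction m with
  | zero => rfl
  | succ m ih => rw [unsweep, toggle_of_ne _ (by omega) (by omega), ih (by omega)]

theorem sweep_toggle_comm (n : ℕ) {m i : ℕ} (h : m + 1 < i) (q : Word k) :
    sweep n m (toggle n i q) = toggle n i (sweep n m q) := by
  induction m generalizing q with
  | zero => rfl
  | succ m ih => rw [sweep, sweep, toggle_comm n (by omega), ih (by omega)]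

theorem sweep_exch_comm (n : ℕ) {m i : ℕ} (h : m + 1 < i) (q : Word k) :
    sweep n m (exch i q) = exch i (sweep n m q) := by
  induction m generalizing q with
  | zero => rfl
  | succ m ih => rw [sweep, sweep, toggle_exch_comm n (by omega), ih (by omega)]

theorem sweep_dual_comm (n : ℕ) {m j : ℕ} (h : m + 1 < j) (q : Word k) :
    sweep n m (dual n j q) = dual n j (sweep n m q) := by
  induction m generalizing q with
  | zero => rfl
  | succ m ih => rw [sweep, sweep, toggle_dual_comm n (by omega), ih (by omega)]

theorem fac_sweep (hq : IsStandard r s q) {m : ℕ} (hm : m + 1 ≤ size r s) :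
    (sweep (size r s) m q 1).1 = (q (m + 1)).1 ∧
      ∀ v, 1 ≤ v → v ≤ m → (sweep (size r s) m q (v + 1)).1 = (q v).1 := by
  induction m generalizing q with
  | zero => exact ⟨rfl, fun v h h' => by omega⟩
  | succ m ih =>
    obtain ⟨h1, h2⟩ := ih (hq.toggle (i := m + 1) (by omega) (by omega)) (by omega)
    refine ⟨?_, fun v hv hv' => ?_⟩
    · rw [sweep, h1, fac_toggle_left hq (by omega) hm]
    · rcases Nat.lt_or_ge m v with h | h
      · obtain rfl : v = m + 1 := by omega
        rw [sweep, sweep_of_lt _ _ (by omega), fac_toggle_right hq (by omega) hm]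
      · rw [sweep, h2 v hv h, toggle_of_ne _ (by omega) (by omega)]

/-- The toggles above i+1 act to the right of the pair at i, i+1; those at i+1 and i pass one letter
over the pair; the remaining ones act to the left of its new place. `sweep_exch` and `sweep_dual`
follow the same pattern. -/
theorem desc_sweep (hq : IsStandard r s q) {i m : ℕ} (hi : 1 ≤ i) (him : i + 1 ≤ m)
    (hm : m + 1 ≤ size r s) :
    Desc (size r s) (i + 1) (sweep (size r s) m q) ↔ Desc (size r s) i q := by
  induction m, him using Nat.le_induction generalizing q with
  | base =>
    obtain ⟨i, rfl⟩ : ∃ l, i = l + 1 := ⟨i - 1, by omega⟩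
    rw [sweep, sweep, desc_congr (sweep_of_lt _ _ (by omega)) (sweep_of_lt _ _ (by omega))]
    exact desc_pass hq hi hm
  | succ m him ih =>
    rw [sweep, ih (hq.toggle (by omega) hm) (by omega)]
    exact desc_congr (toggle_of_ne _ (by omega) (by omega)) (toggle_of_ne _ (by omega) (by omega))

theorem sweep_exch (hq : IsStandard r s q) {i m : ℕ} (hi : 1 ≤ i) (him : i + 1 ≤ m)
    (hm : m + 1 ≤ size r s) (hf : (q i).1 ≠ (q (i + 1)).1) :
    sweep (size r s) m (exch i q) = exch (i + 1) (sweep (size r s) m q) := by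
  induction m, him using Nat.le_induction generalizing q with
  | base =>
    obtain ⟨i, rfl⟩ : ∃ l, i = l + 1 := ⟨i - 1, by omega⟩
    rw [sweep, sweep, exch_pass hq hi hm hf, sweep_exch_comm _ (by omega)]
    rfl
  | succ m him ih =>
    rw [sweep, toggle_exch_comm _ (by omega), ih (hq.toggle (by omega) hm) (by omega)]
    · rfl
    · rwa [toggle_of_ne _ (by omega) (by omega), toggle_of_ne _ (by omega) (by omega)]

theorem sweep_dual (hq : IsStandard r s q) {j m : ℕ} (hj : 1 ≤ j) (hjm : j + 2 ≤ m)
    (hm : m + 1 ≤ size r s) :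
    sweep (size r s) m (dual (size r s) j q) = dual (size r s) (j + 1) (sweep (size r s) m q) := by
  induction m, hjm using Nat.le_induction generalizing q with
  | base =>
    obtain ⟨j, rfl⟩ : ∃ l, j = l + 1 := ⟨j - 1, by omega⟩
    rw [sweep, sweep, sweep]
    refine (congrArg _ (dual_pass hq hj hm)).trans ?_
    rw [sweep_dual_comm _ (by omega)]
    rfl
  | succ m hjm ih =>
    rw [sweep, toggle_dual_comm _ (by omega), ih (hq.toggle (by omega) hm) (by omega)]
    rfl

/-! ### Two and three sweeps combined -/

/-- Two sweeps, without the comparison of the two letters that are swept. -/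
def sweepTwo (n : ℕ) : ℕ → Word k → Word k
  | 0, q => q
  | m + 1, q => sweepTwo n m (toggle n (m + 2) (toggle n (m + 1) q))

/-- Three sweeps, without the comparisons among the three letters that are swept. -/
def sweepThree (n : ℕ) : ℕ → Word k → Word k
  | 0, q => q
  | m + 1, q => sweepThree n m (toggle n (m + 3) (toggle n (m + 2) (toggle n (m + 1) q)))

/-- Distant toggles commute, so the second sweep may follow right behind the first. Only its final
toggle is left over, the comparison of the two carried letters. -/
theorem sweep_sweep (n m : ℕ) (q : Word k) :
    sweep n (m + 1) (sweep n m q) = toggle n 1 (sweepTwo n m q) := by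
  induction m generalizing q with
  | zero => rfl
  | succ m ih =>
    rw [sweepTwo, ← ih, sweep_toggle_comm n (m := m) (i := m + 2) (by omega)]
    rfl

/-- As for two sweeps; what is left over are the three comparisons among the three carried letters.
-/
theorem sweep_sweep_sweep (n m : ℕ) (q : Word k) :
    sweep n (m + 2) (sweep n (m + 1) (sweep n m q)) =
      toggle n 1 (toggle n 2 (toggle n 1 (sweepThree n m q))) := by
  induction m generalizing q with
  | zero => rfl
  | succ m ih =>
    rw [sweepThree, ← ih, sweep_toggle_comm n (m := m) (i := m + 3) (by omega),
      sweep_toggle_comm n (m := m + 1) (i := m + 3) (by omega),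
      sweep_toggle_comm n (m := m) (i := m + 2) (by omega)]
    rfl

theorem IsStandard.sweepTwo (hq : IsStandard r s q) {m : ℕ} (hm : m + 2 ≤ size r s) :
    IsStandard r s (sweepTwo (size r s) m q) := by
  induction m generalizing q with
  | zero => exact hq
  | succ m ih =>
    exact ih ((hq.toggle (by omega) (by omega)).toggle (by omega) (by omega)) (by omega)

theorem IsStandard.sweepThree (hq : IsStandard r s q) {m : ℕ} (hm : m + 3 ≤ size r s) :
    IsStandard r s (sweepThree (size r s) m q) := by
  induction m generalizing q with
  | zero => exact hq
  | succ m ih =>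
    exact ih (((hq.toggle (by omega) (by omega)).toggle (by omega) (by omega)).toggle
      (by omega) (by omega)) (by omega)

/-- Each round of `sweepTwo` passes one letter rightwards over the carried pair, so `desc_pass_back`
applies round by round. -/
theorem desc_sweepTwo (hq : IsStandard r s q) {m : ℕ} (hm : m + 2 ≤ size r s) :
    Desc (size r s) 1 (sweepTwo (size r s) m q) ↔ Desc (size r s) (m + 1) q := by
  induction m generalizing q with
  | zero => rfl
  | succ m ih =>
    rw [sweepTwo, ih ((hq.toggle (by omega) (by omega)).toggle (by omega) (by omega)) (by omega)]
    exact desc_pass_back hq (by omega) (by omega)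

theorem sweepTwo_exch (hq : IsStandard r s q) {m : ℕ} (hm : m + 2 ≤ size r s)
    (hf : (q (m + 1)).1 ≠ (q (m + 2)).1) :
    sweepTwo (size r s) m (exch (m + 1) q) = exch 1 (sweepTwo (size r s) m q) := by
  induction m generalizing q with
  | zero => rfl
  | succ m ih =>
    have h := fac_pass_back hq (i := m + 1) (by omega) (by omega)
    rw [sweepTwo, exch_pass_back hq (by omega) (by omega) hf,
      ih ((hq.toggle (by omega) (by omega)).toggle (by omega) (by omega)) (by omega)
        (by rw [h.1, h.2]; exact hf)]
    rfl

theorem sweepThree_dual (hq : IsStandard r s q) {m : ℕ} (hm : m + 3 ≤ size r s) :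
    sweepThree (size r s) m (dual (size r s) (m + 1) q) =
      dual (size r s) 1 (sweepThree (size r s) m q) := by
  induction m generalizing q with
  | zero => rfl
  | succ m ih =>
    rw [sweepThree, dual_pass_back hq (by omega) (by omega),
      ih (((hq.toggle (by omega) (by omega)).toggle (by omega) (by omega)).toggle
      (by omega) (by omega)) (by omega)]
    rfl

/-! ### Promotion of words -/

/-- The promotion of a word. -/
def prom (r s : Fin k → ℕ) (q : Word k) : Word k := sweep (size r s) (size r s - 1) q

/-- The inverse of the promotion of a word. -/
def demote (r s : Fin k → ℕ) (q : Word k) : Word k := unsweep (size r s) (size r s - 1) q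

theorem demote_prom (q : Word k) : demote r s (prom r s q) = q := unsweep_sweep _ _ _

theorem prom_demote (q : Word k) : prom r s (demote r s q) = q := sweep_unsweep _ _ _

theorem prom_eq {m : ℕ} (hm : m + 1 = size r s) (q : Word k) :
    prom r s q = sweep (size r s) m q := by
  rw [prom, show size r s - 1 = m by omega]

theorem demote_eq {m : ℕ} (hm : m + 1 = size r s) (q : Word k) :
    demote r s q = unsweep (size r s) m q := by
  rw [demote, show size r s - 1 = m by omega]

theorem IsStandard.prom (hq : IsStandard r s q) (hn : 1 ≤ size r s) :
    IsStandard r s (prom r s q) := hq.sweep (by omega)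

theorem IsStandard.demote (hq : IsStandard r s q) (hn : 1 ≤ size r s) :
    IsStandard r s (demote r s q) := hq.unsweep (by omega)

theorem fac_prom_one (hq : IsStandard r s q) (hn : 1 ≤ size r s) :
    (prom r s q 1).1 = (q (size r s)).1 := by
  have h := (fac_sweep hq (m := size r s - 1) (by omega)).1
  rw [Nat.sub_add_cancel hn] at h
  exact h

theorem fac_prom_succ (hq : IsStandard r s q) {v : ℕ} (hv : 1 ≤ v) (hn : v + 1 ≤ size r s) :
    (prom r s q (v + 1)).1 = (q v).1 :=
  (fac_sweep hq (m := size r s - 1) (by omega)).2 v hv (by omega)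

theorem desc_prom (hq : IsStandard r s q) {i : ℕ} (hi : 1 ≤ i) (hn : i + 2 ≤ size r s) :
    Desc (size r s) (i + 1) (prom r s q) ↔ Desc (size r s) i q :=
  desc_sweep hq hi (by omega) (by omega)

theorem toggle_one_of_fac (hq : IsStandard r s q) (hn : 2 ≤ size r s) (h : (q 1).1 = (q 2).1) :
    toggle (size r s) 1 q = q := toggle_of_near (hq.near_one_two hn h)

theorem not_near_of_fac_ne (hq : IsStandard r s q) {i : ℕ} (hi : 1 ≤ i) (hn : i + 1 ≤ size r s)
    (hf : (q i).1 ≠ (q (i + 1)).1) :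
    ¬ Near (code (size r s) (q i)) (code (size r s) (q (i + 1))) := fun h =>
  hf (hq.fac_eq_of_code hi (by omega) (by omega) hn (by rcases h with h | h <;> omega)
    (by rcases h with h | h <;> omega))

/-- The letters n-1 and n are compared twice: by the first toggle of the first promotion and by the
last toggle of the second one. -/
theorem prom_prom_eq {m : ℕ} (hm : m + 2 = size r s) (q : Word k) :
    prom r s (prom r s q) = toggle (size r s) 1
      (sweepTwo (size r s) m (toggle (size r s) (m + 1) q)) := by
  rw [prom_eq (m := m + 1) (by omega), prom_eq (m := m + 1) (by omega), ← sweep_sweep]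
  rfl

/-- If the last two letters share a factor, both of their comparisons in `prom_prom_eq` are trivial
toggles. Otherwise both are exchanges, and the two reversals of the descent cancel. -/
theorem desc_prom_prom (hq : IsStandard r s q) {m : ℕ} (hm : m + 2 = size r s) :
    Desc (size r s) 1 (prom r s (prom r s q)) ↔ Desc (size r s) (m + 1) q := by
  have hp := (hq.prom (by omega)).prom (by omega)
  have f1 : (prom r s (prom r s q) 1).1 = (q (m + 1)).1 := by
    rw [fac_prom_one (hq.prom (by omega)) (by omega), ← hm]
    exact fac_prom_succ hq (by omega) (by omega)
  have f2 : (prom r s (prom r s q) 2).1 = (q (m + 2)).1 := by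
    rw [fac_prom_succ (hq.prom (by omega)) le_rfl (by omega), fac_prom_one hq (by omega), ← hm]
  have hz := (hq.toggle (i := m + 1) (by omega) (by omega)).sweepTwo (m := m) (by omega)
  have e := prom_prom_eq hm q
  have e' : sweepTwo (size r s) m (toggle (size r s) (m + 1) q) =
      toggle (size r s) 1 (prom r s (prom r s q)) := by rw [e, toggle_toggle]
  have hd := desc_sweepTwo (hq.toggle (i := m + 1) (by omega) (by omega)) (m := m) (by omega)
  rw [e'] at hd
  by_cases hf : (q (m + 1)).1 = (q (m + 2)).1
  · rw [toggle_one_of_fac hp (by omega) (by rw [f1, f2, hf]),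
      toggle_of_near (hq.near_last (by omega) hm hf)] at hd
    exact hd
  · have h1 := not_near_of_fac_ne hq (i := m + 1) (by omega) (by omega) hf
    have h2 := not_near_of_fac_ne hp (i := 1) (by omega) (by omega) (by rw [f1, f2]; exact hf)
    rw [toggle_of_not_near h1, toggle_of_not_near h2, desc_exch, desc_exch] at hd
    have h3 := hq.code_succ_ne (u := m + 1) (by omega) (by omega)
    have h4 := hp.code_succ_ne (u := 1) (by omega) (by omega)
    unfold Desc
    omega

theorem prom_exch (hq : IsStandard r s q) {i : ℕ} (hi : 1 ≤ i) (hn : i + 2 ≤ size r s)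
    (hf : (q i).1 ≠ (q (i + 1)).1) :
    prom r s (exch i q) = exch (i + 1) (prom r s q) :=
  sweep_exch hq hi (by omega) (by omega) hf

theorem prom_prom_exch (hq : IsStandard r s q) {m : ℕ} (hm : m + 2 = size r s)
    (hf : (q (m + 1)).1 ≠ (q (m + 2)).1) :
    prom r s (prom r s (exch (m + 1) q)) = exch 1 (prom r s (prom r s q)) := by
  have h1 := not_near_of_fac_ne hq (i := m + 1) (by omega) (by omega) hf
  have hq' := hq.exch (by omega) (by omega) h1
  have hp := (hq.prom (by omega)).prom (by omega)
  have f1 : (prom r s (prom r s q) 1).1 = (q (m + 1)).1 := by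
    rw [fac_prom_one (hq.prom (by omega)) (by omega), ← hm]
    exact fac_prom_succ hq (by omega) (by omega)
  have f2 : (prom r s (prom r s q) 2).1 = (q (m + 2)).1 := by
    rw [fac_prom_succ (hq.prom (by omega)) le_rfl (by omega), fac_prom_one hq (by omega), ← hm]
  have e2 : prom r s (prom r s q) =
      exch 1 (toggle (size r s) 1 (sweepTwo (size r s) m q)) := by
    have e := prom_prom_eq hm q
    rw [toggle_of_not_near h1, sweepTwo_exch hq (by omega) hf] at e
    have h2 := not_near_of_fac_ne hp (i := 1) (by omega) (by omega) (by rw [f1, f2]; exact hf)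
    have e3 : sweepTwo (size r s) m q = exch 1 (toggle (size r s) 1 (prom r s (prom r s q))) := by
      rw [e, toggle_toggle, exch_exch]
    rw [toggle_of_not_near h2, exch_exch] at e3
    rw [e3, toggle_of_not_near h2, exch_exch]
  have e1 := prom_prom_eq hm (exch (m + 1) q)
  rw [toggle_of_not_near (q := exch (m + 1) q), exch_exch] at e1
  · rw [e1, e2, exch_exch]
  · rw [exch_left, exch_right]; exact fun h => h1 h.symm

theorem sweepThree_injective (n m : ℕ) :
    Function.Injective (sweepThree n m : Word k → Word k) := by
  induction m with
  | zero => exact fun _ _ h => h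
  | succ m ih =>
    intro p p' h
    have h1 := congrArg (toggle n (m + 3)) (ih h)
    rw [toggle_toggle, toggle_toggle] at h1
    have h2 := congrArg (toggle n (m + 2)) h1
    rw [toggle_toggle, toggle_toggle] at h2
    have h3 := congrArg (toggle n (m + 1)) h2
    rwa [toggle_toggle, toggle_toggle] at h3

/-- Before the block of the last three letters starts to travel, it undergoes the toggles at m+2,
m+1, m+2. Inside one factor both toggles at m+2 are trivial by `near_last`, which leaves a single
exchange. -/
theorem prom_prom_prom_eq (hq : IsStandard r s q) {m : ℕ} (hm : m + 3 = size r s)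
    (h1 : ¬ Near (code (size r s) (q (m + 1))) (code (size r s) (q (m + 2))))
    (h2 : (q (m + 1)).1 = (q (m + 2)).1) (h3 : (q (m + 2)).1 = (q (m + 3)).1) :
    prom r s (prom r s (prom r s q)) = toggle (size r s) 1 (toggle (size r s) 2
      (toggle (size r s) 1 (sweepThree (size r s) m (exch (m + 1) q)))) := by
  have hq' := hq.exch (by omega) (by omega) h1
  have e1 : toggle (size r s) (m + 2) q = q :=
    toggle_of_near (hq.near_last (by omega) hm h3)
  have e2 : toggle (size r s) (m + 2) (exch (m + 1) q) = exch (m + 1) q := by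
    apply toggle_of_near (hq'.near_last (by omega) hm _)
    rw [show exch (m + 1) q (m + 2) = q (m + 1) from exch_right _ _,
      exch_of_ne (v := m + 2 + 1) _ (by omega) (by omega), h2, h3]
  rw [← sweep_sweep_sweep]
  simp only [prom_eq (m := m + 2) (by omega)]
  congr 1
  rw [show sweep (size r s) (m + 2) q =
    sweep (size r s) m (toggle (size r s) (m + 1) (toggle (size r s) (m + 2) q)) from rfl, e1,
    toggle_of_not_near h1]
  rw [show ∀ p : Word k, sweep (size r s) (m + 2) p =
    sweep (size r s) (m + 1) (toggle (size r s) (m + 2) p) from fun _ => rfl,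
    ← sweep_toggle_comm _ (by omega), e2]

/-- The elementary dual equivalence that moves the last three entries, if they are in the same
factor, becomes the one that moves the first three entries after three promotions. -/
theorem prom_prom_prom_exch (hq : IsStandard r s q) {m : ℕ} (hm : m + 3 = size r s)
    (hb : Btw (code (size r s) (q (m + 3))) (code (size r s) (q (m + 1)))
      (code (size r s) (q (m + 2))))
    (h2 : (q (m + 1)).1 = (q (m + 2)).1) (h3 : (q (m + 2)).1 = (q (m + 3)).1) :
    prom r s (prom r s (prom r s (exch (m + 1) q))) =
      exch 2 (prom r s (prom r s (prom r s q))) := by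
  have h1 : ¬ Near (code (size r s) (q (m + 1))) (code (size r s) (q (m + 2))) := by omega
  have hq' := hq.exch (by omega) (by omega) h1
  have x1 : exch (m + 1) q (m + 1) = q (m + 2) := exch_left _ _
  have x2 : exch (m + 1) q (m + 2) = q (m + 1) := exch_right _ _
  have x3 : exch (m + 1) q (m + 3) = q (m + 3) := exch_of_ne _ (by omega) (by omega)
  have e := prom_prom_prom_eq hq hm h1 h2 h3
  have e' := prom_prom_prom_eq hq' hm (by rw [x1, x2]; exact fun h => h1 h.symm)
    (by rw [x1, x2, h2]) (by rw [x2, x3, h2, h3])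
  rw [exch_exch] at e'
  have fac : ∀ p : Word k, IsStandard r s p → (p (m + 1)).1 = (p (m + 2)).1 →
      (p (m + 2)).1 = (p (m + 3)).1 →
      (prom r s (prom r s (prom r s p)) 1).1 = (prom r s (prom r s (prom r s p)) 2).1 ∧
      (prom r s (prom r s (prom r s p)) 2).1 = (prom r s (prom r s (prom r s p)) 3).1 := by
    intro p hp a b
    have p1 := hp.prom (by omega)
    have p2 := p1.prom (by omega)
    rw [fac_prom_one p2 (by omega), fac_prom_succ p2 (v := 1) (by omega) (by omega),
      fac_prom_succ p2 (v := 2) (by omega) (by omega), ← hm,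
      fac_prom_succ p1 (v := m + 2) (by omega) (by omega), fac_prom_one p1 (by omega), ← hm,
      fac_prom_succ hp (v := m + 1) (by omega) (by omega),
      fac_prom_succ hp (v := m + 2) (by omega) (by omega),
      fac_prom_succ p1 (v := 1) (by omega) (by omega), fac_prom_one hp (by omega), ← hm]
    exact ⟨a, b⟩
  obtain ⟨fw, fw2⟩ := fac q hq h2 h3
  obtain ⟨fw', fw2'⟩ := fac _ hq' (by rw [x1, x2, h2]) (by rw [x2, x3, h2, h3])
  have hw := ((hq.prom (by omega)).prom (by omega)).prom (by omega)
  have hw' := ((hq'.prom (by omega)).prom (by omega)).prom (by omega)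
  generalize prom r s (prom r s (prom r s q)) = w at *
  generalize prom r s (prom r s (prom r s (exch (m + 1) q))) = w' at *
  have hz := hq.sweepThree (m := m) (by omega)
  have hz' := hq'.sweepThree (m := m) (by omega)
  have hd : exch (m + 1) q = dual (size r s) (m + 1) q :=
    ((if_neg (by simp only [add_assoc, Nat.reduceAdd]; omega)).trans
      (if_pos (by simp only [add_assoc, Nat.reduceAdd]; omega))).symm
  have hzz : sweepThree (size r s) m (exch (m + 1) q) =
      dual (size r s) 1 (sweepThree (size r s) m q) := by
    rw [hd]; exact sweepThree_dual hq (by omega)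
  have hne : sweepThree (size r s) m (exch (m + 1) q) ≠ sweepThree (size r s) m q := by
    intro h
    have h4 := congrFun (sweepThree_injective _ _ h) (m + 1)
    rw [x1] at h4
    rw [h4] at hb
    omega
  generalize sweepThree (size r s) m (exch (m + 1) q) = z' at *
  generalize sweepThree (size r s) m q = z at *
  -- Inside one factor the outer two of the toggles 1, 2, 1 are trivial, so only the toggle at 2
  -- remains.
  have solve : ∀ {w z : Word k}, IsStandard r s w → IsStandard r s z → (w 1).1 = (w 2).1 →
      (w 2).1 = (w 3).1 → w = toggle (size r s) 1 (toggle (size r s) 2 (toggle (size r s) 1 z)) →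
      toggle (size r s) 2 w = z ∧ (z 1).1 = (z 2).1 := by
    intro w z hw hz a b h
    have h' : toggle (size r s) 2 (toggle (size r s) 1 w) = toggle (size r s) 1 z := by
      rw [h, toggle_toggle, toggle_toggle]
    rw [toggle_one_of_fac hw (by omega) a] at h'
    have hv := hw.toggle (i := 2) (by omega) (by omega)
    have f1 : (toggle (size r s) 2 w 1).1 = (w 1).1 := by rw [toggle_of_ne _ (by omega) (by omega)]
    have f2 : (toggle (size r s) 2 w 2).1 = (w 3).1 := fac_toggle_left hw (by omega) (by omega)
    have f3 : (toggle (size r s) 2 w 1).1 = (toggle (size r s) 2 w 2).1 := by rw [f1, f2, a, b]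
    have h5 : toggle (size r s) 1 (toggle (size r s) 2 w) = z := by rw [h', toggle_toggle]
    rw [toggle_one_of_fac hv (by omega) f3] at h5
    exact ⟨h5, by rw [← h5]; exact f3⟩
  obtain ⟨s1, s2⟩ := solve hw hz' fw fw2 e
  obtain ⟨s1', s2'⟩ := solve hw' hz fw' fw2' e'
  -- An elementary dual equivalence that is not the identity is an exchange at 1 or at 2; the one at
  -- 1 is impossible, as the first two letters are neighbours.
  have hz2 : z' = exch 2 z := by
    rw [hzz]; unfold dual
    split_ifs with a b
    · rfl
    · exfalso
      have : z' = exch 1 z := by rw [hzz]; exact (if_neg a).trans (if_pos b)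
      rw [this] at hz'
      exact hz.not_near_of_exch (by omega) (by omega) hz' (hz.near_one_two (by omega) s2')
    · exact absurd (by rw [hzz]; exact (if_neg a).trans (if_neg b)) hne
  have hnn := hz.not_near_of_exch (i := 2) (by omega) (by omega) (by rw [← hz2]; exact hz')
  have a1 : w' = toggle (size r s) 2 z := by rw [← s1', toggle_toggle]
  have a2 : w = toggle (size r s) 2 z' := by rw [← s1, toggle_toggle]
  rw [toggle_of_not_near hnn] at a1
  rw [a2, hz2, toggle_of_not_near, exch_exch, a1]
  rw [exch_left, exch_right]; exact fun h => hnn h.symm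

/-! ### The sweeps of two words that differ by one exchange do not cross -/

theorem code_toggle_left (n i : ℕ) (q : Word k) : code n (toggle n i q i) =
    if Near (code n (q i)) (code n (q (i + 1))) then code n (q i) else code n (q (i + 1)) := by
  by_cases h : Near (code n (q i)) (code n (q (i + 1)))
  · rw [toggle_of_near h, if_pos h]
  · rw [toggle_of_not_near h, if_neg h, exch_left]

/-- Meeting a content a, the carried content c becomes a if |c - a| = 1 and is kept otherwise. Since
c ≠ a, this is weakly increasing in c, so the order of the carried contents of the two words
persists down to the position 1. -/
theorem desc_sweep_mono {p p' : Word k} (hp : IsStandard r s p) (hp' : IsStandard r s p') {m : ℕ}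
    (hm1 : 1 ≤ m) (hm : m + 1 ≤ size r s) (h : ∀ v, 1 ≤ v → v ≤ m → p v = p' v)
    (hf : (p (m + 1)).1 = (p' (m + 1)).1)
    (hc : code (size r s) (p' (m + 1)) ≤ code (size r s) (p (m + 1)))
    (hd : Desc (size r s) 1 (sweep (size r s) m p)) :
    Desc (size r s) 1 (sweep (size r s) m p') := by
  induction m, hm1 using Nat.le_induction generalizing p p' with
  | base =>
    have e := h 1 le_rfl le_rfl
    have a1 := hp.code_lt_iff_of_fac_ne (u := 1) (v := 2) (by omega) (by omega) (by omega) (by omega)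
    have a2 := hp'.code_lt_iff_of_fac_ne (u := 1) (v := 2) (by omega) (by omega) (by omega) (by omega)
    change Desc (size r s) 1 (toggle (size r s) 1 p) at hd
    change Desc (size r s) 1 (toggle (size r s) 1 p')
    simp only [Nat.reduceAdd] at hf hc
    by_cases hf1 : (p 1).1 = (p 2).1
    · rw [toggle_one_of_fac hp (by omega) hf1] at hd
      rw [toggle_one_of_fac hp' (by omega) (by rw [← e, ← hf, hf1])]
      unfold Desc at *
      rw [← e]; simp only [Nat.reduceAdd] at *; omega
    · have hf2 : (p' 1).1 ≠ (p' 2).1 := by rw [← e, ← hf]; exact hf1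
      rw [toggle_of_not_near (not_near_of_fac_ne hp le_rfl (by omega) hf1), desc_exch] at hd
      rw [toggle_of_not_near (not_near_of_fac_ne hp' le_rfl (by omega) hf2), desc_exch]
      simp only [Nat.reduceAdd] at hd ⊢
      rw [a1 hf1] at hd
      rw [a2 hf2, ← e, ← hf]
      exact hd
  | succ m hm1 ih =>
    refine ih (hp.toggle (by omega) hm) (hp'.toggle (by omega) hm) (by omega) ?_ ?_ ?_ hd
    · intro v hv hv'
      rw [toggle_of_ne _ (by omega) (by omega), toggle_of_ne _ (by omega) (by omega),
        h v hv (by omega)]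
    · rw [fac_toggle_left hp (by omega) hm, fac_toggle_left hp' (by omega) hm, hf]
    · have h1 := hp.code_succ_ne (u := m + 1) (by omega) hm
      have h2 := hp'.code_succ_ne (u := m + 1) (by omega) hm
      rw [code_toggle_left, code_toggle_left]
      rw [← h (m + 1) (by omega) le_rfl] at h2 ⊢
      split_ifs <;> omega

theorem desc_sweep_exch (hq : IsStandard r s q) {i m : ℕ} (hi : 2 ≤ i) (him : i + 1 ≤ m)
    (hm : m + 1 ≤ size r s) (hq' : IsStandard r s (exch i q)) (hf : (q i).1 = (q (i + 1)).1)
    (hc : code (size r s) (q i) < code (size r s) (q (i + 1)))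
    (hd : Desc (size r s) 1 (sweep (size r s) m q)) :
    Desc (size r s) 1 (sweep (size r s) m (exch i q)) := by
  induction m, him using Nat.le_induction generalizing q with
  | base =>
    obtain ⟨i, rfl⟩ : ∃ l, i = l + 1 := ⟨i - 1, by omega⟩
    have p1 := hq.toggle (i := i + 1 + 1) (by omega) hm
    have p2 := hq'.toggle (i := i + 1 + 1) (by omega) hm
    -- Once the carried letter has passed the exchanged pair, the words agree to its left, and the
    -- carried content is not larger for the word with the pair exchanged.
    refine desc_sweep_mono (p1.toggle (i := i + 1) (by omega) (by omega))
      (p2.toggle (i := i + 1) (by omega) (by omega)) (by omega) (by omega) ?_ ?_ ?_ hd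
    · intro v hv hv'
      simp only [toggle_of_ne (v := v) (i := i + 1) _ (by omega : v ≠ i + 1) (by omega),
        toggle_of_ne (v := v) (i := i + 1 + 1) _ (by omega : v ≠ i + 1 + 1) (by omega)]
      rw [exch_of_ne _ (by omega) (by omega)]
    · rw [fac_toggle_left p1 (by omega) (by omega), fac_toggle_left p2 (by omega) (by omega),
        fac_toggle_left hq (by omega) (by omega), fac_toggle_left hq' (by omega) (by omega),
        exch_of_ne _ (by omega) (by omega)]
    · have h1 := hq.not_near_of_exch (by omega) (by omega) hq'
      have h2 := hq.code_add_two_ne (u := i + 1) (by omega) (by omega)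
      have h3 := hq.code_succ_ne (u := i + 1 + 1) (by omega) (by omega)
      rw [code_toggle_left, code_toggle_left, code_toggle_left, code_toggle_left,
        toggle_of_ne _ (by omega) (by omega), toggle_of_ne _ (by omega) (by omega), exch_left,
        exch_right, exch_of_ne (v := i + 1 + 1 + 1) _ (by omega) (by omega)]
      split_ifs <;> omega
  | succ m him ih =>
    have h1 : toggle (size r s) (m + 1) (exch i q) = exch i (toggle (size r s) (m + 1) q) :=
      toggle_exch_comm _ (by omega) _
    have e1 : toggle (size r s) (m + 1) q i = q i := toggle_of_ne _ (by omega) (by omega)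
    have e2 : toggle (size r s) (m + 1) q (i + 1) = q (i + 1) :=
      toggle_of_ne _ (by omega) (by omega)
    rw [sweep, h1]
    refine ih (hq.toggle (by omega) hm) (by omega) ?_ (by rw [e1, e2, hf]) (by rw [e1, e2]; exact hc)
      hd
    rw [← h1]; exact hq'.toggle (by omega) hm

theorem desc_prom_exch (hq : IsStandard r s q) {i : ℕ} (hi : 2 ≤ i) (hn : i + 2 ≤ size r s)
    (hq' : IsStandard r s (exch i q)) (hf : (q i).1 = (q (i + 1)).1)
    (hc : code (size r s) (q i) < code (size r s) (q (i + 1)))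
    (hd : Desc (size r s) 1 (prom r s q)) : Desc (size r s) 1 (prom r s (exch i q)) :=
  desc_sweep_exch hq hi (by omega) (by omega) hq' hf hc hd

/-! ### The filling of a word -/

open Classical in
/-- The position of a cell in a word, `0` if the cell does not occur. -/
noncomputable def idx (r s : Fin k → ℕ) (q : Word k) (c : Fin k × ℕ × ℕ) : ℕ :=
  if h : ∃ v, 1 ≤ v ∧ v ≤ size r s ∧ q v = c then h.choose else 0

theorem idx_eq_zero {c : Fin k × ℕ × ℕ} (h : ∀ v, 1 ≤ v → v ≤ size r s → q v ≠ c) :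
    idx r s q c = 0 := dif_neg (by rintro ⟨v, h1, h2, h3⟩; exact h v h1 h2 h3)

theorem idx_cases (r s : Fin k → ℕ) (q : Word k) (c : Fin k × ℕ × ℕ) :
    idx r s q c = 0 ∨ (1 ≤ idx r s q c ∧ idx r s q c ≤ size r s ∧ q (idx r s q c) = c) := by
  by_cases h : ∃ v, 1 ≤ v ∧ v ≤ size r s ∧ q v = c
  · right
    have e : idx r s q c = h.choose := dif_pos h
    rw [e]; exact h.choose_spec
  · left; exact dif_neg h

theorem idx_le (c : Fin k × ℕ × ℕ) : idx r s q c ≤ size r s := by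
  rcases idx_cases r s q c with h | h
  · omega
  · exact h.2.1

theorem apply_idx {c : Fin k × ℕ × ℕ} (h : idx r s q c ≠ 0) : q (idx r s q c) = c :=
  ((idx_cases r s q c).resolve_left h).2.2

namespace IsStandard

theorem idx_apply (hq : IsStandard r s q) {v : ℕ} (h1 : 1 ≤ v) (h2 : v ≤ size r s) :
    idx r s q (q v) = v := by
  rcases idx_cases r s q (q v) with h | ⟨h3, h4, h5⟩
  · exfalso
    have : ∃ u, 1 ≤ u ∧ u ≤ size r s ∧ q u = q v := ⟨v, h1, h2, rfl⟩
    have e : idx r s q (q v) = this.choose := dif_pos this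
    have := this.choose_spec.1
    omega
  · exact hq.inj _ _ h3 h4 h1 h2 h5

theorem idx_eq_iff (hq : IsStandard r s q) {v : ℕ} (h1 : 1 ≤ v) (h2 : v ≤ size r s)
    {c : Fin k × ℕ × ℕ} : idx r s q c = v ↔ q v = c := by
  constructor
  · rintro rfl; exact apply_idx (by omega)
  · rintro rfl; exact hq.idx_apply h1 h2

theorem idx_exch (hq : IsStandard r s q) {i : ℕ} (hi : 1 ≤ i) (hn : i + 1 ≤ size r s)
    (hq' : IsStandard r s (KRDual.exch i q)) (c : Fin k × ℕ × ℕ) :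
    idx r s (KRDual.exch i q) c = Equiv.swap i (i + 1) (idx r s q c) := by
  rcases idx_cases r s q c with h | ⟨h1, h2, h3⟩
  · rw [h, Equiv.swap_apply_of_ne_of_ne (by omega) (by omega)]
    apply idx_eq_zero
    intro v hv hv' e
    have := hq.idx_apply (swap_mem hi hn hv hv').1 (swap_mem hi hn hv hv').2
    rw [show q (Equiv.swap i (i + 1) v) = c from e, h] at this
    have := (swap_mem hi hn hv hv').1
    omega
  · have h4 := swap_mem hi hn h1 h2
    rw [hq'.idx_eq_iff h4.1 h4.2, KRDual.exch, Equiv.swap_apply_self, h3]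

theorem idx_ne_zero (hq : IsStandard r s q) {j : Fin k} {a b : ℕ} (ha : a < r j) (hb : b < s j) :
    idx r s q (j, a, b) ≠ 0 := by
  obtain ⟨v, h1, h2, h3⟩ := hq.surj j a b ha hb
  rw [← h3, hq.idx_apply h1 h2]; omega

theorem idx_eq_zero_of_not (hq : IsStandard r s q) {j : Fin k} {a b : ℕ} (h : ¬ (a < r j ∧ b < s j)) :
    idx r s q (j, a, b) = 0 := by
  apply idx_eq_zero
  intro v h1 h2 h3
  have h4 := hq.row_lt v h1 h2
  have h5 := hq.col_lt v h1 h2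
  rw [h3] at h4 h5
  exact h ⟨h4, h5⟩

end IsStandard

/-! ### Slides

During a slide the empty box is the letter at some position `m`; the other letters carry labels that
increase with the position. -/

/-- The label of the letter at the position `v` if the letter at the position `m` is empty and the
labels of the other letters are `x 1, x 2, …`. -/
def lab (x : ℕ → ℕ) (m v : ℕ) : ℕ :=
  if v = 0 then 0 else if v < m then x v else if v = m then 0 else x (v - 1)

@[simp] theorem lab_zero (x : ℕ → ℕ) (m : ℕ) : lab x m 0 = 0 := rfl

@[simp] theorem lab_self (x : ℕ → ℕ) (m : ℕ) : lab x m m = 0 := by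
  unfold lab; split_ifs <;> first | rfl | omega

theorem lab_lt (x : ℕ → ℕ) {m v : ℕ} (h : v ≠ 0) (h' : v < m) : lab x m v = x v := by
  unfold lab; rw [if_neg h, if_pos h']

theorem lab_gt (x : ℕ → ℕ) {m v : ℕ} (h' : m < v) : lab x m v = x (v - 1) := by
  unfold lab; rw [if_neg (by omega), if_neg (by omega), if_neg (by omega)]

theorem lab_succ (x : ℕ → ℕ) {m v : ℕ} (h : v ≠ m) (h' : v ≠ m + 1) :
    lab x m v = lab x (m + 1) v := by
  rcases Nat.eq_zero_or_pos v with rfl | h0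
  · rfl
  rcases Nat.lt_or_gt_of_ne h with h1 | h1
  · rw [lab_lt x (by omega) h1, lab_lt x (by omega) (by omega)]
  · rw [lab_gt x h1, lab_gt x (by omega)]

theorem lab_swap (x : ℕ → ℕ) {m : ℕ} (hm : 1 ≤ m) (v : ℕ) :
    lab x m (Equiv.swap m (m + 1) v) = lab x (m + 1) v := by
  by_cases h : v = m
  · rw [h, Equiv.swap_apply_left, lab_gt x (by omega), lab_lt x (by omega) (by omega)]; rfl
  by_cases h' : v = m + 1
  · rw [h', Equiv.swap_apply_right, lab_self, lab_self]
  rw [Equiv.swap_apply_of_ne_of_ne h h', lab_succ x h h']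

theorem moveCell_apply (F : Filling) (src dst : ℕ × ℕ) (a b : ℕ) : moveCell F src dst a b =
    if (a, b) = src then 0 else if (a, b) = dst then F src.1 src.2 else F a b := by
  simp only [moveCell, setCell, Prod.ext_iff]

theorem setCell_apply (F : Filling) (c : ℕ × ℕ) (v a b : ℕ) :
    setCell F c v a b = if (a, b) = c then v else F a b := by
  simp only [setCell, Prod.ext_iff]

/-- The filling of the factor `j` in which the letter at the position `m` is empty. -/
noncomputable def labFilling (r s : Fin k → ℕ) (q : Word k) (j : Fin k) (x : ℕ → ℕ) (m : ℕ) : Filling :=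
  fun a b => lab x m (idx r s q (j, a, b))

/-- Exchanging the empty letter with its predecessor is pure renumbering: labels belong to the other
letters, which keep their cells. -/
theorem labFilling_exch (hq : IsStandard r s q) {m : ℕ} (hm : 1 ≤ m) (hn : m + 1 ≤ size r s)
    (hq' : IsStandard r s (exch m q)) (j : Fin k) (x : ℕ → ℕ) :
    labFilling r s (exch m q) j x m = labFilling r s q j x (m + 1) := by
  funext a b
  rw [labFilling, hq.idx_exch hm hn hq', lab_swap x hm]; rfl

theorem labFilling_exch_succ (hq : IsStandard r s q) {m : ℕ} (hm : 1 ≤ m) (hn : m + 1 ≤ size r s)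
    (hq' : IsStandard r s (exch m q)) (j : Fin k) (x : ℕ → ℕ) :
    labFilling r s (exch m q) j x (m + 1) = labFilling r s q j x m := by
  have h := labFilling_exch hq' hm hn (by rw [exch_exch]; exact hq) j x
  rw [exch_exch] at h
  exact h.symm

theorem moveCell_labFilling (hq : IsStandard r s q) {m : ℕ} (hm : 1 ≤ m) (hn : m + 1 ≤ size r s)
    {j : Fin k} {c d : ℕ × ℕ} (hc : q m = (j, c)) (hd : q (m + 1) = (j, d)) (x : ℕ → ℕ) :
    moveCell (labFilling r s q j x (m + 1)) c d = labFilling r s q j x m := by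
  funext a b
  have ic := hq.idx_apply hm (by omega)
  have id := hq.idx_apply (v := m + 1) (by omega) hn
  rw [hc] at ic
  rw [hd] at id
  rw [moveCell_apply]
  split_ifs with h1 h2
  · rw [labFilling, h1, ic, lab_self]
  · rw [labFilling, labFilling, h2, id, ic, lab_lt _ (by omega) (by omega), lab_gt _ (by omega)]
    rfl
  · refine (lab_succ x ?_ ?_).symm
    · intro h; rw [hq.idx_eq_iff hm (by omega), hc] at h
      exact h1 (Prod.ext_iff.mp h).2.symm
    · intro h; rw [hq.idx_eq_iff (by omega) hn, hd] at h
      exact h2 (Prod.ext_iff.mp h).2.symm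

theorem moveCell_labFilling_succ (hq : IsStandard r s q) {m : ℕ} (hm : 1 ≤ m) (hn : m + 1 ≤ size r s)
    {j : Fin k} {c d : ℕ × ℕ} (hc : q m = (j, c)) (hd : q (m + 1) = (j, d)) (x : ℕ → ℕ) :
    moveCell (labFilling r s q j x m) d c = labFilling r s q j x (m + 1) := by
  funext a b
  have ic := hq.idx_apply hm (by omega)
  have id := hq.idx_apply (v := m + 1) (by omega) hn
  rw [hc] at ic
  rw [hd] at id
  rw [moveCell_apply]
  split_ifs with h1 h2
  · rw [labFilling, h1, id, lab_self]
  · rw [labFilling, labFilling, h2, id, ic, lab_lt _ (v := m) (by omega) (by omega),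
      lab_gt _ (v := m + 1) (by omega)]
    rfl
  · refine lab_succ x ?_ ?_
    · intro h; rw [hq.idx_eq_iff hm (by omega), hc] at h
      exact h2 (Prod.ext_iff.mp h).2.symm
    · intro h; rw [hq.idx_eq_iff (by omega) hn, hd] at h
      exact h1 (Prod.ext_iff.mp h).2.symm

theorem entryAbove_labFilling (hq : IsStandard r s q) {m : ℕ} (hm : 1 ≤ m) (hn : m ≤ size r s)
    (x : ℕ → ℕ) : entryAbove (labFilling r s q (q m).1 x m) (q m).2 = 0 ∨
      ∃ u, 1 ≤ u ∧ u < m ∧ q m = ((q u).1, (q u).2.1 + 1, (q u).2.2) ∧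
        entryAbove (labFilling r s q (q m).1 x m) (q m).2 = x u := by
  unfold entryAbove
  split_ifs with h0
  · exact Or.inl rfl
  · rcases idx_cases r s q ((q m).1, (q m).2.1 - 1, (q m).2.2) with h | ⟨h1, h2, h3⟩
    · left; rw [labFilling, h, lab_zero]
    · right
      have e : q m = ((q (idx r s q ((q m).1, (q m).2.1 - 1, (q m).2.2))).1,
          (q (idx r s q ((q m).1, (q m).2.1 - 1, (q m).2.2))).2.1 + 1,
          (q (idx r s q ((q m).1, (q m).2.1 - 1, (q m).2.2))).2.2) := by
        rw [h3]; simp only; rw [Nat.sub_add_cancel (by omega)]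
      have lt := hq.down _ m h1 h2 hm hn e
      exact ⟨_, h1, lt, e, lab_lt x (by omega) lt⟩

theorem entryLeft_labFilling (hq : IsStandard r s q) {m : ℕ} (hm : 1 ≤ m) (hn : m ≤ size r s)
    (x : ℕ → ℕ) : entryLeft (labFilling r s q (q m).1 x m) (q m).2 = 0 ∨
      ∃ u, 1 ≤ u ∧ u < m ∧ q m = ((q u).1, (q u).2.1, (q u).2.2 + 1) ∧
        entryLeft (labFilling r s q (q m).1 x m) (q m).2 = x u := by
  unfold entryLeft
  split_ifs with h0
  · exact Or.inl rfl
  · rcases idx_cases r s q ((q m).1, (q m).2.1, (q m).2.2 - 1) with h | ⟨h1, h2, h3⟩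
    · left; rw [labFilling, h, lab_zero]
    · right
      have e : q m = ((q (idx r s q ((q m).1, (q m).2.1, (q m).2.2 - 1))).1,
          (q (idx r s q ((q m).1, (q m).2.1, (q m).2.2 - 1))).2.1,
          (q (idx r s q ((q m).1, (q m).2.1, (q m).2.2 - 1))).2.2 + 1) := by
        rw [h3]; simp only; rw [Nat.sub_add_cancel (by omega)]
      have lt := hq.right _ m h1 h2 hm hn e
      exact ⟨_, h1, lt, e, lab_lt x (by omega) lt⟩

theorem entryAbove_eq (hq : IsStandard r s q) {u m : ℕ} (hu : 1 ≤ u) (hum : u < m)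
    (hn : m ≤ size r s) (h : q m = ((q u).1, (q u).2.1 + 1, (q u).2.2)) (x : ℕ → ℕ) :
    entryAbove (labFilling r s q (q m).1 x m) (q m).2 = x u := by
  have e : ((q m).1, (q m).2.1 - 1, (q m).2.2) = q u := by rw [h]; rfl
  unfold entryAbove
  rw [if_neg (by rw [h]; simp), labFilling, e, hq.idx_apply hu (by omega),
    lab_lt x (by omega) hum]

theorem entryLeft_eq (hq : IsStandard r s q) {u m : ℕ} (hu : 1 ≤ u) (hum : u < m)
    (hn : m ≤ size r s) (h : q m = ((q u).1, (q u).2.1, (q u).2.2 + 1)) (x : ℕ → ℕ) :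
    entryLeft (labFilling r s q (q m).1 x m) (q m).2 = x u := by
  have e : ((q m).1, (q m).2.1, (q m).2.2 - 1) = q u := by rw [h]; rfl
  unfold entryLeft
  rw [if_neg (by rw [h]; simp), labFilling, e, hq.idx_apply hu (by omega),
    lab_lt x (by omega) hum]

/-- The steps of a slide that starts at the outer box at the position `l + 1` amount to the sweep
from `l` down to `1`. -/
theorem stepOuter_iterate (hq : IsStandard r s q) (x : ℕ → ℕ) {l : ℕ} (hl : l + 1 ≤ size r s) (K : ℕ)
    (hK : (q (l + 1)).2.1 + (q (l + 1)).2.2 ≤ K) (hx : ∀ u, 1 ≤ u → u ≤ l → 0 < x u)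
    (hx' : ∀ u v, 1 ≤ u → u < v → v ≤ l → x u < x v ∨ (q u).2 = (0, 0)) :
    stepOuter^[K] (labFilling r s q (q (l + 1)).1 x (l + 1), (q (l + 1)).2) =
      (labFilling r s (sweep (size r s) l q) (q (l + 1)).1 x 1, (sweep (size r s) l q 1).2) := by
  induction l generalizing q K with
  | zero =>
    apply Function.iterate_fixed
    unfold stepOuter
    rw [if_pos]
    constructor
    · rcases entryAbove_labFilling hq le_rfl hl x with h | ⟨u, h1, h2, -⟩
      · exact h
      · omega
    · rcases entryLeft_labFilling hq le_rfl hl x with h | ⟨u, h1, h2, -⟩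
      · exact h
      · omega
  | succ l ih =>
    have e : sweep (size r s) (l + 1) q =
      sweep (size r s) l (toggle (size r s) (l + 1) q) := rfl
    rw [e]
    by_cases hnear : Near (code (size r s) (q (l + 1))) (code (size r s) (q (l + 1 + 1)))
    · rw [toggle_of_near hnear]
      rcases hq.succ_eq_of_near (by omega) hl hnear with h | h
      · have ha := entryAbove_eq hq (u := l + 1) (by omega) (by omega) hl h x
        have hpos := hx (l + 1) (by omega) le_rfl
        have hle : entryLeft (labFilling r s q (q (l + 1 + 1)).1 x (l + 1 + 1)) (q (l + 1 + 1)).2 ≤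
            entryAbove (labFilling r s q (q (l + 1 + 1)).1 x (l + 1 + 1)) (q (l + 1 + 1)).2 := by
          rcases entryLeft_labFilling hq (by omega) hl x with h1 | ⟨u, h1, h2, h3, h4⟩
          · rw [h1]; exact Nat.zero_le _
          · rw [ha, h4]
            rcases Nat.lt_or_ge u (l + 1) with h5 | h5
            -- Equal labels are allowed only with the corner; as a left neighbour, the corner would
            -- put the empty box into the first row, where nothing is above it.
            · rcases hx' u (l + 1) h1 h5 le_rfl with h6 | h6
              · exact h6.le
              · rw [h3, h6] at h; simp at h
            · obtain rfl : u = l + 1 := by omega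
              exact le_rfl
        obtain ⟨K, rfl⟩ : ∃ K', K = K' + 1 := ⟨K - 1, by rw [h] at hK; simp only at hK; omega⟩
        have hfac : (q (l + 1 + 1)).1 = (q (l + 1)).1 := by rw [h]
        have hsrc : ((q (l + 1 + 1)).2.1 - 1, (q (l + 1 + 1)).2.2) = (q (l + 1)).2 := by rw [h]; rfl
        rw [Function.iterate_succ_apply]
        have hstep : stepOuter (labFilling r s q (q (l + 1 + 1)).1 x (l + 1 + 1),
            (q (l + 1 + 1)).2) = (labFilling r s q (q (l + 1)).1 x (l + 1), (q (l + 1)).2) := by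
          unfold stepOuter
          rw [if_neg (by simp only; omega), if_pos hle]
          simp only [hsrc]
          rw [hfac, moveCell_labFilling hq (by omega) hl (j := (q (l + 1)).1) rfl
            (by rw [← hfac])]
        rw [hstep, hfac]
        refine ih hq (by omega) K ?_ (fun u h1 h2 => hx u h1 (by omega))
          (fun u v h1 h2 h3 => hx' u v h1 h2 (by omega))
        rw [h] at hK; simp only at hK; omega
      · have ha := entryLeft_eq hq (u := l + 1) (by omega) (by omega) hl h x
        have hpos := hx (l + 1) (by omega) le_rfl
        have hlt : entryAbove (labFilling r s q (q (l + 1 + 1)).1 x (l + 1 + 1)) (q (l + 1 + 1)).2 <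
            entryLeft (labFilling r s q (q (l + 1 + 1)).1 x (l + 1 + 1)) (q (l + 1 + 1)).2 := by
          rcases entryAbove_labFilling hq (by omega) hl x with h1 | ⟨u, h1, h2, h3, h4⟩
          · rw [h1, ha]; exact hpos
          · rw [ha, h4]
            rcases Nat.lt_or_ge u (l + 1) with h5 | h5
            · rcases hx' u (l + 1) h1 h5 le_rfl with h6 | h6
              · exact h6
              · rw [h3, h6] at h; simp at h
            · obtain rfl : u = l + 1 := by omega
              rw [h3] at h; simp at h
        obtain ⟨K, rfl⟩ : ∃ K', K = K' + 1 := ⟨K - 1, by rw [h] at hK; simp only at hK; omega⟩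
        have hfac : (q (l + 1 + 1)).1 = (q (l + 1)).1 := by rw [h]
        have hsrc : ((q (l + 1 + 1)).2.1, (q (l + 1 + 1)).2.2 - 1) = (q (l + 1)).2 := by rw [h]; rfl
        rw [Function.iterate_succ_apply]
        have hstep : stepOuter (labFilling r s q (q (l + 1 + 1)).1 x (l + 1 + 1),
            (q (l + 1 + 1)).2) = (labFilling r s q (q (l + 1)).1 x (l + 1), (q (l + 1)).2) := by
          unfold stepOuter
          rw [if_neg (by simp only; omega), if_neg (by simp only; omega)]
          simp only [hsrc]
          rw [hfac, moveCell_labFilling hq (by omega) hl (j := (q (l + 1)).1) rfl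
            (by rw [← hfac])]
        rw [hstep, hfac]
        refine ih hq (by omega) K ?_ (fun u h1 h2 => hx u h1 (by omega))
          (fun u v h1 h2 h3 => hx' u v h1 h2 (by omega))
        rw [h] at hK; simp only at hK; omega
    -- The toggle exchanges letters that are not neighbours: no step of the slide takes place, and
    -- the empty box only gets the number l+1.
    · have hq' := hq.exch (by omega) hl hnear
      have e1 : exch (l + 1) q (l + 1) = q (l + 1 + 1) := exch_left _ _
      rw [toggle_of_not_near hnear, ← labFilling_exch hq (by omega) hl hq', ← e1]
      refine ih hq' (by omega) K (by rw [e1]; exact hK) (fun u h1 h2 => hx u h1 (by omega)) ?_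
      intro u v h1 h2 h3
      rw [exch_of_ne _ (by omega) (by omega)]
      exact hx' u v h1 h2 (by omega)

theorem below_labFilling (hq : IsStandard r s q) {m : ℕ} (hm : 1 ≤ m) (hn : m ≤ size r s)
    (x : ℕ → ℕ) : labFilling r s q (q m).1 x m ((q m).2.1 + 1) (q m).2.2 = 0 ∨
      ∃ u, m < u ∧ u ≤ size r s ∧ q u = ((q m).1, (q m).2.1 + 1, (q m).2.2) ∧
        labFilling r s q (q m).1 x m ((q m).2.1 + 1) (q m).2.2 = x (u - 1) := by
  rcases idx_cases r s q ((q m).1, (q m).2.1 + 1, (q m).2.2) with h | ⟨h1, h2, h3⟩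
  · left; rw [labFilling, h, lab_zero]
  · have lt := hq.down m _ hm hn h1 h2 h3
    exact Or.inr ⟨_, lt, h2, h3, lab_gt x lt⟩

theorem beside_labFilling (hq : IsStandard r s q) {m : ℕ} (hm : 1 ≤ m) (hn : m ≤ size r s)
    (x : ℕ → ℕ) : labFilling r s q (q m).1 x m (q m).2.1 ((q m).2.2 + 1) = 0 ∨
      ∃ u, m < u ∧ u ≤ size r s ∧ q u = ((q m).1, (q m).2.1, (q m).2.2 + 1) ∧
        labFilling r s q (q m).1 x m (q m).2.1 ((q m).2.2 + 1) = x (u - 1) := by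
  rcases idx_cases r s q ((q m).1, (q m).2.1, (q m).2.2 + 1) with h | ⟨h1, h2, h3⟩
  · left; rw [labFilling, h, lab_zero]
  · have lt := hq.right m _ hm hn h1 h2 h3
    exact Or.inr ⟨_, lt, h2, h3, lab_gt x lt⟩

theorem below_eq (hq : IsStandard r s q) {u m : ℕ} (hum : m < u)
    (hn : u ≤ size r s) (h : q u = ((q m).1, (q m).2.1 + 1, (q m).2.2)) (x : ℕ → ℕ) :
    labFilling r s q (q m).1 x m ((q m).2.1 + 1) (q m).2.2 = x (u - 1) := by
  rw [labFilling, ← h, hq.idx_apply (by omega) hn, lab_gt x hum]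

theorem beside_eq (hq : IsStandard r s q) {u m : ℕ} (hum : m < u)
    (hn : u ≤ size r s) (h : q u = ((q m).1, (q m).2.1, (q m).2.2 + 1)) (x : ℕ → ℕ) :
    labFilling r s q (q m).1 x m (q m).2.1 ((q m).2.2 + 1) = x (u - 1) := by
  rw [labFilling, ← h, hq.idx_apply (by omega) hn, lab_gt x hum]

theorem stepInner_down {F : Filling} {c : ℕ × ℕ} (h : F (c.1 + 1) c.2 ≠ 0)
    (h' : F c.1 (c.2 + 1) = 0 ∨ F (c.1 + 1) c.2 ≤ F c.1 (c.2 + 1)) :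
    stepInner (F, c) = (moveCell F (c.1 + 1, c.2) c, (c.1 + 1, c.2)) := by
  unfold stepInner
  simp only
  rw [if_neg (by tauto), if_pos (by tauto)]

theorem stepInner_right {F : Filling} {c : ℕ × ℕ} (h : F c.1 (c.2 + 1) ≠ 0)
    (h' : F (c.1 + 1) c.2 = 0 ∨ F c.1 (c.2 + 1) < F (c.1 + 1) c.2) :
    stepInner (F, c) = (moveCell F (c.1, c.2 + 1) c, (c.1, c.2 + 1)) := by
  unfold stepInner
  simp only
  rw [if_neg (by tauto), if_neg (by rw [not_or, not_and]; exact ⟨h, fun _ => by omega⟩)]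

/-- The steps of a slide that starts at the inner box at the position `l + 1`, among the letters at
positions up to `l + 1 + d`, amount to the sweep from `l + 1` up to `l + d`. -/
theorem stepInner_iterate {p : Word k} (hp : IsStandard r s p) (x : ℕ → ℕ) (d : ℕ) : ∀ (l K : ℕ),
    l + 1 + d ≤ size r s →
    r (unsweep (size r s) l p (l + 1)).1 + s (unsweep (size r s) l p (l + 1)).1 ≤
      K + (unsweep (size r s) l p (l + 1)).2.1 + (unsweep (size r s) l p (l + 1)).2.2 →
    (∀ u, l + 1 ≤ u → u < l + 1 + d → 0 < x u) → (∀ u, l + 1 + d ≤ u → u < size r s → x u = 0) →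
    (∀ u v, l + 1 ≤ u → u < v → v < l + 1 + d → x u < x v) →
    stepInner^[K] (labFilling r s (unsweep (size r s) l p) (unsweep (size r s) l p (l + 1)).1 x (l + 1),
        (unsweep (size r s) l p (l + 1)).2) =
      (labFilling r s (unsweep (size r s) (l + d) p) (unsweep (size r s) l p (l + 1)).1 x (l + 1 + d),
        (unsweep (size r s) (l + d) p (l + 1 + d)).2) := by
  induction d with
  | zero =>
    intro l K hl hK hx hx0 hx'
    have hq := hp.unsweep (m := l) (by omega)
    simp only [add_zero] at *
    generalize unsweep (size r s) l p = q at *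
    apply Function.iterate_fixed
    unfold stepInner
    simp only
    rw [if_pos]
    constructor
    · rcases below_labFilling hq (m := l + 1) (by omega) hl x with h | ⟨u, h1, h2, h3, h4⟩
      · exact h
      · rw [h4]; exact hx0 _ (by omega) (by omega)
    · rcases beside_labFilling hq (m := l + 1) (by omega) hl x with h | ⟨u, h1, h2, h3, h4⟩
      · exact h
      · rw [h4]; exact hx0 _ (by omega) (by omega)
  | succ d ih =>
    intro l K hl hK hx hx0 hx'
    have hq := hp.unsweep (m := l) (by omega)
    have e : unsweep (size r s) (l + 1) p =
      toggle (size r s) (l + 1) (unsweep (size r s) l p) := rfl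
    have IH := fun K => ih (l + 1) K (by omega)
    rw [show l + (d + 1) = l + 1 + d by omega, show l + 1 + (d + 1) = l + 1 + 1 + d by omega]
    rw [e] at IH
    generalize hqdef : unsweep (size r s) l p = q at *
    have hpos : 0 < x (l + 1) := hx (l + 1) le_rfl (by omega)
    have hbig : ∀ u, l + 1 + 1 < u → u ≤ size r s → x (u - 1) = 0 ∨ x (l + 1) < x (u - 1) := by
      intro u h1 h2
      rcases Nat.lt_or_ge (u - 1) (l + 1 + (d + 1)) with h | h
      · exact Or.inr (hx' _ _ le_rfl (by omega) h)
      · exact Or.inl (hx0 _ h (by omega))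
    have r1 := hq.row_lt (l + 1 + 1) (by omega) (by omega)
    have c1 := hq.col_lt (l + 1 + 1) (by omega) (by omega)
    by_cases hnear : Near (code (size r s) (q (l + 1))) (code (size r s) (q (l + 1 + 1)))
    · rw [toggle_of_near hnear] at IH
      rcases hq.succ_eq_of_near (by omega) (by omega) hnear with h | h
      · have hb := below_eq hq (m := l + 1) (by omega) (by omega) h x
        have hfac : (q (l + 1 + 1)).1 = (q (l + 1)).1 := by rw [h]
        have hdst : (q (l + 1 + 1)).2 = ((q (l + 1)).2.1 + 1, (q (l + 1)).2.2) := by rw [h]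
        rw [hfac, hdst] at r1 c1
        simp only at r1 c1
        obtain ⟨K, rfl⟩ : ∃ K', K = K' + 1 := ⟨K - 1, by omega⟩
        rw [Function.iterate_succ_apply, stepInner_down]
        · have IH := IH K
          rw [hfac, hdst] at IH
          rw [moveCell_labFilling_succ hq (by omega) (by omega) (j := (q (l + 1)).1) rfl
            (by rw [← hfac, ← hdst])]
          exact IH (by simp only; omega) (fun u h1 h2 => hx u (by omega) (by omega))
            (fun u h1 h2 => hx0 u (by omega) h2)
            (fun u v h1 h2 h3 => hx' u v (by omega) h2 (by omega))
        · rw [hb]; exact hpos.ne'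
        · rw [hb]
          rcases beside_labFilling hq (m := l + 1) (by omega) (by omega) x with h0 | ⟨u, h1, h2, h3, h4⟩
          · exact Or.inl h0
          · rw [h4]
            rcases Nat.lt_or_ge (l + 1 + 1) u with h5 | h5
            · exact (hbig u h5 h2).imp_right fun h => h.le
            · obtain rfl : u = l + 1 + 1 := by omega
              exact Or.inr le_rfl
      · have hb := beside_eq hq (m := l + 1) (by omega) (by omega) h x
        have hfac : (q (l + 1 + 1)).1 = (q (l + 1)).1 := by rw [h]
        have hdst : (q (l + 1 + 1)).2 = ((q (l + 1)).2.1, (q (l + 1)).2.2 + 1) := by rw [h]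
        rw [hfac, hdst] at r1 c1
        simp only at r1 c1
        obtain ⟨K, rfl⟩ : ∃ K', K = K' + 1 := ⟨K - 1, by omega⟩
        rw [Function.iterate_succ_apply, stepInner_right]
        · have IH := IH K
          rw [hfac, hdst] at IH
          rw [moveCell_labFilling_succ hq (by omega) (by omega) (j := (q (l + 1)).1) rfl
            (by rw [← hfac, ← hdst])]
          exact IH (by simp only; omega) (fun u h1 h2 => hx u (by omega) (by omega))
            (fun u h1 h2 => hx0 u (by omega) h2)
            (fun u v h1 h2 h3 => hx' u v (by omega) h2 (by omega))
        · rw [hb]; exact hpos.ne'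
        · rw [hb]
          rcases below_labFilling hq (m := l + 1) (by omega) (by omega) x with h0 | ⟨u, h1, h2, h3, h4⟩
          · exact Or.inl h0
          · rw [h4]
            rcases Nat.lt_or_ge (l + 1 + 1) u with h5 | h5
            · exact hbig u h5 h2
            · obtain rfl : u = l + 1 + 1 := by omega
              rw [h3] at h; simp at h
    · have hq' := hq.exch (i := l + 1) (by omega) (by omega) hnear
      rw [toggle_of_not_near hnear] at IH
      have e1 : exch (l + 1) q (l + 1 + 1) = q (l + 1) := exch_right _ _
      have IH := IH K
      rw [e1, labFilling_exch_succ hq (by omega) (by omega) hq'] at IH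
      exact IH (by omega) (fun u h1 h2 => hx u (by omega) (by omega))
            (fun u h1 h2 => hx0 u (by omega) h2)
            (fun u v h1 h2 h3 => hx' u v (by omega) h2 (by omega))

/-! ### Lists -/

/-- Asymmetry leaves only one order for members of an ordered list. Thus patterns in reading words
turn into comparisons of cells. -/
theorem sublist_of_pairwise {α : Type*} {R : α → α → Prop} (hR : ∀ a b, R a b → ¬ R b a) {L : List α}
    (hL : L.Pairwise R) {l : List α} (hl : l.Pairwise R) (h : ∀ a ∈ l, a ∈ L) : l.Sublist L := by
  induction L generalizing l with
  | nil =>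
    cases l with
    | nil => exact List.Sublist.refl _
    | cons a l => exact absurd (h a (by simp)) (by simp)
  | cons b L ih =>
    cases l with
    | nil => exact List.nil_sublist _
    | cons a l =>
      rw [List.pairwise_cons] at hL hl
      by_cases hab : a = b
      · subst hab
        refine (ih hL.2 hl.2 fun c hc => ?_).cons_cons a
        rcases List.mem_cons.mp (h c (List.mem_cons_of_mem _ hc)) with rfl | h1
        · exact absurd (hl.1 c hc) (fun h2 => hR _ _ h2 h2)
        · exact h1
      · have ha : a ∈ L := (List.mem_cons.mp (h a (by simp))).resolve_left hab
        refine (ih hL.2 (List.pairwise_cons.mpr hl) fun c hc => ?_).cons b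
        rcases List.mem_cons.mp hc with rfl | h1
        · exact ha
        · rcases List.mem_cons.mp (h c hc) with rfl | h2
          · exact absurd (hL.1 a ha) (hR _ _ (hl.1 c h1))
          · exact h2

theorem pair_sublist_map {α β : Type*} {R : α → α → Prop} (hR : ∀ a b, R a b → ¬ R b a) {L : List α}
    (hL : L.Pairwise R) (f : α → β) (x y : β) :
    [x, y].Sublist (L.map f) ↔ ∃ c ∈ L, ∃ d ∈ L, R c d ∧ f c = x ∧ f d = y := by
  rw [List.sublist_map_iff]
  constructor
  · rintro ⟨l, hl, e⟩
    obtain ⟨c, d, rfl⟩ : ∃ c d, l = [c, d] :=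
      List.length_eq_two.mp (by have := congrArg List.length e; simpa using this.symm)
    have h1 := hL.sublist hl
    simp only [List.map_cons, List.map_nil, List.cons.injEq, and_true] at e
    exact ⟨c, hl.subset (by simp), d, hl.subset (by simp), by simpa using h1, e.1.symm, e.2.symm⟩
  · rintro ⟨c, hc, d, hd, h, rfl, rfl⟩
    exact ⟨[c, d], sublist_of_pairwise hR hL (by simpa using h) (by simp [hc, hd]), rfl⟩

theorem triple_sublist_map {α β : Type*} {R : α → α → Prop} (hR : ∀ a b, R a b → ¬ R b a)
    {L : List α} (hL : L.Pairwise R) (f : α → β) (x y z : β) :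
    [x, y, z].Sublist (L.map f) ↔ ∃ c ∈ L, ∃ d ∈ L, ∃ e ∈ L, (R c d ∧ R c e ∧ R d e) ∧
      f c = x ∧ f d = y ∧ f e = z := by
  rw [List.sublist_map_iff]
  constructor
  · rintro ⟨l, hl, e⟩
    obtain ⟨c, d, g, rfl⟩ : ∃ c d g, l = [c, d, g] :=
      List.length_eq_three.mp (by have := congrArg List.length e; simpa using this.symm)
    have h1 := hL.sublist hl
    simp only [List.map_cons, List.map_nil, List.cons.injEq, and_true] at e
    refine ⟨c, hl.subset (by simp), d, hl.subset (by simp), g, hl.subset (by simp), ?_,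
      e.1.symm, e.2.1.symm, e.2.2.symm⟩
    simpa [and_assoc] using h1
  · rintro ⟨c, hc, d, hd, g, hg, h, rfl, rfl, rfl⟩
    exact ⟨[c, d, g], sublist_of_pairwise hR hL (by simpa [and_assoc] using h)
      (by simp [hc, hd, hg]), rfl⟩

theorem filter_eq_singleton {α : Type*} {p : α → Bool} {L : List α} (hL : L.Nodup) {c : α}
    (hc : c ∈ L) (h : ∀ d, p d = true ↔ d = c) : L.filter p = [c] := by
  have h1 : ∀ d, d ∈ L.filter p ↔ d = c := fun d => by
    rw [List.mem_filter, h]; exact ⟨fun h => h.2, fun h => ⟨h ▸ hc, h⟩⟩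
  have h2 : (L.filter p).Nodup := hL.filter _
  generalize L.filter p = l at *
  match l with
  | [] => exact absurd ((h1 c).mpr rfl) (by simp)
  | [a] => rw [(h1 a).mp (by simp)]
  | a :: b :: l =>
    have e1 := (h1 a).mp (by simp)
    have e2 := (h1 b).mp (by simp)
    simp [e1, e2] at h2

/-! ### Reading words -/

/-- The order of the cells of a rectangle in the row reading. -/
def ReadBefore (c d : ℕ × ℕ) : Prop := d.1 < c.1 ∨ (c.1 = d.1 ∧ c.2 < d.2)

/-- The order of the cells of a tensor product in the row reading. -/
def ReadBeforeTensor (c d : Fin k × ℕ × ℕ) : Prop := c.1 < d.1 ∨ (c.1 = d.1 ∧ ReadBefore c.2 d.2)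

theorem ReadBefore.asymm (c d : ℕ × ℕ) (h : ReadBefore c d) : ¬ ReadBefore d c := by
  unfold ReadBefore at *; omega

theorem ReadBeforeTensor.asymm (c d : Fin k × ℕ × ℕ) (h : ReadBeforeTensor c d) :
    ¬ ReadBeforeTensor d c := by
  unfold ReadBeforeTensor ReadBefore at *; omega

theorem mem_cellList {r s : ℕ} {c : ℕ × ℕ} : c ∈ cellList r s ↔ c.1 < r ∧ c.2 < s := by
  unfold cellList
  simp only [List.mem_flatMap, List.mem_reverse, List.mem_range, List.mem_map]
  constructor
  · rintro ⟨a, ha, b, hb, rfl⟩; exact ⟨ha, hb⟩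
  · rintro ⟨ha, hb⟩; exact ⟨c.1, ha, c.2, hb, rfl⟩

theorem pairwise_cellList (r s : ℕ) : (cellList r s).Pairwise ReadBefore := by
  unfold cellList
  rw [List.pairwise_flatMap]
  constructor
  · intro a _
    rw [List.pairwise_map]
    exact List.pairwise_lt_range.imp fun h => Or.inr ⟨rfl, h⟩
  · rw [List.pairwise_reverse]
    refine List.pairwise_lt_range.imp fun h => ?_
    intro x hx y hy
    simp only [List.mem_map, List.mem_range] at hx hy
    obtain ⟨_, _, rfl⟩ := hx
    obtain ⟨_, _, rfl⟩ := hy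
    exact Or.inl h

theorem nodup_cellList (r s : ℕ) : (cellList r s).Nodup :=
  (pairwise_cellList r s).imp fun h e => by subst e; exact ReadBefore.asymm _ _ h h

/-- The cells of a tensor product in the order of the row reading. -/
def tensorCells (r s : Fin k → ℕ) : List (Fin k × ℕ × ℕ) :=
  (List.finRange k).flatMap fun j => (cellList (r j) (s j)).map (Prod.mk j)

theorem mem_tensorCells {c : Fin k × ℕ × ℕ} :
    c ∈ tensorCells r s ↔ c.2.1 < r c.1 ∧ c.2.2 < s c.1 := by
  unfold tensorCells
  simp only [List.mem_flatMap, List.mem_finRange, true_and, List.mem_map, mem_cellList]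
  constructor
  · rintro ⟨a, b, hb, rfl⟩; exact hb
  · rintro h; exact ⟨c.1, c.2, h, rfl⟩

theorem pairwise_tensorCells (r s : Fin k → ℕ) : (tensorCells r s).Pairwise ReadBeforeTensor := by
  unfold tensorCells
  rw [List.pairwise_flatMap]
  constructor
  · intro a _
    rw [List.pairwise_map]
    exact (pairwise_cellList _ _).imp fun h => Or.inr ⟨rfl, h⟩
  · refine (List.pairwise_lt_finRange k).imp fun h => ?_
    intro x hx y hy
    simp only [List.mem_map] at hx hy
    obtain ⟨_, _, rfl⟩ := hx
    obtain ⟨_, _, rfl⟩ := hy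
    exact Or.inl h

theorem rw_eq_map (T : Fin k → Filling) :
    rw r s T = (tensorCells r s).map fun c => T c.1 c.2.1 c.2.2 := by
  unfold rw rowWord tensorCells
  rw [List.map_flatMap]
  congr 1
  funext j
  rw [List.map_map]
  rfl

/-! ### Fillings and words -/

/-- The tensor product of fillings with a given word. -/
noncomputable def wordFilling (r s : Fin k → ℕ) (q : Word k) : Fin k → Filling :=
  fun j a b => idx r s q (j, a, b)

namespace IsStandard

theorem mem_tensorCells (hq : IsStandard r s q) {v : ℕ} (h1 : 1 ≤ v) (h2 : v ≤ size r s) :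
    q v ∈ tensorCells r s :=
  KRDual.mem_tensorCells.mpr ⟨hq.row_lt v h1 h2, hq.col_lt v h1 h2⟩

/-- For consecutive letters of one factor, the second cell is neither weakly north-west nor strictly
south-east of the first. It is either strictly lower and weakly to the left, or weakly higher and
strictly to the right; in both cases content and reading order agree. -/
theorem readBefore_iff (hq : IsStandard r s q) {i : ℕ} (hi : 1 ≤ i) (hn : i + 1 ≤ size r s) :
    ReadBeforeTensor (q (i + 1)) (q i) ↔ Desc (size r s) i q := by
  unfold Desc ReadBeforeTensor ReadBefore
  by_cases hf : (q i).1 = (q (i + 1)).1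
  · have hc := code_sub_of_fac_eq (size r s) hf
    have h1 := hq.code_succ_ne hi hn
    have r1 := hq.row_lt (i + 1) (by omega) hn
    have c1 := hq.col_lt (i + 1) (by omega) hn
    have back : ¬ ((q (i + 1)).2.1 ≤ (q i).2.1 ∧ (q (i + 1)).2.2 ≤ (q i).2.2) := by
      rintro ⟨h1, h2⟩
      have := hq.le_of_le (by omega) hn hi (by omega) hf.symm h1 h2
      omega
    have diag : ¬ ((q i).2.1 < (q (i + 1)).2.1 ∧ (q i).2.2 < (q (i + 1)).2.2) := by
      rintro ⟨h1, h2⟩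
      obtain ⟨w, hw, hw', e⟩ :=
        hq.surj (q (i + 1)).1 (q i).2.1 ((q i).2.2 + 1) (by omega) (by omega)
      have e1 : (q w).1 = (q (i + 1)).1 := by rw [e]
      have e2 : (q w).2.1 = (q i).2.1 := by rw [e]
      have e3 : (q w).2.2 = (q i).2.2 + 1 := by rw [e]
      have h3 := hq.le_of_le hi (by omega) hw hw' (hf.trans e1.symm) (by omega) (by omega)
      have h4 := hq.le_of_le hw hw' (by omega) hn e1 (by omega) (by omega)
      have h5 : w = i ∨ w = i + 1 := by omega
      rcases h5 with rfl | rfl <;> omega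
    rw [hf]
    simp only [lt_irrefl, false_or, true_and]
    omega
  · rw [hq.code_lt_iff_of_fac_ne (by omega) hn hi (by omega) (Ne.symm hf)]
    exact ⟨fun h => h.resolve_right fun h => hf h.1.symm, Or.inl⟩

theorem mem_classicalDescents (hq : IsStandard r s q) {i : ℕ} :
    i ∈ classicalDescents r s (wordFilling r s q) ↔
      1 ≤ i ∧ i + 1 ≤ size r s ∧ Desc (size r s) i q := by
  unfold classicalDescents
  rw [Set.mem_ofPred_eq, rw_eq_map]
  refine and_congr_right fun hi => and_congr_right fun hn => ?_
  rw [pair_sublist_map ReadBeforeTensor.asymm (pairwise_tensorCells r s),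
    ← hq.readBefore_iff hi hn]
  constructor
  · rintro ⟨c, -, d, -, h, h1, h2⟩
    rw [(hq.idx_eq_iff (by omega) hn).mp h1, (hq.idx_eq_iff hi (by omega)).mp h2]
    exact h
  · intro h
    exact ⟨_, hq.mem_tensorCells (by omega) hn, _, hq.mem_tensorCells hi (by omega), h,
      hq.idx_apply (by omega) hn, hq.idx_apply hi (by omega)⟩

/-! ### Vertices and words -/

theorem idx_lt_right (hq : IsStandard r s q) {j : Fin k} {a b : ℕ} (ha : a < r j)
    (hb : b + 1 < s j) : idx r s q (j, a, b) < idx r s q (j, a, b + 1) := by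
  obtain ⟨u, hu, hu', eu⟩ := hq.surj j a b ha (by omega)
  obtain ⟨v, hv, hv', ev⟩ := hq.surj j a (b + 1) ha hb
  rw [← eu, ← ev, hq.idx_apply hu hu', hq.idx_apply hv hv']
  exact hq.right u v hu hu' hv hv' (by rw [ev, eu])

theorem idx_lt_down (hq : IsStandard r s q) {j : Fin k} {a b : ℕ} (ha : a + 1 < r j)
    (hb : b < s j) : idx r s q (j, a, b) < idx r s q (j, a + 1, b) := by
  obtain ⟨u, hu, hu', eu⟩ := hq.surj j a b (by omega) hb
  obtain ⟨v, hv, hv', ev⟩ := hq.surj j (a + 1) b ha hb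
  rw [← eu, ← ev, hq.idx_apply hu hu', hq.idx_apply hv hv']
  exact hq.down u v hu hu' hv hv' (by rw [ev, eu])

end IsStandard

theorem mem_rectangle {r s a b : ℕ} : (a, b) ∈ rectangle r s ↔ a < r ∧ b < s := by
  rw [← YoungDiagram.mem_cells]
  change (a, b) ∈ Finset.range r ×ˢ Finset.range s ↔ _
  rw [Finset.mem_product, Finset.mem_range, Finset.mem_range]

/-- The vertex with a given word. -/
noncomputable def IsStandard.toVertex (hq : IsStandard r s q) : Vertex r s :=
  ⟨fun j =>
    { entry := fun a b => idx r s q (j, a, b)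
      row_weak' := by
        intro a b b' h hb
        rw [mem_rectangle] at hb
        induction b', h using Nat.le_induction with
        | base => exact (hq.idx_lt_right hb.1 hb.2).le
        | succ b' h ih =>
          exact (ih ⟨hb.1, by omega⟩).trans (hq.idx_lt_right hb.1 hb.2).le
      col_strict' := by
        intro a a' b h hb
        rw [mem_rectangle] at hb
        induction a', h using Nat.le_induction with
        | base => exact hq.idx_lt_down hb.1 hb.2
        | succ a' h ih =>
          exact (ih ⟨by omega, hb.2⟩).trans (hq.idx_lt_down hb.1 hb.2)
      zeros' := by
        intro a b h
        rw [mem_rectangle] at h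
        exact hq.idx_eq_zero_of_not h },
  ⟨fun j a b ha hb => Finset.mem_Icc.mpr ⟨Nat.one_le_iff_ne_zero.mpr (hq.idx_ne_zero ha hb),
    idx_le _⟩, fun m hm => by
      rw [Finset.mem_Icc] at hm
      refine ⟨q m, hq.idx_apply hm.1 hm.2, fun c hc => ?_⟩
      exact ((hq.idx_eq_iff hm.1 hm.2).mp hc).symm⟩⟩

theorem IsStandard.filling_toVertex (hq : IsStandard r s q) :
    hq.toVertex.filling = wordFilling r s q := rfl

theorem Vertex.filling_injective : Function.Injective (Vertex.filling : Vertex r s → _) := by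
  intro T T' h
  apply Subtype.ext
  funext j
  apply SemistandardYoungTableau.ext
  intro a b
  exact congrFun (congrFun (congrFun h j) a) b

/-- A word that lists the cells of a vertex in the order of their entries. -/
theorem Vertex.isStandard (T : Vertex r s)
    (h : ∀ m, 1 ≤ m → m ≤ size r s → T.filling (q m).1 (q m).2.1 (q m).2.2 = m) :
    IsStandard r s q ∧ T.filling = wordFilling r s q := by
  have hmem : ∀ j a b, T.filling j a b ≠ 0 → a < r j ∧ b < s j := by
    intro j a b h0
    rw [← mem_rectangle]
    by_contra hcon
    exact h0 ((T.1 j).zeros hcon)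
  have huniq : ∀ j a b m, 1 ≤ m → m ≤ size r s → T.filling j a b = m → q m = (j, a, b) := by
    intro j a b m h1 h2 h3
    exact (T.2.2 m (Finset.mem_Icc.mpr ⟨h1, h2⟩)).unique (h m h1 h2) h3
  have hrange : ∀ j a b, a < r j → b < s j → 1 ≤ T.filling j a b ∧ T.filling j a b ≤ size r s :=
    fun j a b ha hb => Finset.mem_Icc.mp (T.2.1 j a b ha hb)
  have hinj : ∀ u v, 1 ≤ u → u ≤ size r s → 1 ≤ v → v ≤ size r s → q u = q v → u = v := by
    intro u v h1 h2 h3 h4 h5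
    rw [← h u h1 h2, h5, h v h3 h4]
  have hcell : ∀ v, 1 ≤ v → v ≤ size r s → (q v).2.1 < r (q v).1 ∧ (q v).2.2 < s (q v).1 :=
    fun v h1 h2 => hmem _ _ _ (by rw [h v h1 h2]; omega)
  have hq : IsStandard r s q :=
    { row_lt := fun v h1 h2 => (hcell v h1 h2).1
      col_lt := fun v h1 h2 => (hcell v h1 h2).2
      surj := fun j a b ha hb =>
        ⟨_, (hrange j a b ha hb).1, (hrange j a b ha hb).2,
          huniq j a b _ (hrange j a b ha hb).1 (hrange j a b ha hb).2 rfl⟩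
      inj := hinj
      down := by
        intro u v h1 h2 h3 h4 h5
        have hv := hcell v h3 h4
        have e1 := h u h1 h2
        have e2 := h v h3 h4
        rw [h5] at e2 hv
        have := (T.1 (q u).1).col_strict (i1 := (q u).2.1) (i2 := (q u).2.1 + 1) (j := (q u).2.2)
          (by omega) (mem_rectangle.mpr hv)
        rw [← e1, ← e2]
        exact this
      right := by
        intro u v h1 h2 h3 h4 h5
        have hv := hcell v h3 h4
        have e1 := h u h1 h2
        have e2 := h v h3 h4
        rw [h5] at e2 hv
        have := (T.1 (q u).1).row_weak (i := (q u).2.1) (j1 := (q u).2.2) (j2 := (q u).2.2 + 1)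
          (by omega) (mem_rectangle.mpr hv)
        refine lt_of_le_of_ne ?_ ?_
        · rw [← e1, ← e2]; exact this
        · rintro rfl
          simp [Prod.ext_iff] at h5 }
  refine ⟨hq, ?_⟩
  funext j a b
  by_cases hc : a < r j ∧ b < s j
  · have h1 := hrange j a b hc.1 hc.2
    exact ((hq.idx_eq_iff h1.1 h1.2).mpr (huniq j a b _ h1.1 h1.2 rfl)).symm
  · rw [wordFilling, hq.idx_eq_zero_of_not hc]
    exact (T.1 j).zeros (by rwa [mem_rectangle])

theorem Vertex.exists_word (T : Vertex r s) (hn : 1 ≤ size r s) :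
    ∃ q, IsStandard r s q ∧ T.filling = wordFilling r s q := by
  have h : ∀ m, ∃ c : Fin k × ℕ × ℕ, 1 ≤ m → m ≤ size r s → T.filling c.1 c.2.1 c.2.2 = m := by
    intro m
    by_cases hm : 1 ≤ m ∧ m ≤ size r s
    · obtain ⟨c, hc, -⟩ := T.2.2 m (Finset.mem_Icc.mpr hm)
      exact ⟨c, fun _ _ => hc⟩
    -- Positions outside 1, …, n need some value; the cell of the entry 1 serves as default.
    · obtain ⟨c, hc, -⟩ := T.2.2 1 (Finset.mem_Icc.mpr ⟨le_rfl, hn⟩)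
      exact ⟨c, fun h1 h2 => absurd ⟨h1, h2⟩ hm⟩
  choose q hq using h
  exact ⟨q, T.isStandard hq⟩

/-! ### Promotion of fillings -/

/-- The carried letter stays in the factor where it started, so letters of other factors never block
it and are just pushed up by one position. -/
theorem sweep_succ_of_fac_ne (hq : IsStandard r s q) {l v : ℕ} (hl : l + 1 ≤ size r s)
    (hv : 1 ≤ v) (hvl : v ≤ l) (hf : (q v).1 ≠ (q (l + 1)).1) :
    sweep (size r s) l q (v + 1) = q v := by
  induction l generalizing q with
  | zero => omega
  | succ l ih =>
    rcases Nat.lt_or_ge l v with h | h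
    · obtain rfl : v = l + 1 := by omega
      rw [sweep, sweep_of_lt _ _ (by omega),
        toggle_of_not_near (not_near_of_fac_ne hq hv hl hf), exch_right]
    · rw [sweep, ih (hq.toggle (by omega) hl) (by omega) h, toggle_of_ne _ (by omega) (by omega)]
      rw [toggle_of_ne _ (by omega) (by omega), fac_toggle_left hq (by omega) hl]
      exact hf

theorem idx_prom_of_fac_ne (hq : IsStandard r s q) (hn : 1 ≤ size r s) {j : Fin k}
    (hf : j ≠ (q (size r s)).1) {a b : ℕ} (ha : a < r j) (hb : b < s j) :
    idx r s (prom r s q) (j, a, b) = idx r s q (j, a, b) + 1 := by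
  obtain ⟨v, h1, h2, h3⟩ := hq.surj j a b ha hb
  rw [← h3, hq.idx_apply h1 h2]
  have hvn : v ≠ size r s := by rintro rfl; rw [h3] at hf; exact hf rfl
  rw [(hq.prom hn).idx_eq_iff (by omega) (by omega)]
  refine sweep_succ_of_fac_ne hq (l := size r s - 1) (by omega) h1 (by omega) ?_
  rw [Nat.sub_add_cancel hn, h3]
  exact hf

theorem jdtOuter_eq (hq : IsStandard r s q) (hn : 1 ≤ size r s) (x : ℕ → ℕ) {F : Filling}
    (hF : setCell F (q (size r s)).2 0 = labFilling r s q (q (size r s)).1 x (size r s))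
    (hx : ∀ u, 1 ≤ u → u < size r s → 0 < x u)
    (hx' : ∀ u v, 1 ≤ u → u < v → v < size r s → x u < x v ∨ (q u).2 = (0, 0)) :
    jdtOuter F (q (size r s)).2 =
      (labFilling r s (prom r s q) (q (size r s)).1 x 1, (prom r s q 1).2) := by
  obtain ⟨l, hl⟩ : ∃ l, size r s = l + 1 := ⟨size r s - 1, by omega⟩
  have h := stepOuter_iterate hq x (l := l) (by omega) _ le_rfl (fun u h1 h2 => hx u h1 (by omega))
    (fun u v h1 h2 h3 => hx' u v h1 h2 (by omega))
  unfold jdtOuter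
  rw [hF, prom_eq hl.symm]
  rw [← hl] at h
  exact h

theorem setCell_wordFilling_last (hq : IsStandard r s q) (hn : 1 ≤ size r s) :
    setCell (wordFilling r s q (q (size r s)).1) (q (size r s)).2 0 =
      labFilling r s q (q (size r s)).1 (fun v => v) (size r s) := by
  funext a b
  rw [setCell_apply, labFilling]
  split_ifs with h
  · rw [h, Prod.mk.eta, hq.idx_apply hn le_rfl, lab_self]
  · rcases idx_cases r s q ((q (size r s)).1, a, b) with h0 | ⟨h1, h2, h3⟩
    · rw [wordFilling, h0]; rfl
    · rw [lab_lt _ (by omega)]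
      · rfl
      · refine lt_of_le_of_ne h2 fun h4 => h ?_
        rw [h4] at h3
        exact (Prod.ext_iff.mp h3).2.symm

/-- The slide at the box with the largest entry. -/
theorem jdtOuter_wordFilling (hq : IsStandard r s q) (hn : 1 ≤ size r s) :
    jdtOuter (wordFilling r s q (q (size r s)).1) (q (size r s)).2 =
      (labFilling r s (prom r s q) (q (size r s)).1 (fun v => v) 1, (prom r s q 1).2) :=
  jdtOuter_eq hq hn _ (setCell_wordFilling_last hq hn) (fun _ h _ => h) (fun _ _ _ h _ => Or.inl h)

/-- In the factor of n, the slide is the sweep, and it leaves the label v-1 on the position v;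
adding 1 restores the position, also for the empty box, where 0 becomes 1. In the other factors all
positions simply grow by 1. -/
theorem pr_wordFilling (hq : IsStandard r s q) (hn : 1 ≤ size r s) :
    pr r s (wordFilling r s q) = wordFilling r s (prom r s q) := by
  have hp := hq.prom hn
  funext j a b
  unfold pr promote
  split_ifs with hc
  · by_cases hj : j = (q (size r s)).1
    · rw [filter_eq_singleton (c := (q (size r s)).2) (nodup_cellList _ _)]
      · simp only [List.foldl_cons, List.foldl_nil]
        rw [hj, jdtOuter_wordFilling hq hn, ← hj]
        have h0 := hp.idx_ne_zero hc.1 hc.2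
        simp only [labFilling, wordFilling]
        unfold lab
        split_ifs <;> (try dsimp only) <;> omega
      · rw [mem_cellList, hj]
        exact ⟨hq.row_lt _ hn le_rfl, hq.col_lt _ hn le_rfl⟩
      · intro d
        rw [decide_eq_true_iff, wordFilling, Prod.mk.eta, hq.idx_eq_iff hn le_rfl, hj]
        rw [Prod.ext_iff]
        exact ⟨fun h => h.2.symm, fun h => ⟨rfl, h.symm⟩⟩
    · rw [List.filter_eq_nil_iff.mpr]
      · exact (idx_prom_of_fac_ne hq hn hj hc.1 hc.2).symm
      · intro d _ h
        rw [decide_eq_true_iff, wordFilling, Prod.mk.eta, hq.idx_eq_iff hn le_rfl] at h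
        exact hj (by rw [h])
  · rw [wordFilling, hp.idx_eq_zero_of_not hc]

theorem mem_descentSet (hq : IsStandard r s q) (hn : 1 ≤ size r s) {i : ℕ} :
    i ∈ descentSet r s (wordFilling r s q) ↔
      (1 ≤ i ∧ i + 1 ≤ size r s ∧ Desc (size r s) i q) ∨
      (i = size r s ∧ 2 ≤ size r s ∧ Desc (size r s) 1 (prom r s q)) := by
  unfold descentSet
  rw [Set.mem_union, hq.mem_classicalDescents, Set.mem_ofPred_eq, pr_wordFilling hq hn,
    (hq.prom hn).mem_classicalDescents]
  simp

theorem descentSet_subset (hq : IsStandard r s q) (hn : 1 ≤ size r s) {i : ℕ}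
    (h : i ∈ descentSet r s (wordFilling r s q)) : 1 ≤ i ∧ i ≤ size r s := by
  rw [mem_descentSet hq hn] at h; omega

/-- For i = n-1, membership of n refers to one more promotion, which is where `desc_prom_prom`
enters. -/
theorem succ_mem_descentSet_prom (hq : IsStandard r s q) {i : ℕ} (hi : 1 ≤ i)
    (hin : i + 1 ≤ size r s) :
    i + 1 ∈ descentSet r s (wordFilling r s (prom r s q)) ↔
      i ∈ descentSet r s (wordFilling r s q) := by
  rw [mem_descentSet (hq.prom (by omega)) (by omega), mem_descentSet hq (by omega)]
  rcases Nat.lt_or_ge (i + 1) (size r s) with h | h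
  · rw [desc_prom hq hi h]
    constructor <;> rintro (h1 | h1) <;> first | omega | exact Or.inl ⟨by omega, by omega, h1.2.2⟩
  · obtain ⟨m, rfl⟩ : ∃ m, i = m + 1 := ⟨i - 1, by omega⟩
    rw [desc_prom_prom hq (m := m) (by omega)]
    constructor
    · rintro (h1 | h1)
      · omega
      · exact Or.inl ⟨hi, hin, h1.2.2⟩
    · rintro (h1 | h1)
      · exact Or.inr ⟨by omega, by omega, h1.2.2⟩
      · omega

theorem one_mem_descentSet_prom (hq : IsStandard r s q) (hn : 1 ≤ size r s) :
    1 ∈ descentSet r s (wordFilling r s (prom r s q)) ↔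
      size r s ∈ descentSet r s (wordFilling r s q) := by
  rw [mem_descentSet (hq.prom hn) hn, mem_descentSet hq hn]
  constructor
  · rintro (h1 | h1)
    · exact Or.inr ⟨rfl, h1.2.1, h1.2.2⟩
    · omega
  · rintro (h1 | h1)
    · omega
    · exact Or.inl ⟨le_rfl, h1.2.1, h1.2.2⟩

/-! ### The moves on words -/

theorem fac_demote_last (hq : IsStandard r s q) (hn : 1 ≤ size r s) :
    (demote r s q (size r s)).1 = (q 1).1 := by
  have h := fac_prom_one (hq.demote hn) hn
  rw [prom_demote] at h
  exact h.symm

theorem idx_demote_of_fac_ne (hq : IsStandard r s q) (hn : 1 ≤ size r s) {j : Fin k}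
    (hf : j ≠ (q 1).1) {a b : ℕ} (ha : a < r j) (hb : b < s j) :
    idx r s q (j, a, b) = idx r s (demote r s q) (j, a, b) + 1 := by
  have h := idx_prom_of_fac_ne (hq.demote hn) hn (j := j) (by rwa [fac_demote_last hq hn]) ha hb
  rwa [prom_demote] at h

theorem jdtInner_eq {p : Word k} (hp : IsStandard r s p) (x : ℕ → ℕ) {l d : ℕ} {j : Fin k}
    {c : ℕ × ℕ} {F : Filling} (hc : unsweep (size r s) l p (l + 1) = (j, c))
    (hF : setCell F c 0 = labFilling r s (unsweep (size r s) l p) j x (l + 1))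
    (hn : l + 1 + d ≤ size r s)
    (hx : ∀ u, l + 1 ≤ u → u < l + 1 + d → 0 < x u)
    (hx0 : ∀ u, l + 1 + d ≤ u → u < size r s → x u = 0)
    (hx' : ∀ u v, l + 1 ≤ u → u < v → v < l + 1 + d → x u < x v) :
    jdtInner (r j) (s j) F c = (labFilling r s (unsweep (size r s) (l + d) p) j x (l + 1 + d),
      (unsweep (size r s) (l + d) p (l + 1 + d)).2) := by
  have h := stepInner_iterate hp x d l (r j + s j) hn (by rw [hc]; simp only; omega) hx hx0 hx'
  rw [hc] at h
  unfold jdtInner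
  rw [hF]
  exact h

theorem jdtInner_demote {p : Word k} (hp : IsStandard r s p) (hn : 1 ≤ size r s) {j : Fin k}
    {c : ℕ × ℕ} {F : Filling} (hc : p 1 = (j, c))
    (hF : setCell F c 0 = labFilling r s p j (fun v => v) 1) :
    jdtInner (r j) (s j) F c = (labFilling r s (demote r s p) j (fun v => v) (size r s),
      (demote r s p (size r s)).2) := by
  have h := jdtInner_eq hp (fun v => v) (l := 0) (d := size r s - 1) hc hF (by omega)
    (fun u h _ => h) (fun u h1 h2 => by omega) (fun u v _ h _ => h)
  rw [h]
  unfold demote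
  simp only [zero_add, Nat.add_sub_cancel' hn]

theorem jdtOuter_wordFilling' (hq : IsStandard r s q) (hn : 1 ≤ size r s) {j : Fin k} {c : ℕ × ℕ}
    (hc : q (size r s) = (j, c)) : jdtOuter (wordFilling r s q j) c =
      (labFilling r s (prom r s q) j (fun v => v) 1, (prom r s q 1).2) := by
  have h := jdtOuter_wordFilling hq hn
  rwa [hc] at h

theorem setCell_labFilling_last (hq : IsStandard r s q) (hn : 1 ≤ size r s) {j : Fin k}
    (hj : (q (size r s)).1 = j) :
    setCell (labFilling r s q j (fun v => v) (size r s)) (q (size r s)).2 (size r s) =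
      wordFilling r s q j := by
  subst hj
  funext a b
  rw [setCell_apply, wordFilling]
  split_ifs with h
  · rw [h]; exact (hq.idx_apply hn le_rfl).symm
  · rw [labFilling]
    rcases idx_cases r s q ((q (size r s)).1, a, b) with h0 | ⟨h1, h2, h3⟩
    · rw [h0]; rfl
    · rw [lab_lt _ (by omega)]
      refine lt_of_le_of_ne h2 fun h4 => h ?_
      rw [h4] at h3
      exact (Prod.ext_iff.mp h3).2.symm

/-- The position of a cell of the factor `j` is not that of a letter in another factor. -/
theorem idx_ne_of_fac_ne {v : ℕ} {j : Fin k} (hv : 1 ≤ v) (h : (q v).1 ≠ j) (c : ℕ × ℕ) :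
    idx r s q (j, c) ≠ v := by
  intro e
  have := apply_idx (r := r) (s := s) (q := q) (c := (j, c)) (by omega)
  rw [e] at this
  exact h (by rw [this])

/-- After promotion the box emptied by n is the letter 1, and the old letter 1, in another factor,
is the letter 2 in an unchanged cell. Exchanging the two lets the demotion slide from that cell
instead, while the box emptied by n receives 1. -/
theorem affine_filling (hq : IsStandard r s q) (hn : 2 ≤ size r s) {l j : Fin k} {c d : ℕ × ℕ}
    (hc : q (size r s) = (l, c)) (hd : q 1 = (j, d)) (hlj : l ≠ j) :
    IsStandard r s (exch 1 (prom r s q)) ∧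
    Function.update (Function.update (wordFilling r s q) l
        (setCell (jdtOuter (wordFilling r s q l) c).1 (jdtOuter (wordFilling r s q l) c).2 1)) j
      (setCell (jdtInner (r j) (s j) (wordFilling r s q j) d).1
        (jdtInner (r j) (s j) (wordFilling r s q j) d).2 (size r s)) =
      wordFilling r s (demote r s (exch 1 (prom r s q))) := by
  have hn1 : 1 ≤ size r s := by omega
  have hp := hq.prom hn1
  have f1 : (prom r s q 1).1 = l := by rw [fac_prom_one hq hn1, hc]
  have e2 : prom r s q 2 = q 1 := by
    refine sweep_succ_of_fac_ne hq (l := size r s - 1) (by omega) le_rfl (by omega) ?_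
    rw [Nat.sub_add_cancel hn1, hc, hd]; exact hlj.symm
  have f2 : (prom r s q 2).1 = j := by rw [e2, hd]
  have hy := hp.exch le_rfl hn (not_near_of_fac_ne hp le_rfl hn (by
    simp only [Nat.reduceAdd]; rw [f1, f2]; exact hlj))
  have iy := hp.idx_exch le_rfl hn hy
  refine ⟨hy, ?_⟩
  have y1 : exch 1 (prom r s q) 1 = (j, d) := (exch_left 1 _).trans (e2.trans hd)
  have hq' := hy.demote hn1
  have flast : (demote r s (exch 1 (prom r s q)) (size r s)).1 = j := by
    rw [fac_demote_last hy hn1, y1]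
  generalize hyy : exch 1 (prom r s q) = y at *
  funext i
  by_cases hij : i = j
  · subst hij
    rw [Function.update_self, jdtInner_demote hy hn1 y1]
    · exact setCell_labFilling_last hq' hn1 flast
    · funext a b
      rw [setCell_apply, labFilling]
      split_ifs with h
      · rw [h, ← y1, hy.idx_apply le_rfl hn1, lab_self]
      · rw [wordFilling]
        by_cases hab : a < r i ∧ b < s i
        · have h1 := idx_prom_of_fac_ne hq hn1 (j := i) (by rw [hc]; exact hlj.symm) hab.1 hab.2
          have h2 : idx r s q (i, a, b) ≠ 1 := by
            rw [ne_eq, hq.idx_eq_iff le_rfl hn1, hd, Prod.mk.injEq]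
            exact fun h' => h h'.2.symm
          have h3 := hq.idx_ne_zero hab.1 hab.2
          rw [iy, h1, Equiv.swap_apply_of_ne_of_ne (by omega) (by omega), lab_gt _ (by omega)]
          rfl
        · rw [hq.idx_eq_zero_of_not hab, hy.idx_eq_zero_of_not hab]; rfl
  · rw [Function.update_of_ne hij]
    have hcell : ∀ a b, a < r i → b < s i →
        Equiv.swap 1 2 (idx r s (prom r s q) (i, a, b)) = idx r s (demote r s y) (i, a, b) + 1 := by
      intro a b ha hb
      rw [← idx_demote_of_fac_ne hy hn1 (by rw [y1]; exact hij) ha hb, iy]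
    have hne2 : ∀ c, idx r s (prom r s q) (i, c) ≠ 2 :=
      idx_ne_of_fac_ne (by omega) (by rw [f2]; exact Ne.symm hij)
    by_cases hil : i = l
    · subst hil
      rw [Function.update_self, jdtOuter_wordFilling' hq hn1 hc]
      funext a b
      simp only [setCell_apply, wordFilling, labFilling]
      by_cases hab : a < r i ∧ b < s i
      · have h1 := hcell a b hab.1 hab.2
        have h0 := hp.idx_ne_zero hab.1 hab.2
        have h2 := hne2 (a, b)
        split_ifs with h
        · have h3 : idx r s (prom r s q) (i, a, b) = 1 := by
            rw [hp.idx_eq_iff le_rfl hn1]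
            exact Prod.ext f1 h.symm
          rw [h3, Equiv.swap_apply_left] at h1
          omega
        · have h3 : idx r s (prom r s q) (i, a, b) ≠ 1 := by
            rw [ne_eq, hp.idx_eq_iff le_rfl hn1]
            intro h'; exact h (by rw [h'])
          rw [Equiv.swap_apply_of_ne_of_ne h3 h2] at h1
          rw [lab_gt _ (by omega), h1]; rfl
      · rw [hp.idx_eq_zero_of_not hab, hq'.idx_eq_zero_of_not hab, if_neg]
        · rfl
        · intro h
          have h4 := hp.row_lt 1 le_rfl hn1
          have h5 := hp.col_lt 1 le_rfl hn1
          rw [f1, ← h] at h4 h5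
          exact hab ⟨h4, h5⟩
    · rw [Function.update_of_ne hil]
      funext a b
      rw [wordFilling, wordFilling]
      by_cases hab : a < r i ∧ b < s i
      · have h1 := hcell a b hab.1 hab.2
        have h2 := idx_prom_of_fac_ne hq hn1 (j := i) (by rw [hc]; exact hil) hab.1 hab.2
        rw [Equiv.swap_apply_of_ne_of_ne (idx_ne_of_fac_ne le_rfl (by rw [f1]; exact Ne.symm hil) _)
          (hne2 _)] at h1
        omega
      · rw [hq.idx_eq_zero_of_not hab, hq'.idx_eq_zero_of_not hab]

/-- The empty box takes the position 1 after the slide, so the entries 1 and 2 are at the positions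
2 and 3: switching them is the exchange at 2, and the slide back is the demotion. -/
theorem barOne_filling (hq : IsStandard r s q) (hn : 3 ≤ size r s) {j : Fin k} {c : ℕ × ℕ}
    (hc : q (size r s) = (j, c)) (h1 : (q 1).1 = j) (h2 : (q 2).1 = j)
    (hy : IsStandard r s (exch 2 (prom r s q))) :
    Function.update (wordFilling r s q) j (setCell
      (jdtInner (r j) (s j) (fun a b => Equiv.swap 1 2 ((jdtOuter (wordFilling r s q j) c).1 a b))
        (jdtOuter (wordFilling r s q j) c).2).1
      (jdtInner (r j) (s j) (fun a b => Equiv.swap 1 2 ((jdtOuter (wordFilling r s q j) c).1 a b))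
        (jdtOuter (wordFilling r s q j) c).2).2 (size r s)) =
      wordFilling r s (demote r s (exch 2 (prom r s q))) := by
  have hn1 : 1 ≤ size r s := by omega
  have hp := hq.prom hn1
  have f1 : (prom r s q 1).1 = j := by rw [fac_prom_one hq hn1, hc]
  have f2 : (prom r s q 2).1 = j := by rw [fac_prom_succ hq le_rfl (by omega), h1]
  have f3 : (prom r s q 3).1 = j := by rw [fac_prom_succ hq (v := 2) (by omega) (by omega), h2]
  have iy := hp.idx_exch (i := 2) (by omega) (by omega) hy
  have y1 : exch 2 (prom r s q) 1 = (j, (prom r s q 1).2) := by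
    rw [exch_of_ne _ (by omega) (by omega), ← f1]
  have hq' := hy.demote hn1
  have flast : (demote r s (exch 2 (prom r s q)) (size r s)).1 = j := by
    rw [fac_demote_last hy hn1, y1]
  generalize hyy : exch 2 (prom r s q) = y at *
  rw [jdtOuter_wordFilling' hq hn1 hc]
  funext i
  by_cases hij : i = j
  · subst hij
    rw [Function.update_self, jdtInner_demote hy hn1 y1]
    · exact setCell_labFilling_last hq' hn1 flast
    · funext a b
      rw [setCell_apply, labFilling]
      split_ifs with h
      · rw [h, ← y1, hy.idx_apply le_rfl hn1, lab_self]
      · have h3 : idx r s (prom r s q) (i, a, b) ≠ 1 := by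
          rw [ne_eq, hp.idx_eq_iff le_rfl hn1]
          intro h'; exact h (by rw [h'])
        simp only [labFilling]
        rw [iy]
        generalize idx r s (prom r s q) (i, a, b) = v at *
        unfold lab
        simp only [Equiv.swap_apply_def]
        split_ifs <;> omega
  · rw [Function.update_of_ne hij]
    funext a b
    rw [wordFilling, wordFilling]
    by_cases hab : a < r i ∧ b < s i
    · have h4 := idx_prom_of_fac_ne hq hn1 (j := i) (by rw [hc]; exact hij) hab.1 hab.2
      have h5 := idx_demote_of_fac_ne hy hn1 (j := i) (by rw [y1]; exact hij) hab.1 hab.2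
      rw [iy, Equiv.swap_apply_of_ne_of_ne (idx_ne_of_fac_ne (by omega) (by rw [f2]; exact Ne.symm hij) _)
        (idx_ne_of_fac_ne (by omega) (by rw [f3]; exact Ne.symm hij) _)] at h5
      omega
    · rw [hq.idx_eq_zero_of_not hab, hq'.idx_eq_zero_of_not hab]

/-! ### The slides in the move \bar t_{n-1} -/

/-- Lower all labels except `0` and `1` by one. -/
def lowerAboveOne (v : ℕ) : ℕ := if v ≤ 1 then v else v - 1

/-- Writing 1 instead of renumbering makes the positions 1 and 2 of the promoted word share the
label 1; `lowerAboveOne` records this. -/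
theorem setCell_jdtOuter_eq (hq : IsStandard r s q) (hn : 1 ≤ size r s) {j : Fin k} {c : ℕ × ℕ}
    (hc : q (size r s) = (j, c)) :
    setCell (jdtOuter (wordFilling r s q j) c).1 (jdtOuter (wordFilling r s q j) c).2 1 =
      fun a b => lowerAboveOne (idx r s (prom r s q) (j, a, b)) := by
  have hp := hq.prom hn
  have f1 : (prom r s q 1).1 = j := by rw [fac_prom_one hq hn, hc]
  rw [jdtOuter_wordFilling' hq hn hc]
  funext a b
  simp only [setCell_apply, labFilling]
  split_ifs with h
  · have h3 : idx r s (prom r s q) (j, a, b) = 1 := by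
      rw [hp.idx_eq_iff le_rfl hn]
      exact Prod.ext f1 h.symm
    rw [h3]; rfl
  · have h3 : idx r s (prom r s q) (j, a, b) ≠ 1 := by
      rw [ne_eq, hp.idx_eq_iff le_rfl hn]
      intro h'; exact h (by rw [h'])
    generalize idx r s (prom r s q) (j, a, b) = v at *
    unfold lowerAboveOne lab
    split_ifs <;> (try dsimp only) <;> omega

/-- The repeated label does no harm to the slide: one of the two positions is the corner of its
factor, the exception that `stepOuter_iterate` admits. -/
theorem jdtOuter_lowered {p : Word k} (hp : IsStandard r s p) (hn : 1 ≤ size r s) {j : Fin k}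
    {d : ℕ × ℕ} (hd : p (size r s) = (j, d)) :
    jdtOuter (fun a b => lowerAboveOne (idx r s p (j, a, b))) d =
      (labFilling r s (prom r s p) j lowerAboveOne 1, (prom r s p 1).2) := by
  have h := jdtOuter_eq hp hn lowerAboveOne
    (F := fun a b => lowerAboveOne (idx r s p (j, a, b))) ?_ ?_ ?_
  · rwa [hd] at h
  · funext a b
    rw [setCell_apply, hd]
    simp only [labFilling]
    split_ifs with h
    · rw [h, ← hd, hp.idx_apply hn le_rfl, lab_self]
    · rcases idx_cases r s p (j, a, b) with h0 | ⟨h1, h2, h3⟩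
      · rw [h0]; rfl
      · rw [lab_lt _ (by omega)]
        refine lt_of_le_of_ne h2 fun h4 => h ?_
        rw [h4, hd] at h3
        exact (Prod.ext_iff.mp h3).2.symm
  · intro u h1 h2
    unfold lowerAboveOne; split_ifs <;> omega
  · intro u v h1 h2 h3
    by_cases hu : u = 1
    · right; rw [hu, hp.one_eq hn]
    · left; unfold lowerAboveOne; split_ifs <;> omega

/-- Two boxes are empty here, the corner and (0, 1). In the exchanged word they are the positions 1
and 2; the label u - 1 keeps the corner at 0. As the toggle at 1 is trivial, the slide from the
position 2 already performs the whole demotion. -/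
theorem jdtInner_lowered {w : Word k} (hw : IsStandard r s w) (hn : 3 ≤ size r s) {j : Fin k}
    (h1 : w 1 = (j, 0, 0)) (h3 : w 3 = (j, 0, 1))
    (hy : IsStandard r s (exch 2 w)) :
    jdtInner (r j) (s j) (labFilling r s w j lowerAboveOne 1) (0, 1) =
      (labFilling r s (demote r s (exch 2 w)) j (fun u => u - 1) (size r s),
        (demote r s (exch 2 w) (size r s)).2) := by
  have y1 : exch 2 w 1 = (j, 0, 0) := by rw [exch_of_ne _ (by omega) (by omega), h1]
  have y2 : exch 2 w 2 = (j, 0, 1) := by rw [exch_left, h3]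
  have iy := hw.idx_exch (i := 2) (by omega) (by omega) hy
  have ht : unsweep (size r s) 1 (exch 2 w) = exch 2 w :=
    toggle_one_of_fac (q := exch 2 w) hy (by omega) (by rw [y1, y2])
  have h := jdtInner_eq hy (fun u => u - 1) (l := 1) (d := size r s - 2) (j := j) (c := (0, 1))
    (F := labFilling r s w j lowerAboveOne 1) (by rw [ht, y2]) ?_ (by omega)
    (fun u h _ => by omega) (fun u h _ => by omega) (fun u v h h' _ => by omega)
  · rw [h, show 1 + (size r s - 2) = size r s - 1 by omega,
      show 1 + 1 + (size r s - 2) = size r s by omega]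
    rfl
  · rw [ht]
    funext a b
    rw [setCell_apply]
    simp only [labFilling]
    rw [iy]
    split_ifs with h
    · have : idx r s w (j, a, b) = 3 := by rw [hw.idx_eq_iff (by omega) hn, h3, h]
      rw [this, Equiv.swap_apply_right, lab_self]
    · have : idx r s w (j, a, b) ≠ 3 := by
        rw [ne_eq, hw.idx_eq_iff (by omega) hn, h3]
        intro h'; exact h (Prod.ext_iff.mp h').2.symm
      generalize idx r s w (j, a, b) = v at *
      unfold lab lowerAboveOne
      simp only [Equiv.swap_apply_def]
      split_ifs <;> (try dsimp only) <;> first | omega | contradiction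

/-- The slide from the corner runs while the last box is still empty, so it stops at the position
n-1. This is enough because the demotion has no effect in its last toggle. -/
theorem jdtInner_truncated {p : Word k} (hp : IsStandard r s p) {m : ℕ} (hm : m + 1 = size r s)
    (hm1 : 1 ≤ m) {j : Fin k} (h1 : p 1 = (j, 0, 0)) (hl : (p (m + 1)).1 = j) :
    setCell (setCell
        (jdtInner (r j) (s j) (labFilling r s p j (fun u => u - 1) (m + 1)) (0, 0)).1
        (p (m + 1)).2 (m + 1))
      (jdtInner (r j) (s j) (labFilling r s p j (fun u => u - 1) (m + 1)) (0, 0)).2 m =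
    wordFilling r s (demote r s p) j := by
  have hd := hp.demote (by omega)
  obtain ⟨m, rfl⟩ : ∃ l, m = l + 1 := ⟨m - 1, by omega⟩
  have hfl : (demote r s p (m + 1 + 1)).1 = j := by
    rw [hm, fac_demote_last hp (by omega), h1]
  have hfm : (demote r s p (m + 1)).1 = j := by
    have := fac_prom_succ hd (v := m + 1) (by omega) (by omega)
    rw [prom_demote, hl] at this
    exact this.symm
  -- The letters n-1 and n of the demoted word share the factor j, so they are neighbours and the
  -- last toggle is trivial.
  have hdem : unsweep (size r s) m p = demote r s p := by
    have e : demote r s p = toggle (size r s) (m + 1) (unsweep (size r s) m p) := demote_eq hm p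
    have e2 := toggle_of_near (hd.near_last (m := m + 1) (by omega) hm (by rw [hfm, hfl]))
    nth_rewrite 1 [e] at e2
    rwa [toggle_toggle] at e2
  have hlast : p (m + 1 + 1) = demote r s p (m + 1 + 1) := by
    rw [← hdem, unsweep_of_lt _ _ (by omega)]
  -- The label 0 from m+1 on keeps the box left by the previous slide empty.
  have h := jdtInner_eq hp (fun u => if u < m + 1 then u else 0) (l := 0) (d := m) (j := j)
    (c := (0, 0)) (F := labFilling r s p j (fun u => u - 1) (m + 1 + 1)) h1 ?_ (by omega)
    (fun u h h' => by rw [if_pos (by omega)]; omega)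
    (fun u h _ => by rw [if_neg (by omega)])
    (fun u v h h' h'' => by rw [if_pos (by omega), if_pos (by omega)]; exact h')
  · rw [h, zero_add, zero_add, add_comm 1 m, hdem, hlast]
    funext a b
    rw [setCell_apply, setCell_apply]
    simp only [labFilling, wordFilling]
    have e1 : (a, b) = (demote r s p (m + 1)).2 ↔ idx r s (demote r s p) (j, a, b) = m + 1 := by
      rw [hd.idx_eq_iff (by omega) (by omega)]
      exact ⟨fun h => Prod.ext hfm h.symm, fun h => by rw [h]⟩
    have e2 : (a, b) = (demote r s p (m + 1 + 1)).2 ↔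
        idx r s (demote r s p) (j, a, b) = m + 1 + 1 := by
      rw [hd.idx_eq_iff (by omega) (by omega)]
      exact ⟨fun h => Prod.ext hfl h.symm, fun h => by rw [h]⟩
    have e3 := idx_le (r := r) (s := s) (q := demote r s p) (j, a, b)
    simp only [e1, e2]
    generalize idx r s (demote r s p) (j, a, b) = v at *
    unfold lab
    split_ifs <;> (try dsimp only) <;> (try split_ifs) <;> omega
  · funext a b
    rw [setCell_apply]
    simp only [labFilling]
    change (if (a, b) = (0, 0) then 0 else lab (fun u => u - 1) (m + 1 + 1) (idx r s p (j, a, b))) =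
      lab (fun u => if u < m + 1 then u else 0) 1 (idx r s p (j, a, b))
    have e3 := idx_le (r := r) (s := s) (q := p) (j, a, b)
    split_ifs with h
    · rw [h, ← h1, hp.idx_apply le_rfl (by omega)]; rfl
    · have : idx r s p (j, a, b) ≠ 1 := by
        rw [ne_eq, hp.idx_eq_iff le_rfl (by omega), h1]
        intro h'; exact h (Prod.ext_iff.mp h').2.symm
      generalize idx r s p (j, a, b) = v at *
      unfold lab
      simp only
      split_ifs <;> omega

/-- All letters that are swept or exchanged lie in the factor j; in any other factor the two
promotions add 2 to each position and the two demotions subtract it again. -/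
theorem update_eq_wordFilling_demote_demote (hq : IsStandard r s q) {m : ℕ} (hm : m + 1 = size r s)
    (hn : 3 ≤ size r s) {j : Fin k} (hc : (q (m + 1)).1 = j) (hl : (q m).1 = j)
    (h2 : (prom r s (prom r s q) 2).1 = j)
    (h3 : (prom r s (prom r s q) 3).1 = j)
    (hy : IsStandard r s (exch 2 (prom r s (prom r s q)))) {F : Filling}
    (hF : F = wordFilling r s (demote r s (demote r s (exch 2 (prom r s (prom r s q))))) j) :
    Function.update (wordFilling r s q) j F =
      wordFilling r s (demote r s (demote r s (exch 2 (prom r s (prom r s q))))) := by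
  have hn1 : 1 ≤ size r s := by omega
  have hp := hq.prom hn1
  have hw := hp.prom hn1
  have hy1 := hy.demote hn1
  have hy2 := hy1.demote hn1
  have f1 : (prom r s q (size r s)).1 = j := by
    rw [← hm, fac_prom_succ hq (by omega) (by omega), hl]
  have g1 : (exch 2 (prom r s (prom r s q)) 1).1 = j := by
    rw [exch_of_ne _ (by omega) (by omega), fac_prom_one hp hn1, f1]
  have g2 : (demote r s (exch 2 (prom r s (prom r s q))) 1).1 = j := by
    have := fac_prom_succ hy1 (v := 1) le_rfl (by omega)
    rw [prom_demote] at this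
    exact this.symm.trans ((congrArg Prod.fst (exch_left 2 _)).trans h3)
  funext i
  by_cases hij : i = j
  · rw [hij, Function.update_self, hF]
  · rw [Function.update_of_ne hij]
    funext a b
    rw [wordFilling, wordFilling]
    by_cases hab : a < r i ∧ b < s i
    · have e1 := idx_prom_of_fac_ne hq hn1 (j := i) (by rw [← hm, hc]; exact hij) hab.1 hab.2
      have e2 := idx_prom_of_fac_ne hp hn1 (j := i) (by rw [f1]; exact hij) hab.1 hab.2
      have e3 := idx_demote_of_fac_ne hy hn1 (j := i) (by rw [g1]; exact hij) hab.1 hab.2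
      have e4 := idx_demote_of_fac_ne hy1 hn1 (j := i) (by rw [g2]; exact hij) hab.1 hab.2
      rw [hw.idx_exch (by omega) (by omega) hy,
        Equiv.swap_apply_of_ne_of_ne (idx_ne_of_fac_ne (by omega) (by rw [h2]; exact Ne.symm hij) _)
        (idx_ne_of_fac_ne (by omega) (by rw [h3]; exact Ne.symm hij) _)] at e3
      omega
    · rw [hq.idx_eq_zero_of_not hab, hy2.idx_eq_zero_of_not hab]

theorem lowerAboveOne_eq_iff {v n : ℕ} (hn : 3 ≤ n) :
    lowerAboveOne v = n - 1 ↔ v = n := by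
  unfold lowerAboveOne; split_ifs <;> omega

theorem lab_lowerAboveOne_eq_one_iff {v : ℕ} : lab lowerAboveOne 1 v = 1 ↔ v = 2 ∨ v = 3 := by
  unfold lab lowerAboveOne
  split_ifs <;> first
    | omega
    | (simp only [false_iff]; omega)

/-- The first three letters after two promotions, if `n - 1` is a descent and `n` is none. -/
theorem first_letters {w : Word k} (hw : IsStandard r s w) (hn : 3 ≤ size r s) {j : Fin k}
    (f1 : (w 1).1 = j) (f2 : (w 2).1 = j) (f3 : (w 3).1 = j) (hd : Desc (size r s) 1 w)
    (hd' : ¬ Desc (size r s) 2 w) :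
    w 1 = (j, 0, 0) ∧ w 2 = (j, 1, 0) ∧ w 3 = (j, 0, 1) ∧ IsStandard r s (exch 2 w) := by
  have e1 : w 1 = (j, 0, 0) := by rw [hw.one_eq (by omega), f1]
  have a1 : (w 1).2.1 = 0 := by rw [e1]
  have b1 : (w 1).2.2 = 0 := by rw [e1]
  have c12 := code_sub_of_fac_eq (size r s) (f1.trans f2.symm)
  have c13 := code_sub_of_fac_eq (size r s) (f1.trans f3.symm)
  have near := hw.near_one_two (by omega) (f1.trans f2.symm)
  have hne := hw.code_succ_ne (u := 2) (by omega) hn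
  have hne' := hw.code_add_two_ne (u := 1) le_rfl hn
  unfold Desc at hd hd'
  simp only [Nat.reduceAdd] at hd hd' near hne hne'
  have e2 : w 2 = (j, 1, 0) := by
    rcases hw.succ_eq_of_near le_rfl (by omega) near with h | h <;>
      simp only [Nat.reduceAdd, a1, b1, f1, zero_add] at h
    · exact h
    · rw [h] at c12
      push_cast at c12
      rw [h] at hd
      omega
  -- The second letter has content -1. Since 2 is no descent, the third content is at least -1, and
  -- it differs from -1 and from the 0 of the corner, so it is positive.
  have hc : (w 3).2.1 < (w 3).2.2 := by omega
  have e3 : w 3 = (j, 0, 1) := by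
    have r3 := hw.row_lt 3 (by omega) hn
    have s3 := hw.col_lt 3 (by omega) hn
    rw [f3] at r3 s3
    obtain ⟨u, hu, hu', e⟩ := hw.surj j 0 1 (by omega) (by omega)
    have h3 := hw.le_of_le hu hu' (v := 3) (by omega) hn (by rw [e, f3]) (by rw [e]; simp)
      (by rw [e]; simp only; omega)
    have h4 : u ≠ 1 := by rintro rfl; rw [e1] at e; simp at e
    have h5 : u ≠ 2 := by rintro rfl; rw [e2] at e; simp at e
    obtain rfl : u = 3 := by omega
    exact e
  refine ⟨e1, e2, e3, hw.exch (by omega) hn ?_⟩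
  simp only [Nat.reduceAdd]
  rw [e2, e3]
  have := code_sub_of_fac_eq (size r s) (c := (j, 1, 0)) (d := (j, 0, 1)) rfl
  push_cast at this
  omega

/-- The boxes d and (0, b) are forced: n-1 is at the last letter of the promoted word, and the only
1 in the first row is then in column 1. The two outer slides are two promotions and the two inner
ones two demotions. Sliding at (0, 1) before the corner accounts for the exchange at 2 in the
middle. -/
theorem barLast_filling (hq : IsStandard r s q) {m : ℕ} (hm : m + 1 = size r s) (hn : 3 ≤ size r s)
    {j : Fin k} {c : ℕ × ℕ} (hc : q (size r s) = (j, c)) (hl : (q m).1 = j) (h1 : (q 1).1 = j)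
    (hd : Desc (size r s) m q) (hd' : ¬ Desc (size r s) 1 (prom r s q)) {F : Fin k → Filling} :
    (∃ (d : ℕ × ℕ) (b : ℕ),
      let P := jdtOuter (wordFilling r s q j) c
      let U := setCell P.1 P.2 1
      let Q := jdtOuter U d
      let X := jdtInner (r j) (s j) Q.1 (0, b)
      let Y := jdtInner (r j) (s j) X.1 Q.2
      U d.1 d.2 = size r s - 1 ∧ Q.1 0 b = 1 ∧
      F = Function.update (wordFilling r s q) j
        (setCell (setCell Y.1 X.2 (size r s)) Y.2 (size r s - 1))) ↔
    IsStandard r s (exch 2 (prom r s (prom r s q))) ∧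
      F = wordFilling r s (demote r s (demote r s (exch 2 (prom r s (prom r s q))))) := by
  have hn1 : 1 ≤ size r s := by omega
  have hp := hq.prom hn1
  have hw := hp.prom hn1
  have f1 : (prom r s q 1).1 = j := by rw [fac_prom_one hq hn1, hc]
  have f2 : (prom r s q 2).1 = j := by rw [fac_prom_succ hq le_rfl (by omega), h1]
  have fl : (prom r s q (size r s)).1 = j := by
    rw [← hm, fac_prom_succ hq (by omega) (by omega), hl]
  have g1 : (prom r s (prom r s q) 1).1 = j := by rw [fac_prom_one hp hn1, fl]
  have g2 : (prom r s (prom r s q) 2).1 = j := by rw [fac_prom_succ hp le_rfl (by omega), f1]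
  have g3 : (prom r s (prom r s q) 3).1 = j := by
    rw [fac_prom_succ hp (v := 2) (by omega) (by omega), f2]
  obtain ⟨m, rfl⟩ : ∃ l, m = l + 1 := ⟨m - 1, by omega⟩
  obtain ⟨e1, e2, e3, hy⟩ := first_letters hw hn g1 g2 g3 ((desc_prom_prom hq (by omega)).mpr hd)
    (by rw [desc_prom hp le_rfl (by omega)]; exact hd')
  have hlast : prom r s q (size r s) = (j, (prom r s q (size r s)).2) := Prod.ext fl rfl
  have hU := setCell_jdtOuter_eq hq hn1 hc
  have hQ := jdtOuter_lowered hp hn1 hlast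
  have hX := jdtInner_lowered hw hn e1 e3 hy
  have hx := hy.demote hn1
  have y1 : (demote r s (exch 2 (prom r s (prom r s q))) 1).1 = j := by
    have := fac_prom_succ hx (v := 1) le_rfl (by omega)
    rw [prom_demote] at this
    exact this.symm.trans ((congrArg Prod.fst (exch_left 2 _)).trans g3)
  have yl : (demote r s (exch 2 (prom r s (prom r s q))) (size r s)).1 = j := by
    rw [fac_demote_last hy hn1, exch_of_ne _ (by omega) (by omega), g1]
  have hY := jdtInner_truncated hx hm (by omega) (j := j) (by rw [hx.one_eq hn1, y1])
    (by rw [hm, yl])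
  rw [hm, show m + 1 = size r s - 1 by omega] at hY
  have hF := update_eq_wordFilling_demote_demote hq hm hn (by rw [hm, hc]) hl g2 g3 hy hY
  dsimp only
  simp only [hU]
  have hd0 : ∀ d : ℕ × ℕ, lowerAboveOne (idx r s (prom r s q) (j, d.1, d.2)) = size r s - 1 ↔
      d = (prom r s q (size r s)).2 := by
    intro d
    rw [lowerAboveOne_eq_iff hn, hp.idx_eq_iff hn1 le_rfl, hlast]
    simp only [Prod.mk.injEq, true_and]
    exact eq_comm
  have hb0 : ∀ b, labFilling r s (prom r s (prom r s q)) j lowerAboveOne 1 0 b = 1 ↔ b = 1 := by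
    intro b
    rw [labFilling, lab_lowerAboveOne_eq_one_iff, hw.idx_eq_iff (by omega) (by omega),
      hw.idx_eq_iff (by omega) hn, e2, e3]
    simp [eq_comm]
  constructor
  · rintro ⟨d, b, h1, h2, h3⟩
    rw [hd0] at h1
    subst h1
    rw [hQ, hb0] at h2
    subst h2
    rw [hQ] at h3
    dsimp only at h3
    rw [hX] at h3
    dsimp only at h3
    rw [e1] at h3
    exact ⟨hy, h3.trans hF⟩
  · rintro ⟨-, h⟩
    refine ⟨(prom r s q (size r s)).2, 1, (hd0 _).mpr rfl, ?_, ?_⟩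
    · rw [hQ]; exact (hb0 1).mpr rfl
    · rw [hQ]
      dsimp only
      rw [hX]
      dsimp only
      rw [e1, h]
      exact hF.symm

/-! ### Promotion of the moves -/

/-- `T'` is obtained from `T` by one of the moves. -/
def Move (r s : Fin k → ℕ) (T T' : Fin k → Filling) : Prop :=
  MoveSwap r s T T' ∨ MoveAffine r s T T' ∨ MoveBarOne r s T T' ∨ MoveBarLast r s T T'

theorem descentSet_subset_of_prom {p : Word k} (hq : IsStandard r s q) (hp : IsStandard r s p)
    (hn : 1 ≤ size r s) (h : descentSet r s (wordFilling r s (prom r s q)) ⊆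
      descentSet r s (wordFilling r s (prom r s p))) :
    descentSet r s (wordFilling r s q) ⊆ descentSet r s (wordFilling r s p) := by
  intro i hi
  obtain ⟨h1, h2⟩ := descentSet_subset hq hn hi
  rcases Nat.lt_or_ge i (size r s) with h3 | h3
  · rw [← succ_mem_descentSet_prom hp h1 h3]
    exact h ((succ_mem_descentSet_prom hq h1 h3).mpr hi)
  · obtain rfl : i = size r s := by omega
    rw [← one_mem_descentSet_prom hp hn]
    exact h ((one_mem_descentSet_prom hq hn).mpr hi)

theorem incomparable_prom {p : Word k} (hq : IsStandard r s q) (hp : IsStandard r s p)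
    (hn : 1 ≤ size r s) (h : Incomparable r s (wordFilling r s q) (wordFilling r s p)) :
    Incomparable r s (wordFilling r s (prom r s q)) (wordFilling r s (prom r s p)) :=
  ⟨fun h' => h.1 (descentSet_subset_of_prom hq hp hn h'),
    fun h' => h.2 (descentSet_subset_of_prom hp hq hn h')⟩

theorem moveSwap_of_exch {p : Word k} {i : ℕ} (hq : IsStandard r s q) (hp : IsStandard r s p)
    (hi : 1 ≤ i) (hn : i + 1 ≤ size r s) (e : p = exch i q)
    (h : Incomparable r s (wordFilling r s q) (wordFilling r s p)) :
    MoveSwap r s (wordFilling r s q) (wordFilling r s p) := by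
  refine ⟨i, hi, hn, ?_, h⟩
  subst e
  funext j a b
  exact hq.idx_exch hi hn hp (j, a, b)

theorem prom_injective : Function.Injective (prom r s : Word k → Word k) :=
  Function.LeftInverse.injective demote_prom

/-- `sweep_dual` moves the equivalence to j+1, where it is one of two exchanges; it is not the
identity, since promotion is injective. -/
theorem moveSwap_prom_of_dual {p : Word k} {j : ℕ} (hq : IsStandard r s q) (hp : IsStandard r s p)
    (hj : 1 ≤ j) (hn : j + 3 ≤ size r s) (e : p = dual (size r s) j q) (hne : p ≠ q)
    (h : Incomparable r s (wordFilling r s q) (wordFilling r s p)) :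
    MoveSwap r s (wordFilling r s (prom r s q)) (wordFilling r s (prom r s p)) := by
  have hn1 : 1 ≤ size r s := by omega
  have h1 := incomparable_prom hq hp hn1 h
  have h2 : prom r s p = dual (size r s) (j + 1) (prom r s q) := by
    rw [e]; exact sweep_dual hq hj (by omega) (by omega)
  unfold dual at h2
  split_ifs at h2
  · exact moveSwap_of_exch (hq.prom hn1) (hp.prom hn1) (by omega) (by omega) h2 h1
  · exact moveSwap_of_exch (hq.prom hn1) (hp.prom hn1) (by omega) (by omega) h2 h1
  · exact absurd (prom_injective h2) hne

/-! ### Entries in the reading word of one factor -/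

theorem pair_sublist_rowWord_iff (hq : IsStandard r s q) {i : ℕ} (hi : 1 ≤ i)
    (hn : i + 1 ≤ size r s) {j : Fin k} :
    [i + 1, i].Sublist (rowWord (r j) (s j) (wordFilling r s q j)) ↔
      (q (i + 1)).1 = j ∧ (q i).1 = j ∧ Desc (size r s) i q := by
  unfold rowWord
  rw [pair_sublist_map ReadBefore.asymm (pairwise_cellList _ _), ← hq.readBefore_iff hi hn]
  unfold ReadBeforeTensor
  constructor
  · rintro ⟨c, -, d, -, h, h1, h2⟩
    have e1 := (hq.idx_eq_iff (by omega) hn).mp h1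
    have e2 := (hq.idx_eq_iff hi (by omega)).mp h2
    rw [e1, e2]
    exact ⟨rfl, rfl, Or.inr ⟨rfl, h⟩⟩
  · rintro ⟨h1, h2, h3⟩
    have h4 := h3.resolve_left (by rw [h1, h2]; exact lt_irrefl _)
    refine ⟨(q (i + 1)).2, ?_, (q i).2, ?_, h4.2, ?_, ?_⟩
    · rw [mem_cellList, ← h1]
      exact ⟨hq.row_lt _ (by omega) hn, hq.col_lt _ (by omega) hn⟩
    · rw [mem_cellList, ← h2]
      exact ⟨hq.row_lt _ hi (by omega), hq.col_lt _ hi (by omega)⟩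
    · rw [wordFilling, ← h1]; exact hq.idx_apply (by omega) hn
    · rw [wordFilling, ← h2]; exact hq.idx_apply hi (by omega)

theorem mem_rowWord_iff (hq : IsStandard r s q) {v : ℕ} (hv : 1 ≤ v) (hn : v ≤ size r s)
    {j : Fin k} : v ∈ rowWord (r j) (s j) (wordFilling r s q j) ↔ (q v).1 = j := by
  unfold rowWord
  rw [List.mem_map]
  constructor
  · rintro ⟨c, -, h⟩
    rw [(hq.idx_eq_iff hv hn).mp h]
  · intro h
    refine ⟨(q v).2, ?_, ?_⟩
    · rw [mem_cellList, ← h]; exact ⟨hq.row_lt _ hv hn, hq.col_lt _ hv hn⟩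
    · rw [wordFilling, ← h]; exact hq.idx_apply hv hn

theorem triple_sublist_rowWord_iff (hq : IsStandard r s q) {x y z : ℕ} (hx : 1 ≤ x)
    (hx' : x ≤ size r s) (hy : 1 ≤ y) (hy' : y ≤ size r s) (hz : 1 ≤ z) (hz' : z ≤ size r s)
    {j : Fin k} :
    [x, y, z].Sublist (rowWord (r j) (s j) (wordFilling r s q j)) ↔
      ((q x).1 = j ∧ (q y).1 = j ∧ (q z).1 = j) ∧
        ReadBefore (q x).2 (q y).2 ∧ ReadBefore (q x).2 (q z).2 ∧ ReadBefore (q y).2 (q z).2 := by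
  unfold rowWord
  rw [triple_sublist_map ReadBefore.asymm (pairwise_cellList _ _)]
  constructor
  · rintro ⟨c, -, d, -, e, -, h, h1, h2, h3⟩
    have e1 := (hq.idx_eq_iff hx hx').mp h1
    have e2 := (hq.idx_eq_iff hy hy').mp h2
    have e3 := (hq.idx_eq_iff hz hz').mp h3
    rw [e1, e2, e3]
    exact ⟨⟨rfl, rfl, rfl⟩, h⟩
  · rintro ⟨⟨h1, h2, h3⟩, h⟩
    refine ⟨(q x).2, ?_, (q y).2, ?_, (q z).2, ?_, h, ?_, ?_, ?_⟩
    · rw [mem_cellList, ← h1]; exact ⟨hq.row_lt _ hx hx', hq.col_lt _ hx hx'⟩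
    · rw [mem_cellList, ← h2]; exact ⟨hq.row_lt _ hy hy', hq.col_lt _ hy hy'⟩
    · rw [mem_cellList, ← h3]; exact ⟨hq.row_lt _ hz hz', hq.col_lt _ hz hz'⟩
    · rw [wordFilling, ← h1]; exact hq.idx_apply hx hx'
    · rw [wordFilling, ← h2]; exact hq.idx_apply hy hy'
    · rw [wordFilling, ← h3]; exact hq.idx_apply hz hz'

theorem size_mem_descentSet (hq : IsStandard r s q) (hn : 2 ≤ size r s) :
    size r s ∈ descentSet r s (wordFilling r s q) ↔ Desc (size r s) 1 (prom r s q) := by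
  rw [mem_descentSet hq (by omega)]
  constructor
  · rintro (h | h)
    · omega
    · exact h.2.2
  · exact fun h => Or.inr ⟨rfl, hn, h⟩

/-! #### Swaps in two factors -/

/-- Below n-1 the exchange is shifted by one. At n-1, `prom_prom_exch` followed by a demotion is
exactly the word form of t_n. -/
theorem move_prom_of_fac_ne {i : ℕ} (hq : IsStandard r s q) (hp : IsStandard r s (exch i q))
    (hi : 1 ≤ i) (hn : i + 1 ≤ size r s) (hf : (q i).1 ≠ (q (i + 1)).1)
    (h : Incomparable r s (wordFilling r s q) (wordFilling r s (exch i q))) :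
    Move r s (wordFilling r s (prom r s q)) (wordFilling r s (prom r s (exch i q))) := by
  have hn1 : 1 ≤ size r s := by omega
  have h1 := incomparable_prom hq hp hn1 h
  have hq1 := hq.prom hn1
  rcases Nat.lt_or_ge (i + 1) (size r s) with h2 | h2
  · exact Or.inl (moveSwap_of_exch hq1 (hp.prom hn1) (by omega) h2 (prom_exch hq hi h2 hf) h1)
  · obtain ⟨m, rfl⟩ : ∃ m, i = m + 1 := ⟨i - 1, by omega⟩
    have hm : m + 2 = size r s := by omega
    have f1 : (prom r s q 1).1 = (q (m + 2)).1 := by rw [fac_prom_one hq hn1, hm]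
    have f2 : (prom r s q (size r s)).1 = (q (m + 1)).1 := by
      rw [← hm]; exact fac_prom_succ hq hi hn
    have key := (affine_filling hq1 (by omega) (l := (q (m + 1)).1) (j := (q (m + 2)).1)
      (c := (prom r s q (size r s)).2) (d := (prom r s q 1).2)
      (Prod.ext f2 rfl) (Prod.ext f1 rfl) hf).2
    rw [← prom_prom_exch hq hm hf, demote_prom] at key
    refine Or.inr (Or.inl ⟨_, _, _, _, hf, ?_, ?_, key.symm, h1⟩)
    · rw [← f2]; exact hq1.idx_apply hn1 le_rfl
    · change idx r s _ ((q (m + 2)).1, _) = 1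
      rw [← f1]; exact hq1.idx_apply le_rfl hn1

/-! #### Swaps in one factor -/

/-- By `prom_prom_prom_exch`, `prom` of the original word is `demote`² ∘ `exch 2` ∘ `prom`² of
`prom` of the exchanged word. The two comparisons make n-1, but not n, a descent of the latter, so
the move starts there and the edge is reversed. -/
theorem moveBarLast_prom {m : ℕ} (hq : IsStandard r s q) (hp : IsStandard r s (exch (m + 1) q))
    (hm : m + 3 = size r s) (h2 : (q (m + 1)).1 = (q (m + 2)).1)
    (h3 : (q (m + 2)).1 = (q (m + 3)).1)
    (hc : code (size r s) (q (m + 1)) < code (size r s) (q (m + 3)))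
    (hc' : code (size r s) (q (m + 3)) < code (size r s) (q (m + 2))) :
    MoveBarLast r s (wordFilling r s (prom r s (exch (m + 1) q)))
      (wordFilling r s (prom r s q)) := by
  have hn1 : 1 ≤ size r s := by omega
  have e := prom_prom_prom_exch hq hm (Or.inl ⟨hc, hc'⟩) h2 h3
  have x1 : exch (m + 1) q (m + 1) = q (m + 2) := exch_left _ _
  have x2 : exch (m + 1) q (m + 2) = q (m + 1) := exch_right _ _
  have x3 : exch (m + 1) q (m + 3) = q (m + 3) := exch_of_ne _ (by omega) (by omega)
  have e' : exch 2 (prom r s (prom r s (prom r s (exch (m + 1) q)))) =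
      prom r s (prom r s (prom r s q)) := by rw [e, exch_exch]
  have d1 : Desc (size r s) (m + 1) (exch (m + 1) q) := by
    rw [desc_exch]; exact hc.trans hc'
  have d2 : ¬ Desc (size r s) (m + 2) (exch (m + 1) q) := by
    unfold Desc
    rw [x2, show exch (m + 1) q (m + 2 + 1) = q (m + 3) from x3]
    omega
  generalize exch (m + 1) q = y at *
  have hp1 := hp.prom hn1
  have f1 : (prom r s y 1).1 = (q (m + 1)).1 := by
    rw [fac_prom_one hp hn1, ← hm, x3, ← h3, h2]
  have f2 : (prom r s y (m + 2)).1 = (q (m + 1)).1 := by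
    rw [fac_prom_succ hp (v := m + 1) (by omega) (by omega), x1, h2]
  have f3 : (prom r s y (m + 3)).1 = (q (m + 1)).1 := by
    rw [fac_prom_succ hp (v := m + 2) (by omega) (by omega), x2]
  have f3' : (prom r s y (size r s)).1 = (q (m + 1)).1 := by rw [← hm, f3]
  have d3 : Desc (size r s) (m + 2) (prom r s y) :=
    (desc_prom hp (i := m + 1) (by omega) (by omega)).mpr d1
  have d4 : ¬ Desc (size r s) 1 (prom r s (prom r s y)) := by
    rw [desc_prom_prom hp (m := m + 1) (by omega)]; exact d2
  obtain ⟨d, b, h4, h5, h6⟩ := (barLast_filling hp1 (m := m + 2) hm (by omega)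
    (c := (prom r s y (size r s)).2) (Prod.ext f3' rfl) f2 f1 d3 d4
    (F := wordFilling r s (prom r s q))).mpr (by
      rw [e', demote_prom, demote_prom]
      exact ⟨((hq.prom hn1).prom hn1).prom hn1, rfl⟩)
  refine ⟨_, _, d, b, (mem_rowWord_iff hp1 le_rfl hn1).mpr f1, ?_, ?_, ?_, h4, h5, h6⟩
  · have := (pair_sublist_rowWord_iff hp1 (i := m + 2) (by omega) (by omega)).mpr ⟨f3, f2, d3⟩
    rw [← hm]
    exact this
  · rw [size_mem_descentSet hp1 (by omega)]; exact d4
  · rw [← f3']; exact hp1.idx_apply hn1 le_rfl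

/-- A descent lost by the exchange is i-1, i+1 or n. The first two say that the content of the
letter i-1 or i+2 lies between those of the exchanged letters; n is excluded by monotonicity of
sweeps. -/
theorem move_prom_of_fac_eq {i : ℕ} (hq : IsStandard r s q) (hp : IsStandard r s (exch i q))
    (hi : 1 ≤ i) (hn : i + 1 ≤ size r s) (hf : (q i).1 = (q (i + 1)).1)
    (hc : code (size r s) (q i) < code (size r s) (q (i + 1)))
    (h : Incomparable r s (wordFilling r s q) (wordFilling r s (exch i q))) :
    Move r s (wordFilling r s (prom r s q)) (wordFilling r s (prom r s (exch i q))) ∨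
      Move r s (wordFilling r s (prom r s (exch i q))) (wordFilling r s (prom r s q)) := by
  have hn1 : 1 ≤ size r s := by omega
  have hnear := hq.not_near_of_exch hi hn hp
  have hi2 : i ≠ 1 := by
    rintro rfl; exact hnear (hq.near_one_two hn hf)
  have hin : i + 1 ≠ size r s := fun e => hnear (hq.near_last hi e hf)
  have hne : exch i q ≠ q := fun e => by
    have := congrFun e i
    rw [exch_left] at this
    rw [this] at hc
    exact lt_irrefl _ hc
  obtain ⟨d, hd, hd'⟩ := Set.not_subset.mp h.1
  rw [mem_descentSet hq hn1] at hd
  rw [mem_descentSet hp hn1, not_or] at hd'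
  rcases hd with ⟨h1, h2, h3⟩ | ⟨h1, h2, h3⟩
  · have h4 : ¬ Desc (size r s) d (exch i q) := fun h4 => hd'.1 ⟨h1, h2, h4⟩
    have hdi : d ≠ i := by
      rintro rfl; unfold Desc at h3; omega
    by_cases e1 : i = d + 1
    · subst e1
      unfold Desc at h3 h4
      rw [exch_left, exch_of_ne _ (by omega) (by omega)] at h4
      have h5 := hq.code_add_two_ne h1 (by omega)
      refine Or.inl (Or.inl (moveSwap_prom_of_dual hq hp h1 (by omega) ?_ hne h))
      simp only [add_assoc, Nat.reduceAdd] at h4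
      exact (if_pos (Or.inl ⟨h3, by omega⟩)).symm
    by_cases e2 : d = i + 1
    · subst e2
      unfold Desc at h3 h4
      rw [exch_right, exch_of_ne _ (by omega) (by omega)] at h4
      have h5 := hq.code_add_two_ne hi (by omega)
      simp only [add_assoc, Nat.reduceAdd] at h3 h4
      rcases Nat.lt_or_ge (i + 2) (size r s) with h6 | h6
      · refine Or.inl (Or.inl (moveSwap_prom_of_dual hq hp hi h6 ?_ hne h))
        unfold dual
        rw [if_neg (by omega), if_pos (by omega)]
      · obtain ⟨m, rfl⟩ : ∃ m, i = m + 1 := ⟨i - 1, by omega⟩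
        simp only [add_assoc, Nat.reduceAdd] at h3 h4 h5 hf hc
        -- A content between two contents of one factor belongs to that factor, as larger contents
        -- never belong to smaller factors.
        have h7 : (q (m + 2)).1 = (q (m + 3)).1 := by
          by_contra h7
          have h8 := hq.code_lt_iff_of_fac_ne (u := m + 1) (v := m + 3) hi (by omega) (by omega)
            (by omega) (hf.trans_ne h7)
          have h9 := hq.code_lt_iff_of_fac_ne (u := m + 3) (v := m + 2) (by omega) (by omega)
            (by omega) (by omega) (Ne.symm h7)
          have h10 := h8.mp (by omega)
          rw [hf] at h10
          exact lt_asymm h10 (h9.mp h3)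
        exact Or.inr (Or.inr (Or.inr (Or.inr
          (moveBarLast_prom hq hp (by omega) hf h7 (by omega) h3))))
    · exact absurd ((desc_congr (exch_of_ne _ hdi (by omega))
        (exch_of_ne _ (by omega) (by omega))).mpr h3) h4
  -- Here n is the lost descent. The exchange puts the larger content first, which can only lower
  -- the content carried past the pair, so this descent would persist.
  · exact absurd ⟨h1, h2, desc_prom_exch hq (by omega) (by omega) hp hf hc h3⟩ hd'.2

/-! ### Images of the moves t_n, \bar t_1 and \bar t_{n-1} -/

theorem moveSwap_prom_of_moveAffine {p : Word k} (hq : IsStandard r s q) (hp : IsStandard r s p)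
    (hn : 1 ≤ size r s) (h : MoveAffine r s (wordFilling r s q) (wordFilling r s p)) :
    MoveSwap r s (wordFilling r s (prom r s q)) (wordFilling r s (prom r s p)) := by
  obtain ⟨l, j, c, d, hlj, h1, h2, h3, h4⟩ := h
  have e1 : q (size r s) = (l, c) := (hq.idx_eq_iff hn le_rfl).mp h1
  have e2 : q 1 = (j, d) := (hq.idx_eq_iff le_rfl hn).mp h2
  have hn2 : 2 ≤ size r s := by
    by_contra hcon
    rw [show size r s = 1 by omega, e2] at e1
    exact hlj (congrArg Prod.fst e1).symm
  obtain ⟨hy, key⟩ := affine_filling hq hn2 e1 e2 hlj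
  have h5 : wordFilling r s p = wordFilling r s (demote r s (exch 1 (prom r s q))) := h3.trans key
  have h6 := incomparable_prom hq hp hn h4
  rw [← pr_wordFilling hp hn, h5, pr_wordFilling (hy.demote hn) hn, prom_demote] at h6 ⊢
  exact moveSwap_of_exch (hq.prom hn) hy le_rfl hn2 rfl h6

/-- Promotion cancels the outer `demote` of the word form and leaves an exchange at 2.
Incomparability is not part of the move and is proved: the first three cells are (0,0), (1,0),
(0,1), so the exchange trades the descent 1 for the descent 2. -/
theorem moveSwap_prom_of_moveBarOne {p : Word k} (hq : IsStandard r s q) (hp : IsStandard r s p)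
    (hn : 1 ≤ size r s) (h : MoveBarOne r s (wordFilling r s q) (wordFilling r s p)) :
    MoveSwap r s (wordFilling r s (prom r s q)) (wordFilling r s (prom r s p)) := by
  obtain ⟨j, c, h1, h2, h3, h4⟩ := h
  have e1 : q (size r s) = (j, c) := (hq.idx_eq_iff hn le_rfl).mp h3
  have hn2 : 2 ≤ size r s := by
    have h5 : 2 ∈ rowWord (r j) (s j) (wordFilling r s q j) := h1.subset (by simp)
    unfold rowWord at h5
    obtain ⟨d, -, hd⟩ := List.mem_map.mp h5
    rw [← hd]
    exact idx_le _
  obtain ⟨⟨-, f1, f2⟩, b1, b2, b3⟩ :=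
    (triple_sublist_rowWord_iff hq hn le_rfl le_rfl hn (by omega) hn2).mp h1
  have hn3 : 3 ≤ size r s := by
    by_contra hcon
    rw [show size r s = 2 by omega] at b2
    exact ReadBefore.asymm _ _ b2 b2
  have d1 : ¬ Desc (size r s) 1 q := by
    rw [← hq.readBefore_iff le_rfl hn2]
    rintro (h5 | h5)
    · simp only [Nat.reduceAdd] at h5; rw [f1, f2] at h5; exact lt_irrefl _ h5
    · exact ReadBefore.asymm _ _ b3 h5.2
  rw [size_mem_descentSet hq hn2] at h2
  have hp1 := hq.prom hn
  have d2 : ¬ Desc (size r s) 2 (prom r s q) := by rwa [desc_prom hq le_rfl hn3]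
  obtain ⟨x1, x2, x3, hy⟩ := first_letters hp1 hn3 (j := j)
    (by rw [fac_prom_one hq hn, e1]) (by rw [fac_prom_succ hq le_rfl hn2, f1])
    (by rw [fac_prom_succ hq (v := 2) (by omega) hn3, f2]) h2 d2
  have h5 : wordFilling r s p = wordFilling r s (demote r s (exch 2 (prom r s q))) :=
    h4.trans (barOne_filling hq hn3 e1 f1 f2 hy)
  rw [← pr_wordFilling hp hn, h5, pr_wordFilling (hy.demote hn) hn, prom_demote]
  refine moveSwap_of_exch hp1 hy (by omega) hn3 rfl ⟨?_, ?_⟩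
  · refine Set.not_subset.mpr ⟨1, (mem_descentSet hp1 hn).mpr (Or.inl ⟨le_rfl, hn2, h2⟩), ?_⟩
    rw [mem_descentSet hy hn]
    rintro (h6 | h6)
    · have h7 := h6.2.2
      unfold Desc at h7
      rw [exch_left, exch_of_ne _ (by omega) (by omega), x1, x3] at h7
      have := code_sub_of_fac_eq (size r s) (c := (j, 0, 0)) (d := (j, 0, 1)) rfl
      push_cast at this
      omega
    · omega
  · refine Set.not_subset.mpr ⟨2, (mem_descentSet hy hn).mpr (Or.inl ⟨by omega, hn3, ?_⟩), ?_⟩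
    · rw [desc_exch, x2]
      simp only [Nat.reduceAdd]
      rw [x3]
      have := code_sub_of_fac_eq (size r s) (c := (j, 1, 0)) (d := (j, 0, 1)) rfl
      push_cast at this
      omega
    · rw [mem_descentSet hp1 hn]
      rintro (h6 | h6)
      · exact d2 h6.2.2
      · omega

/-- Promotion cancels one of the two outer demotions, and what remains is the word form of \bar t_1
for the promoted word. -/
theorem moveBarOne_prom_of_moveBarLast {p : Word k} (hq : IsStandard r s q) (hp : IsStandard r s p)
    (hn : 1 ≤ size r s) (h : MoveBarLast r s (wordFilling r s q) (wordFilling r s p)) :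
    MoveBarOne r s (wordFilling r s (prom r s q)) (wordFilling r s (prom r s p)) := by
  obtain ⟨j, c, d, b, h1, h2, h3, h4, h5⟩ := h
  have e1 : q (size r s) = (j, c) := (hq.idx_eq_iff hn le_rfl).mp h4
  have f1 := (mem_rowWord_iff hq le_rfl hn).mp h1
  have hn2 : 2 ≤ size r s := by
    by_contra hcon
    rw [show size r s = 1 by omega] at h2
    have h6 : 0 ∈ rowWord (r j) (s j) (wordFilling r s q j) := h2.subset (by simp)
    unfold rowWord at h6
    obtain ⟨a, ha, ha'⟩ := List.mem_map.mp h6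
    rw [mem_cellList] at ha
    exact hq.idx_ne_zero ha.1 ha.2 ha'
  obtain ⟨m, hm⟩ : ∃ m, m + 1 + 1 = size r s := ⟨size r s - 2, by omega⟩
  rw [← hm, Nat.add_sub_cancel] at h2
  obtain ⟨-, f2, d1⟩ := (pair_sublist_rowWord_iff hq (by omega) (by omega)).mp h2
  rw [size_mem_descentSet hq hn2] at h3
  have hn3 : 3 ≤ size r s := by
    by_contra hcon
    -- For n = 2 promotion is a single trivial toggle, so n would be a descent along with n-1.
    obtain rfl : m = 0 := by omega
    refine h3 ?_
    have h6 : prom r s q = toggle (size r s) 1 q := prom_eq (m := 1) hm q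
    rw [h6, toggle_of_near (hq.near_last le_rfl hm ?_)]
    · exact d1
    · rw [f1, show 1 + 1 = size r s from hm, e1]
  obtain ⟨hy, h6⟩ := (barLast_filling hq hm hn3 e1 f2 f1 d1 h3).mp ⟨d, b, h5⟩
  have hp1 := hq.prom hn
  have hx := hy.demote hn
  rw [← pr_wordFilling hp hn, h6, pr_wordFilling (hx.demote hn) hn, prom_demote]
  have g1 : (prom r s q 1).1 = j := by rw [fac_prom_one hq hn, e1]
  have g2 : (prom r s q 2).1 = j := by rw [fac_prom_succ hq le_rfl hn2, f1]
  have gl : (prom r s q (size r s)).1 = j := by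
    rw [← hm, fac_prom_succ hq (by omega) (by omega), f2]
  have d2 : Desc (size r s) 1 (prom r s (prom r s q)) := (desc_prom_prom hq hm).mpr d1
  obtain ⟨-, x2, -, -⟩ := first_letters (hp1.prom hn) hn3 (j := j)
    (by rw [fac_prom_one hp1 hn, gl]) (by rw [fac_prom_succ hp1 le_rfl hn2, g1])
    (by rw [fac_prom_succ hp1 (v := 2) (by omega) hn3, g2]) d2
    (by rw [desc_prom hp1 le_rfl hn3]; exact h3)
  have hr := (hp1.prom hn).row_lt 2 (by omega) hn2
  rw [x2] at hr
  dsimp only at hr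
  have hlast := (hp1.last_eq hn).1
  rw [gl] at hlast
  have y1 : prom r s q 1 = (j, 0, 0) := by rw [hp1.one_eq hn, g1]
  have b3 : ReadBefore (prom r s q 1).2 (prom r s q 2).2 := by
    have h7 := mt (hp1.readBefore_iff le_rfl hn2).mp h3
    have near := hp1.near_one_two hn2 (g1.trans g2.symm)
    rcases hp1.succ_eq_of_near le_rfl hn2 near with h8 | h8
    · exfalso
      refine h7 (Or.inr ⟨by rw [h8], Or.inl ?_⟩)
      rw [h8]
      exact Nat.lt_succ_self _
    · refine Or.inr ?_
      rw [show prom r s q 2 = _ from h8]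
      exact ⟨rfl, Nat.lt_succ_self _⟩
  have b3' : (prom r s q 2).2.1 = 0 := by
    unfold ReadBefore at b3
    rw [y1] at b3
    dsimp only at b3
    omega
  refine ⟨j, (prom r s q (size r s)).2, ?_, ?_, ?_,
    (barOne_filling hp1 hn3 (Prod.ext gl rfl) g1 g2 hy).symm⟩
  · rw [triple_sublist_rowWord_iff hp1 hn le_rfl le_rfl hn (by omega) hn2]
    -- By `first_letters` the factor has a second row; n, in the lower right corner, is therefore
    -- read before 1 and 2, which are in the first row.
    refine ⟨⟨gl, g1, g2⟩, Or.inl ?_, Or.inl ?_, b3⟩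
    · rw [y1]; dsimp only; omega
    · omega
  · rw [size_mem_descentSet hp1 hn2]; exact d2
  · rw [← gl]; exact hp1.idx_apply hn le_rfl

/-! ### Promotion as an automorphism -/

theorem move_prom {T T' : Vertex r s} (hn : 1 ≤ size r s)
    (h : Move r s T.filling T'.filling) :
    Move r s (pr r s T.filling) (pr r s T'.filling) ∨
      Move r s (pr r s T'.filling) (pr r s T.filling) := by
  obtain ⟨q, hq, e⟩ := T.exists_word hn
  rw [e] at h ⊢
  rw [pr_wordFilling hq hn]
  rcases h with h | h
  · obtain ⟨i, hi, hin, h1, h2⟩ := h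
    obtain ⟨hp, e'⟩ := T'.isStandard (q := exch i q) (fun v hv hv' => by
      obtain ⟨h3, h4⟩ := swap_mem hi hin hv hv'
      rw [h1]
      change Equiv.swap i (i + 1) (idx r s q (q (Equiv.swap i (i + 1) v))) = v
      rw [hq.idx_apply h3 h4, Equiv.swap_apply_self])
    rw [e'] at h2 ⊢
    rw [pr_wordFilling hp hn]
    by_cases hf : (q i).1 = (q (i + 1)).1
    · rcases lt_or_gt_of_ne (hq.code_succ_ne hi hin) with hc | hc
      · exact move_prom_of_fac_eq hq hp hi hin hf hc h2
      -- With the contents in the opposite order, the two ends of the edge trade roles.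
      · have := move_prom_of_fac_eq hp (i := i) (by rwa [exch_exch]) hi hin
          (by rw [exch_left, exch_right, hf]) (by rwa [exch_left, exch_right])
          (by rw [exch_exch]; exact ⟨h2.2, h2.1⟩)
        rw [exch_exch] at this
        exact this.symm
    · exact Or.inl (move_prom_of_fac_ne hq hp hi hin hf h2)
  · obtain ⟨p, hp, e'⟩ := T'.exists_word hn
    rw [e'] at h ⊢
    rw [pr_wordFilling hp hn]
    left
    rcases h with h | h | h
    · exact Or.inl (moveSwap_prom_of_moveAffine hq hp hn h)
    · exact Or.inl (moveSwap_prom_of_moveBarOne hq hp hn h)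
    · exact Or.inr (Or.inr (Or.inl (moveBarOne_prom_of_moveBarLast hq hp hn h)))

/-- A vertex is determined by the n letters of its word, whose coordinates are below n; the
remainders modulo n only serve to land in `Fin`. -/
instance Vertex.finite : Finite (Vertex r s) := by
  rcases Nat.eq_zero_or_pos (size r s) with hn | hn
  · have hsub : Subsingleton (Vertex r s) := by
      refine ⟨fun T T' => Vertex.filling_injective ?_⟩
      have h : ∀ T : Vertex r s, T.filling = fun _ _ _ => 0 := by
        intro T
        funext j a b
        refine (T.1 j).zeros ?_
        rw [mem_rectangle]
        rintro ⟨ha, hb⟩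
        have := area_le_size r s j
        have := Nat.mul_pos (Nat.pos_of_ne_zero (by omega : r j ≠ 0))
          (Nat.pos_of_ne_zero (by omega : s j ≠ 0))
        omega
      rw [h T, h T']
    exact Finite.of_subsingleton
  · choose w hw using fun T : Vertex r s => T.exists_word hn
    refine Finite.of_injective (β := Fin (size r s + 1) → Fin k × Fin (size r s) × Fin (size r s))
      (fun T v => ((w T v).1, ⟨(w T v).2.1 % size r s, Nat.mod_lt _ hn⟩,
        ⟨(w T v).2.2 % size r s, Nat.mod_lt _ hn⟩)) fun T T' h => ?_
    apply Vertex.filling_injective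
    have h1 : ∀ v, 1 ≤ v → v ≤ size r s → w T v = w T' v := by
      intro v h2 h3
      have h4 := congrFun h ⟨v, by omega⟩
      simp only [Prod.mk.injEq, Fin.mk.injEq] at h4
      rw [Nat.mod_eq_of_lt ((hw T).1.row_lt_size h2 h3),
        Nat.mod_eq_of_lt ((hw T').1.row_lt_size h2 h3),
        Nat.mod_eq_of_lt ((hw T).1.col_lt_size h2 h3),
        Nat.mod_eq_of_lt ((hw T').1.col_lt_size h2 h3)] at h4
      exact Prod.ext h4.1 (Prod.ext h4.2.1 h4.2.2)
    exact ((T.isStandard (q := w T') fun v h2 h3 => by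
      rw [← h1 v h2 h3, (hw T).2]; exact (hw T).1.idx_apply h2 h3).2).trans (hw T').2.symm

theorem exists_promEquiv (hn : 1 ≤ size r s) :
    ∃ φ : Equiv.Perm (Vertex r s), ∀ T, (φ T).filling = pr r s T.filling := by
  choose w hw using fun T : Vertex r s => T.exists_word hn
  have h1 : ∀ T, (((hw T).1.prom hn).toVertex).filling = pr r s T.filling := by
    intro T
    rw [IsStandard.filling_toVertex, (hw T).2, pr_wordFilling (hw T).1 hn]
  have h2 : Function.Surjective fun T : Vertex r s => ((hw T).1.prom hn).toVertex := by
    intro T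
    refine ⟨((hw T).1.demote hn).toVertex, Vertex.filling_injective ?_⟩
    rw [h1, IsStandard.filling_toVertex, pr_wordFilling ((hw T).1.demote hn) hn, prom_demote,
      (hw T).2]
  exact ⟨Equiv.ofBijective _ ⟨Finite.injective_iff_surjective.mpr h2, h2⟩, h1⟩

/-- A permutation of the vertices of a finite graph that maps edges to edges is an automorphism. -/
theorem adj_iff_of_perm {V : Type*} [Finite V] {G : SimpleGraph V} (φ : Equiv.Perm V)
    (h : ∀ a b, G.Adj a b → G.Adj (φ a) (φ b)) (a b : V) : G.Adj (φ a) (φ b) ↔ G.Adj a b := by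
  refine ⟨fun hab => ?_, h a b⟩
  have hpow : ∀ (m : ℕ) (x y : V), G.Adj x y → G.Adj ((φ ^ m) x) ((φ ^ m) y) := by
    intro m
    induction m with
    | zero => exact fun _ _ h => h
    | succ m ih =>
      intro x y hxy
      rw [pow_succ', Equiv.Perm.mul_apply, Equiv.Perm.mul_apply]
      exact h _ _ (ih x y hxy)
  -- The inverse of φ is a power of φ, so it maps edges to edges as well.
  have h1 := hpow (orderOf φ - 1) _ _ hab
  have h2 : φ ^ (orderOf φ - 1) * φ = 1 := by
    rw [← pow_succ, Nat.sub_add_cancel (orderOf_pos φ), pow_orderOf_eq_one]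
  rwa [← Equiv.Perm.mul_apply, ← Equiv.Perm.mul_apply, h2] at h1

theorem image_descentSet_pr (T : Vertex r s) (hn : 1 ≤ size r s) :
    (fun i : ℕ => (i : ZMod (size r s))) '' descentSet r s (pr r s T.filling) =
      (fun i : ℕ => (i : ZMod (size r s)) + 1) '' descentSet r s T.filling := by
  obtain ⟨q, hq, e⟩ := T.exists_word hn
  rw [e, pr_wordFilling hq hn]
  ext x
  constructor
  · rintro ⟨i, hi, rfl⟩
    obtain ⟨h1, h2⟩ := descentSet_subset (hq.prom hn) hn hi
    obtain ⟨i, rfl⟩ : ∃ l, i = l + 1 := ⟨i - 1, by omega⟩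
    rcases Nat.eq_zero_or_pos i with rfl | h3
    · exact ⟨size r s, (one_mem_descentSet_prom hq hn).mp hi, by simp⟩
    · exact ⟨i, (succ_mem_descentSet_prom hq h3 h2).mp hi, by push_cast; rfl⟩
  · rintro ⟨i, hi, rfl⟩
    obtain ⟨h1, h2⟩ := descentSet_subset hq hn hi
    rcases Nat.lt_or_ge i (size r s) with h3 | h3
    · exact ⟨i + 1, (succ_mem_descentSet_prom hq h1 h3).mpr hi, by push_cast; rfl⟩
    · obtain rfl : i = size r s := by omega
      exact ⟨1, (one_mem_descentSet_prom hq hn).mpr hi, by simp⟩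

end KRDual

theorem propositionp {k : ℕ} (r s : Fin k → ℕ) (hr : ∀ i, 0 < r i) (hs : ∀ i, 0 < s i) :
    ∃ φ : KRDual.krGraph r s ≃g KRDual.krGraph r s,
      (∀ T : KRDual.Vertex r s, (φ T).filling = KRDual.pr r s T.filling) ∧
      ∀ T : KRDual.Vertex r s,
        (fun i : ℕ => (i : ZMod (KRDual.size r s))) ''
            KRDual.descentSet r s (KRDual.pr r s T.filling) =
          (fun i : ℕ => (i : ZMod (KRDual.size r s)) + 1) ''
            KRDual.descentSet r s T.filling := by
  rcases Nat.eq_zero_or_pos (KRDual.size r s) with hn | hn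
  -- Nonempty rectangles of total size 0 means no factors at all; the identity serves, and all
  -- descent sets are empty.
  · have hk : IsEmpty (Fin k) := ⟨fun j => by
      have := KRDual.area_le_size r s j
      have := Nat.mul_pos (hr j) (hs j)
      omega⟩
    have h0 : ∀ T : Fin k → KRDual.Filling, KRDual.descentSet r s T = ∅ := by
      intro T
      have h1 : ∀ T : Fin k → KRDual.Filling, KRDual.classicalDescents r s T = ∅ := fun T =>
        Set.eq_empty_of_forall_notMem fun i hi => by
          have := hi.2.1
          omega
      unfold KRDual.descentSet
      rw [h1, h1]
      simp
    refine ⟨SimpleGraph.Iso.refl, fun T => funext fun j => isEmptyElim j, fun T => ?_⟩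
    rw [h0, h0, Set.image_empty, Set.image_empty]
  · obtain ⟨φ, hφ⟩ := KRDual.exists_promEquiv (r := r) (s := s) hn
    have hadj : ∀ T T', (KRDual.krGraph r s).Adj T T' → (KRDual.krGraph r s).Adj (φ T) (φ T') := by
      intro T T' h
      unfold KRDual.krGraph at h ⊢
      rw [SimpleGraph.fromRel_adj] at h ⊢
      refine ⟨φ.injective.ne h.1, ?_⟩
      rw [hφ, hφ]
      rcases h.2 with h1 | h1
      · exact KRDual.move_prom hn h1
      · exact (KRDual.move_prom hn h1).symm
    exact ⟨⟨φ, KRDual.adj_iff_of_perm φ hadj _ _⟩, hφ, fun T => KRDual.image_descentSet_pr T hn⟩
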